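/- **Theorem (Algorithm 1 runs in $O(nm)$ time).** A directed graph $G=(V,E)$ with $V\neq\emptyset$ is *strongly biconnected* if it is strongly connected and its underlying undirected graph has no articulation point; an undirected graph is *biconnected* if it is connected and has no articulation point. The *strongly biconnected components* of a directed graph are its maximal vertex sets that induce a strongly biconnected subgraph. Let $n=|V|$ and $m=|E|$. Consider the following algorithm (Algorithm 1), whose input is a strongly biconnected directed graph $G=(V,E)$. 1. Select a vertex $v\in V$. Construct a spanning tree $T$ of $G$ rooted at $v$ (all edges directed away from $v$) and a spanning tree $T_v$ rooted at $v$ of the reversed graph $G_r=(V,\{(u,w):(w,u)\in E\})$. Put $E_v=T\cup\{(w,u):(u,w)\in T_v\}$. 2. While the underlying undirected graph of $G_v=(V,E_v)$ is not biconnected: compute the strongly biconnected components of $G_v$, find an edge $(u,w)\in E\setminus E_v$ such that $u$ and $w$ do not belong to the same strongly biconnected component of $G_v$, and replace $E_v$ by $E_v\cup\{(u,w)\}$. 3. Output $E_v$. Then the following hold. (a) On every strongly biconnected input, whatever choices are made in the algorithm, the while loop is executed at most $n$ times, and as long as the underlying graph of $G_v$ is not biconnected an edge $(u,w)$ as required exists.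 (b) Algorithm 1 can be implemented in $O(nm)$ time: there are one program for the unit-cost random access machine, whose only arithmetic is adding or subtracting one, and a constant $C$ such that on every strongly biconnected input graph, with vertices $0,\dots,n-1$ and with its $m$ edges given as a list in any order, the program carries out a complete execution of Algorithm 1 and halts after at most $C\cdot\max(1,nm)$ steps. More precisely, it computes $T$, $T_v$ and the initial set $E_v$ within $C(n+m)$ steps; each iteration of the while loop, in which the strongly biconnected components of $G_v$ are computed and stored and an edge is added to $E_v$, takes at most $C(n+m)$ steps; and after the last iteration it halts within $C(n+m)$ steps with the final set $E_v$ in memory. -/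

import Mathlib

/-! ### Strongly biconnected directed graphs -/

/-- `x` is an articulation point of the undirected graph `H`: deleting `x` separates two other
vertices that are connected in `H`. -/
def IsArticulationPoint {V : Type*} (H : SimpleGraph V) (x : V) : Prop :=
  ∃ (u w : V) (hu : u ≠ x) (hw : w ≠ x), H.Reachable u w ∧
    ¬ (H.induce {y : V | y ≠ x}).Reachable ⟨u, hu⟩ ⟨w, hw⟩

/-- An undirected graph is biconnected if it is connected and has no articulation point. -/
def IsBiconnected {V : Type*} (H : SimpleGraph V) : Prop :=
  H.Connected ∧ ∀ x : V, ¬ IsArticulationPoint H x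

/-- The directed graph `(V, F)` with edge set `F`; the pair `(u, w)` is the edge from `u` to `w`. -/
def digraphOf {V : Type*} (F : Set (V × V)) : Digraph V where
  Adj u w := (u, w) ∈ F

/-- There is a directed path from `u` to `w`. -/
def Digraph.HasPath {V : Type*} (D : Digraph V) (u w : V) : Prop :=
  Relation.ReflTransGen D.Adj u w

/-- The subgraph of `D` induced by a set `S` of vertices. -/
def Digraph.inducedOn {V : Type*} (D : Digraph V) (S : Set V) : Digraph S where
  Adj u w := D.Adj u w

/-- A nonempty directed graph is strongly biconnected if it is strongly connected and its underlying
undirected graph has no articulation point. -/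
def Digraph.StronglyBiconnected {V : Type*} (D : Digraph V) : Prop :=
  Nonempty V ∧ (∀ u w : V, D.HasPath u w) ∧
    ∀ x : V, ¬ IsArticulationPoint D.toSimpleGraphInclusive x

/-- `S` is (the vertex set of) a strongly biconnected component of `D`: a maximal set of vertices
that induces a strongly biconnected subgraph. -/
def Digraph.IsSBComponent {V : Type*} (D : Digraph V) (S : Set V) : Prop :=
  Maximal (fun S' : Set V => (D.inducedOn S').StronglyBiconnected) S

/-! ### The algorithm, with all its choices -/

/-- The edge set of the reversed graph. -/
def revEdges {V : Type*} (F : Set (V × V)) : Set (V × V) := {p | p.swap ∈ F}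

/-- `T` is a spanning tree rooted at `v` of `(V, E)`: edges of `E` such that no edge enters `v`,
exactly one edge enters each other vertex, and every vertex is reached from `v`. -/
structure IsRootedSpanningTree {V : Type*} (E : Set (V × V)) (v : V) (T : Set (V × V)) : Prop where
  subset : T ⊆ E
  no_edge_into_root : ∀ u : V, (u, v) ∉ T
  unique_parent : ∀ w : V, w ≠ v → ∃! u : V, (u, w) ∈ T
  reach : ∀ w : V, (digraphOf T).HasPath v w

/-- One iteration of the while loop, from edge set `F` to edge set `F'`: the underlying graph of
`(V, F)` is not biconnected, and `F'` is `F` together with an edge of `E \ F` whose ends do not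
belong to the same strongly biconnected component of `(V, F)`. -/
def AugmentStep {V : Type*} (E F F' : Set (V × V)) : Prop :=
  ¬ IsBiconnected (digraphOf F).toSimpleGraphInclusive ∧
    ∃ u w : V, (u, w) ∈ E \ F ∧
      (¬ ∃ S : Set V, (digraphOf F).IsSBComponent S ∧ u ∈ S ∧ w ∈ S) ∧
      F' = insert (u, w) F

/-- An execution of the algorithm on `(V, E)` up to (and including) the `k`-th iteration of the while
loop: `T` is the spanning tree of `(V, E)` rooted at `v`, `T'` the spanning tree of the reversed
graph rooted at `v`, and `F i` is the edge set that has been built after `i` iterations. -/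
structure PartialRun {V : Type*} (E : Set (V × V)) (v : V) (T T' : Set (V × V))
    (k : ℕ) (F : ℕ → Set (V × V)) : Prop where
  tree : IsRootedSpanningTree E v T
  revTree : IsRootedSpanningTree (revEdges E) v T'
  init : F 0 = T ∪ revEdges T'
  augment : ∀ i < k, AugmentStep E (F i) (F (i + 1))

/-- A complete execution with exactly `k` iterations of the while loop, and output `F k`. -/
structure CompleteRun {V : Type*} (E : Set (V × V)) (v : V) (T T' : Set (V × V))
    (k : ℕ) (F : ℕ → Set (V × V)) : Prop extends PartialRun E v T T' k F where
  done : IsBiconnected (digraphOf (F k)).toSimpleGraphInclusive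

/-! ### The machine model

A random access machine with unit cost.  Its memory consists of scalar variables and of arrays, all
holding natural numbers; a program, being a finite object, names only finitely many of them.  The
only arithmetic is adding or subtracting one, so a step raises the largest number in memory by at
most one unless it writes a constant of the program: after `t` steps all numbers have
`O(log (n + m + t))` bits, and no power is hidden in long words. -/

namespace RAM

/-- The memory: `var x` is the scalar variable `x`, and `arr a i` is entry `i` of array `a`. -/
structure Store where
  var : ℕ → ℕ
  arr : ℕ → ℕ → ℕ

/-- Tests on two scalar variables. -/
inductive Test where
  | eq (x y : ℕ)
  | ne (x y : ℕ)
  | lt (x y : ℕ)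

def Test.holds : Test → Store → Bool
  | .eq x y, s => decide (s.var x = s.var y)
  | .ne x y, s => decide (s.var x ≠ s.var y)
  | .lt x y, s => decide (s.var x < s.var y)

/-- Programs. -/
inductive Cmd where
  /-- `x := c` -/
  | const (x c : ℕ)
  /-- `x := y` -/
  | copy (x y : ℕ)
  /-- `x := x + 1` -/
  | inc (x : ℕ)
  /-- `x := x - 1` (and `0` stays `0`) -/
  | dec (x : ℕ)
  /-- `x := a[y]` -/
  | load (x a y : ℕ)
  /-- `a[y] := x` -/
  | store (a y x : ℕ)
  /-- do nothing -/
  | skip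
  /-- first `p`, then `q` -/
  | seq (p q : Cmd)
  /-- if `b` then `p` else `q` -/
  | ite (b : Test) (p q : Cmd)
  /-- while `b` do `p` -/
  | while (b : Test) (p : Cmd)

def Store.setVar (s : Store) (x c : ℕ) : Store :=
  { s with var := Function.update s.var x c }

def Store.setArr (s : Store) (a i c : ℕ) : Store :=
  { s with arr := Function.update s.arr a (Function.update (s.arr a) i c) }

/-- A configuration: the stack of commands that remain to be executed, and the memory. -/
structure Config where
  todo : List Cmd
  mem : Store

/-- One step of the machine.  Each assignment, each test and each unfolding of a sequence costs one
step. -/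
def step : Config → Config
  | ⟨[], s⟩ => ⟨[], s⟩
  | ⟨.const x c :: k, s⟩ => ⟨k, s.setVar x c⟩
  | ⟨.copy x y :: k, s⟩ => ⟨k, s.setVar x (s.var y)⟩
  | ⟨.inc x :: k, s⟩ => ⟨k, s.setVar x (s.var x + 1)⟩
  | ⟨.dec x :: k, s⟩ => ⟨k, s.setVar x (s.var x - 1)⟩
  | ⟨.load x a y :: k, s⟩ => ⟨k, s.setVar x (s.arr a (s.var y))⟩
  | ⟨.store a y x :: k, s⟩ => ⟨k, s.setArr a (s.var y) (s.var x)⟩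
  | ⟨.skip :: k, s⟩ => ⟨k, s⟩
  | ⟨.seq p q :: k, s⟩ => ⟨p :: q :: k, s⟩
  | ⟨.ite b p q :: k, s⟩ => if b.holds s then ⟨p :: k, s⟩ else ⟨q :: k, s⟩
  | ⟨.while b p :: k, s⟩ => if b.holds s then ⟨p :: .while b p :: k, s⟩ else ⟨k, s⟩

/-- The configuration after `t` steps of the program `P` started with memory `s`. -/
def configAt (P : Cmd) (s : Store) (t : ℕ) : Config := step^[t] ⟨[P], s⟩

/-- The memory after `t` steps. -/
def memAt (P : Cmd) (s : Store) (t : ℕ) : Store := (configAt P s t).mem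

/-- The program has stopped after at most `t` steps. -/
def HaltedAt (P : Cmd) (s : Store) (t : ℕ) : Prop := (configAt P s t).todo = []

/-! ### Input and output conventions

The vertices are `0, …, n - 1`, and the edges are numbered `0, …, m - 1` by a list `e`.
Variable 0 holds `n`, variable 1 holds `m`; arrays 0 and 1 hold the tails and the heads of the edges.
Everything else is zero at the start.  The program uses variable 2 for the root, arrays 2, 3, 4 for
the edge sets of the two trees and for the edge set under construction, and variable 3 and
arrays 5, 6 for the strongly biconnected components.  All the rest is working memory. -/

/-- The memory at the start. -/
def inputStore {n m : ℕ} (e : Fin m → Fin n × Fin n) : Store where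
  var x := if x = 0 then n else if x = 1 then m else 0
  arr a j :=
    if h : j < m then
      if a = 0 then ((e ⟨j, h⟩).1 : ℕ) else if a = 1 then ((e ⟨j, h⟩).2 : ℕ) else 0
    else 0

/-- Array `a` marks the members of `F` among the edges in the list `e`. -/
def HoldsEdges {n m : ℕ} (e : Fin m → Fin n × Fin n) (a : ℕ) (F : Set (Fin n × Fin n))
    (s : Store) : Prop :=
  ∀ j : Fin m, s.arr a j ≠ 0 ↔ e j ∈ F

/-- The numbers in use as names of components: the first `s.var 3` entries of array 6. -/
def compNames (s : Store) : Set ℕ := {c | ∃ j < s.var 3, s.arr 6 j = c}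

/-- The vertices of the component named `c`: the entries of array 5 that stand beside a `c` in
array 6. -/
def compVertices (n : ℕ) (s : Store) (c : ℕ) : Set (Fin n) :=
  {u | ∃ j < s.var 3, s.arr 6 j = c ∧ s.arr 5 j = (u : ℕ)}

/-- The memory contains the list of the strongly biconnected components of `(V, F)`, each under
exactly one name. -/
def HoldsComponents {n : ℕ} (F : Set (Fin n × Fin n)) (s : Store) : Prop :=
  (∀ c ∈ compNames s, (digraphOf F).IsSBComponent (compVertices n s c)) ∧
    ∀ S : Set (Fin n), (digraphOf F).IsSBComponent S →
      ∃! c : ℕ, c ∈ compNames s ∧ compVertices n s c = S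

/-- On the edge list `e`, the program `P` carries out the run of the algorithm that is given by
`v`, `T`, `T'`, `k`, `F`, and stops after at most `total` steps, where `lin` bounds the time until the
while loop is reached, the time of each of its iterations, and the time after the last iteration:

* after `a` steps the root `v` and the tree `T` have been computed, after `b` steps the tree `T'`;
* after `t i` steps the while loop has been passed `i` times and the current edge set is `F i`;
* during the iteration from `t i` to `t (i + 1)`, after `c i` steps, the strongly biconnected
  components of the current graph have been computed;
* after `tEnd` steps the program has stopped, with the output `F k`. -/
def Executes {n m : ℕ} (P : Cmd) (e : Fin m → Fin n × Fin n) (v : Fin n)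
    (T T' : Set (Fin n × Fin n)) (k : ℕ) (F : ℕ → Set (Fin n × Fin n)) (lin total : ℕ) : Prop :=
  ∃ (a b : ℕ) (t c : ℕ → ℕ) (tEnd : ℕ),
    (a ≤ b ∧ b ≤ t 0 ∧ t 0 ≤ lin) ∧
    ((memAt P (inputStore e) a).var 2 = (v : ℕ) ∧
      HoldsEdges e 2 T (memAt P (inputStore e) a)) ∧
    HoldsEdges e 3 (revEdges T') (memAt P (inputStore e) b) ∧
    (∀ i ≤ k, HoldsEdges e 4 (F i) (memAt P (inputStore e) (t i))) ∧
    (∀ i < k, t i ≤ c i ∧ c i ≤ t (i + 1) ∧ t (i + 1) ≤ t i + lin ∧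
      HoldsComponents (F i) (memAt P (inputStore e) (c i))) ∧
    (t k ≤ tEnd ∧ tEnd ≤ t k + lin ∧ tEnd ≤ total) ∧
    HaltedAt P (inputStore e) tEnd ∧
    HoldsEdges e 4 (F k) (memAt P (inputStore e) tEnd)

end RAM

/-!
Two facts carry the theorem.  Call two vertices of the undirected graph `H` underlying `(V, F)`
*separated* if the deletion of a third vertex disconnects them, and a set of vertices *nonseparable*
if no two of its members are separated.

*Components.*  If `(V, F)` is strongly connected, then its strongly biconnected components are the
maximal nonseparable sets (`isSBComponent_iff_maximal_nonSep`): a walk that leaves a maximal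
nonseparable set must come back at the vertex where it left, so that excursions can be cut out of
directed paths and of paths that avoid a given vertex.  As the two trees make every `(V, F)` that
occurs strongly connected, an edge may be added exactly if its ends are separated.  While `H` has an
articulation point `x`, a path of the input graph around `x` contains such an edge
(`exists_separated_edge`).  Adding it lowers the sum over all `x` of the number of components of
`H - x`; this sum is at most `2 n - 2` because `H` has a spanning tree, and at least `n` if `n ≥ 2`,
so there are at most `n` iterations (`PartialRun.le_card`).

*Linear time.*  In a depth-first search tree of `H` all edges join ancestors to descendants.  Let a
vertex inherit the label of its parent if an edge leads from its subtree beyond the parent, and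
start a new label otherwise.  Then the maximal nonseparable sets are the sets of all vertices with
the same label `c`, together with the parent of `c` (`maximal_nonSep_labelBlock`,
`exists_labelBlock_of_maximal`), and the labels tell in constant time whether two vertices are
separated (`nonSep_pair_iff`).

The program finds both spanning trees and all depth-first search trees with one search routine
(`search`) on linked lists of arcs, whose state is described by `SearchState`.  In each iteration it
computes the labels and the list of components, and looks for an edge with separated ends.  If there
is none, the graph is biconnected, and it stops.  All loops but the main one have bodies without
loops; their effect is computed by `Cmd.exec`, and `achieves_while` bounds their time.
-/

/-! ### Vertices that no third vertex separates -/

/-- The undirected graph underlying `(V, F)`. -/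
abbrev underlying {V : Type*} (F : Set (V × V)) : SimpleGraph V :=
  (digraphOf F).toSimpleGraphInclusive

theorem underlying_adj {V : Type*} {F : Set (V × V)} {u w : V} :
    (underlying F).Adj u w ↔ u ≠ w ∧ ((u, w) ∈ F ∨ (w, u) ∈ F) := by
  simp [underlying, Digraph.toSimpleGraphInclusive, SimpleGraph.fromRel_adj, digraphOf]

theorem underlying_mono {V : Type*} {F F' : Set (V × V)} (h : F ⊆ F') :
    underlying F ≤ underlying F' := by
  intro u w huw
  rw [underlying_adj] at huw ⊢
  exact ⟨huw.1, huw.2.imp (fun x => h x) (fun x => h x)⟩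

/-- Some path of `H` from `a` to `b` avoids the vertex `x`.  (For `a = b` this holds by convention,
even if `a = x`.) -/
def Avoids {V : Type*} (H : SimpleGraph V) (x a b : V) : Prop :=
  Relation.ReflTransGen (fun u w => H.Adj u w ∧ u ≠ x ∧ w ≠ x) a b

namespace Avoids

variable {V : Type*} {H : SimpleGraph V} {x a b c : V}

theorem refl (a : V) : Avoids H x a a := Relation.ReflTransGen.refl

theorem trans (h : Avoids H x a b) (h' : Avoids H x b c) : Avoids H x a c :=
  Relation.ReflTransGen.trans h h'

theorem symm (h : Avoids H x a b) : Avoids H x b a := by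
  refine Relation.reflTransGen_swap.1 (Relation.ReflTransGen.mono ?_ _ _ h)
  exact fun u w ⟨h1, h2, h3⟩ => ⟨h1.symm, h3, h2⟩

theorem of_adj (h : H.Adj a b) (ha : a ≠ x) (hb : b ≠ x) : Avoids H x a b :=
  Relation.ReflTransGen.single ⟨h, ha, hb⟩

end Avoids

section Separation

variable {V : Type*}

/-- A path of the relation `r` all of whose vertices lie in `S` is a path in the subtype `S`. -/
theorem reflTransGen_subtype {r : V → V → Prop} {S : Set V} {a b : V} (ha : a ∈ S)
    (h : Relation.ReflTransGen (fun u w => r u w ∧ w ∈ S) a b) :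
    ∃ hb : b ∈ S, Relation.ReflTransGen (fun u w : S => r u w) ⟨a, ha⟩ ⟨b, hb⟩ := by
  induction h with
  | refl => exact ⟨ha, .refl⟩
  | tail _ h2 ih =>
    obtain ⟨hb, ih⟩ := ih
    exact ⟨h2.2, ih.tail h2.1⟩

theorem reachable_induce_ne_iff {H : SimpleGraph V} {x u w : V} (hu : u ≠ x) (hw : w ≠ x) :
    (H.induce {y : V | y ≠ x}).Reachable ⟨u, hu⟩ ⟨w, hw⟩ ↔ Avoids H x u w := by
  rw [SimpleGraph.reachable_iff_reflTransGen]
  constructor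
  · intro h
    exact h.lift Subtype.val (fun a b hab => ⟨hab, a.2, b.2⟩)
  · intro h
    obtain ⟨_, h⟩ := reflTransGen_subtype (S := {y : V | y ≠ x}) (r := H.Adj) hu
      (Relation.ReflTransGen.mono (fun _ _ h => ⟨h.1, h.2.2⟩) _ _ h)
    exact h

theorem isArticulationPoint_iff {H : SimpleGraph V} {x : V} :
    IsArticulationPoint H x ↔
      ∃ u w, u ≠ x ∧ w ≠ x ∧ H.Reachable u w ∧ ¬ Avoids H x u w := by
  constructor
  · rintro ⟨u, w, hu, hw, h1, h2⟩
    exact ⟨u, w, hu, hw, h1, fun h => h2 ((reachable_induce_ne_iff hu hw).2 h)⟩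
  · rintro ⟨u, w, hu, hw, h1, h2⟩
    exact ⟨u, w, hu, hw, h1, fun h => h2 ((reachable_induce_ne_iff hu hw).1 h)⟩

/-- No two vertices of `S` are separated in `H` by the deletion of a third vertex, which need not
lie in `S`. -/
def NonSep (H : SimpleGraph V) (S : Set V) : Prop :=
  ∀ a ∈ S, ∀ b ∈ S, ∀ x, x ≠ a → x ≠ b → Avoids H x a b

theorem NonSep.singleton (H : SimpleGraph V) (a : V) : NonSep H {a} := by
  rintro _ rfl _ rfl x _ _
  exact .refl _

theorem NonSep.pair {H : SimpleGraph V} {a b : V}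
    (h : ∀ x, x ≠ a → x ≠ b → Avoids H x a b) : NonSep H {a, b} := by
  rintro u (rfl | rfl) w (rfl | rfl) x hu hw
  · exact .refl _
  · exact h x hu hw
  · exact (h x hw hu).symm
  · exact .refl _

theorem isBiconnected_iff_nonSep {H : SimpleGraph V} (hH : H.Connected) :
    IsBiconnected H ↔ NonSep H Set.univ := by
  constructor
  · intro h a _ b _ x hxa hxb
    by_contra hc
    exact h.2 x (isArticulationPoint_iff.2 ⟨a, b, hxa.symm, hxb.symm, hH.preconnected a b, hc⟩)
  · intro h
    refine ⟨hH, fun x hx => ?_⟩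
    obtain ⟨u, w, hu, hw, _, hn⟩ := isArticulationPoint_iff.1 hx
    exact hn (h u trivial w trivial x hu.symm hw.symm)

/-- A walk that leaves a maximal nonseparable set returns to it at the vertex where it left:
otherwise the first vertex outside could be added to the set.  Hence the excursions can be cut out
of any walk between two vertices of the set. -/
theorem reflTransGen_of_maximal_nonSep {H : SimpleGraph V} {S : Set V}
    (hS : Maximal (NonSep H) S) {r : V → V → Prop} (hr : ∀ u w, r u w → u = w ∨ H.Adj u w)
    {a b : V} (ha : a ∈ S) (hb : b ∈ S) (h : Relation.ReflTransGen r a b) :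
    Relation.ReflTransGen (fun u w => r u w ∧ w ∈ S) a b := by
  -- The induction follows the walk; while it is outside `S`, it remembers the exit `s` and the
  -- first vertex `z` outside.
  suffices key : (b ∈ S ∧ Relation.ReflTransGen (fun u w => r u w ∧ w ∈ S) a b) ∨
      (b ∉ S ∧ ∃ s ∈ S, ∃ z ∉ S, Relation.ReflTransGen (fun u w => r u w ∧ w ∈ S) a s ∧
        H.Adj s z ∧ Relation.ReflTransGen (fun u w => H.Adj u w ∧ u ∉ S ∧ w ∉ S) z b) by
    rcases key with h | h
    · exact h.2
    · exact absurd hb h.1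
  clear hb
  induction h with
  | refl => exact Or.inl ⟨ha, .refl⟩
  | @tail b c _ hbc ih =>
    rcases hr b c hbc with rfl | hadj
    · exact ih
    rcases ih with ⟨hb, hab⟩ | ⟨hb, s, hs, z, hz, has, hsz, hzb⟩
    · by_cases hc : c ∈ S
      · exact Or.inl ⟨hc, hab.tail ⟨hbc, hc⟩⟩
      · exact Or.inr ⟨hc, b, hb, c, hc, hab, hadj, .refl⟩
    · by_cases hc : c ∈ S
      · refine Or.inl ⟨hc, ?_⟩
        by_cases hcs : c = s
        · exact hcs ▸ has
        exfalso
        have hzt : ∀ t ∈ S, ∀ y, y ≠ z → y ≠ t → Avoids H y z t := by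
          intro t ht y hyz hyt
          by_cases hys : y = s
          · subst hys
            have h1 : Avoids H y z b := by
              refine Relation.ReflTransGen.mono (fun u w h => ?_) _ _ hzb
              exact ⟨h.1, fun e => h.2.1 (e ▸ hs), fun e => h.2.2 (e ▸ hs)⟩
            have h2 : Avoids H y b c := .of_adj hadj (fun e => hb (e ▸ hs)) hcs
            exact (h1.trans h2).trans (hS.prop c hc t ht y (Ne.symm hcs) hyt)
          · exact (Avoids.of_adj hsz.symm hyz.symm (Ne.symm hys)).trans
              (hS.prop s hs t ht y hys hyt)
        have hins : NonSep H (insert z S) := by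
          rintro u (rfl | hu) w (rfl | hw) x hxu hxw
          · exact .refl _
          · exact hzt w hw x hxu hxw
          · exact (hzt u hu x hxw hxu).symm
          · exact hS.prop u hu w hw x hxu hxw
        exact hz (hS.le_of_ge hins (Set.subset_insert z S) (Set.mem_insert z S))
      · exact Or.inr ⟨hc, s, hs, z, hz, has, hsz, hzb.tail ⟨hadj, hb, hc⟩⟩

theorem inducedOn_underlying_adj {D : Digraph V} {S : Set V} {u w : S} :
    (D.inducedOn S).toSimpleGraphInclusive.Adj u w ↔ D.toSimpleGraphInclusive.Adj u w := by
  simp [Digraph.toSimpleGraphInclusive, SimpleGraph.fromRel_adj, Digraph.inducedOn,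
    Subtype.ext_iff]

/-- A directed path is a path of the underlying undirected graph, once loops are dropped. -/
theorem Digraph.HasPath.reachable {D : Digraph V} {u w : V} (h : D.HasPath u w) :
    D.toSimpleGraphInclusive.Reachable u w := by
  induction h with
  | refl => exact .refl _
  | @tail b c _ hbc ih =>
    by_cases e : b = c
    · exact e ▸ ih
    · exact ih.trans (SimpleGraph.Adj.reachable
        (by simp [Digraph.toSimpleGraphInclusive, SimpleGraph.fromRel_adj, e, hbc]))

theorem connected_of_hasPath [Nonempty V] {D : Digraph V} (h : ∀ u w, D.HasPath u w) :
    D.toSimpleGraphInclusive.Connected :=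
  ⟨fun u w => (h u w).reachable⟩

theorem Digraph.StronglyBiconnected.nonSep {D : Digraph V} {S : Set V}
    (h : (D.inducedOn S).StronglyBiconnected) : NonSep D.toSimpleGraphInclusive S := by
  obtain ⟨_, hc, hart⟩ := h
  intro a ha b hb x hxa hxb
  have hreach : (D.inducedOn S).toSimpleGraphInclusive.Reachable ⟨a, ha⟩ ⟨b, hb⟩ :=
    (hc _ _).reachable
  by_cases hx : x ∈ S
  · have h1 : Avoids (D.inducedOn S).toSimpleGraphInclusive ⟨x, hx⟩ ⟨a, ha⟩ ⟨b, hb⟩ := by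
      by_contra hn
      exact hart ⟨x, hx⟩ (isArticulationPoint_iff.2 ⟨_, _, by simpa using hxa.symm,
        by simpa using hxb.symm, hreach, hn⟩)
    exact h1.lift Subtype.val (fun u w huw => ⟨inducedOn_underlying_adj.1 huw.1,
      fun e => huw.2.1 (Subtype.ext e), fun e => huw.2.2 (Subtype.ext e)⟩)
  · rw [SimpleGraph.reachable_iff_reflTransGen] at hreach
    exact hreach.lift Subtype.val (fun u w huw => ⟨inducedOn_underlying_adj.1 huw,
      fun e => hx (e ▸ u.2), fun e => hx (e ▸ w.2)⟩)

theorem Maximal.stronglyBiconnected {D : Digraph V} (hD : ∀ u w, D.HasPath u w) {S : Set V}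
    (hS : Maximal (NonSep D.toSimpleGraphInclusive) S) (hne : S.Nonempty) :
    (D.inducedOn S).StronglyBiconnected := by
  refine ⟨hne.to_subtype, ?_, ?_⟩
  · rintro ⟨a, ha⟩ ⟨b, hb⟩
    have h1 := reflTransGen_of_maximal_nonSep hS (r := D.Adj) (fun u w h => ?_) ha hb (hD a b)
    · exact (reflTransGen_subtype ha h1).2
    · by_cases e : u = w
      · exact Or.inl e
      · exact Or.inr (by simp [Digraph.toSimpleGraphInclusive, SimpleGraph.fromRel_adj, e, h])
  · rintro ⟨x, hx⟩ hart
    obtain ⟨⟨u, hu⟩, ⟨w, hw⟩, hux, hwx, -, hn⟩ := isArticulationPoint_iff.1 hart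
    apply hn
    have h1 := reflTransGen_of_maximal_nonSep hS (fun _ _ h => Or.inr h.1) hu hw
      (hS.prop u hu w hw x (fun e => hux (Subtype.ext e.symm))
        (fun e => hwx (Subtype.ext e.symm)))
    obtain ⟨_, h2⟩ := reflTransGen_subtype hu h1
    refine Relation.ReflTransGen.mono (fun a b h => ?_) _ _ h2
    exact ⟨inducedOn_underlying_adj.2 h.1, fun e => h.2.1 (congrArg Subtype.val e),
      fun e => h.2.2 (congrArg Subtype.val e)⟩

theorem NonSep.exists_maximal [Finite V] {H : SimpleGraph V} {S : Set V} (h : NonSep H S) :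
    ∃ S', S ⊆ S' ∧ Maximal (NonSep H) S' :=
  Finite.exists_le_maximal h

/-- In a strongly connected directed graph the strongly biconnected components are the maximal
nonseparable sets of the underlying undirected graph. -/
theorem isSBComponent_iff_maximal_nonSep [Finite V] [Nonempty V] {D : Digraph V}
    (hD : ∀ u w, D.HasPath u w) {S : Set V} :
    D.IsSBComponent S ↔ Maximal (NonSep D.toSimpleGraphInclusive) S := by
  constructor
  · intro h
    refine ⟨h.prop.nonSep, fun S' hS' hle => ?_⟩
    obtain ⟨S'', hle', hmax⟩ := hS'.exists_maximal
    have hne : S''.Nonempty := by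
      obtain ⟨a⟩ := h.prop.1
      exact ⟨a, hle' (hle a.2)⟩
    exact hle'.trans (h.le_of_ge (hmax.stronglyBiconnected hD hne) (hle.trans hle'))
  · intro h
    have hne : S.Nonempty := by
      by_contra hc
      rw [Set.not_nonempty_iff_eq_empty] at hc
      subst hc
      obtain ⟨a⟩ := ‹Nonempty V›
      exact h.le_of_ge (NonSep.singleton _ a) (Set.empty_subset _) (Set.mem_singleton a)
    refine ⟨h.stronglyBiconnected hD hne, fun S' hS' hle => h.le_of_ge hS'.nonSep hle⟩

theorem exists_isSBComponent_iff [Finite V] [Nonempty V] {D : Digraph V}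
    (hD : ∀ u w, D.HasPath u w) {u w : V} :
    (∃ S : Set V, D.IsSBComponent S ∧ u ∈ S ∧ w ∈ S) ↔
      ∀ x, x ≠ u → x ≠ w → Avoids D.toSimpleGraphInclusive x u w := by
  simp_rw [isSBComponent_iff_maximal_nonSep hD]
  constructor
  · rintro ⟨S, hS, hu, hw⟩
    exact hS.prop u hu w hw
  · intro h
    obtain ⟨S, hle, hS⟩ := (NonSep.pair h).exists_maximal
    exact ⟨S, hS, hle (by simp), hle (by simp)⟩

end Separation

/-! ### The number of iterations -/

section Iterations

variable {V : Type*}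

/-- The number of connected components that remain when `x` is deleted from `H`. -/
noncomputable def componentsWithout (H : SimpleGraph V) (x : V) : ℕ :=
  Nat.card (H.induce {y : V | y ≠ x}).ConnectedComponent

theorem componentsWithout_anti [Fintype V] {H H' : SimpleGraph V} (h : H ≤ H') (x : V) :
    componentsWithout H' x ≤ componentsWithout H x :=
  Nat.card_le_card_of_surjective _ <|
    SimpleGraph.ConnectedComponent.surjective_map_ofLE (SimpleGraph.comap_monotone _ h)

theorem componentsWithout_lt [Fintype V] {H H' : SimpleGraph V} (h : H ≤ H') {x u w : V}
    (hu : u ≠ x) (hw : w ≠ x) (hn : ¬ Avoids H x u w) (hy : H'.Adj u w) :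
    componentsWithout H' x < componentsWithout H x := by
  classical
  have hle : H.induce {y : V | y ≠ x} ≤ H'.induce {y : V | y ≠ x} :=
    SimpleGraph.comap_monotone _ h
  unfold componentsWithout
  rw [Nat.card_eq_fintype_card, Nat.card_eq_fintype_card]
  refine Fintype.card_lt_of_surjective_not_injective _
    (SimpleGraph.ConnectedComponent.surjective_map_ofLE hle) (fun hinj => hn ?_)
  rw [← reachable_induce_ne_iff hu hw]
  refine SimpleGraph.ConnectedComponent.exact (hinj ?_)
  simp only [SimpleGraph.ConnectedComponent.map_mk]
  refine SimpleGraph.ConnectedComponent.sound (SimpleGraph.Adj.reachable ?_)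
  exact hy

theorem componentsWithout_pos [Fintype V] [Nontrivial V] (H : SimpleGraph V) (x : V) :
    0 < componentsWithout H x := by
  obtain ⟨y, hy⟩ := exists_ne x
  have : Nonempty (H.induce {y : V | y ≠ x}).ConnectedComponent :=
    ⟨SimpleGraph.connectedComponentMk _ ⟨y, hy⟩⟩
  exact Nat.card_pos

/-- Every component that remains when `x` is deleted contains a child of `x` in the tree `T`, or the
root. -/
theorem IsRootedSpanningTree.exists_avoids {E T F : Set (V × V)} {v : V}
    (hT : IsRootedSpanningTree E v T) (hTF : T ⊆ F) (x y : V) (hy : y ≠ x) :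
    ∃ a, a ≠ x ∧ ((x, a) ∈ T ∨ a = v) ∧ Avoids (underlying F) x a y := by
  have h := hT.reach y
  revert hy
  induction h with
  | refl => exact fun hy => ⟨v, hy, Or.inr rfl, .refl _⟩
  | @tail b c _ hbc ih =>
    intro hc
    by_cases hb : b = x
    · exact ⟨c, hc, Or.inl (hb ▸ hbc), .refl _⟩
    · obtain ⟨a, ha, hax, hab⟩ := ih hb
      refine ⟨a, ha, hax, ?_⟩
      by_cases e : b = c
      · exact e ▸ hab
      · exact hab.trans (.of_adj (underlying_adj.2 ⟨e, Or.inl (hTF hbc)⟩) hb hc)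

/-- In a graph with a spanning tree, `x` leaves at most one component for each of its children and
one for the root. -/
theorem IsRootedSpanningTree.sum_componentsWithout_le [Fintype V] {E T F : Set (V × V)} {v : V}
    (hT : IsRootedSpanningTree E v T) (hTF : T ⊆ F) :
    ∑ x, componentsWithout (underlying F) x + 2 ≤ 2 * Fintype.card V := by
  classical
  have hpar : ∀ w, ∃ u, w ≠ v → ∀ u', (u', w) ∈ T → u' = u := by
    intro w
    by_cases hw : w = v
    · exact ⟨v, fun h => absurd hw h⟩
    · obtain ⟨u, _, hu⟩ := hT.unique_parent w hw
      exact ⟨u, fun _ => hu⟩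
  choose f hf using hpar
  have hbound : ∀ x, componentsWithout (underlying F) x ≤
      ((Finset.univ.erase v).filter (fun y => f y = x)).card + (if x = v then 0 else 1) := by
    intro x
    set A : Finset V := (Finset.univ.erase v).filter (fun y => f y = x) ∪
      (if x = v then ∅ else {v}) with hA
    have hsurj : componentsWithout (underlying F) x ≤ (A.filter (· ≠ x)).card := by
      rw [← Nat.card_eq_finsetCard]
      refine Nat.card_le_card_of_surjective (fun a => SimpleGraph.connectedComponentMk _
        ⟨a.1, (Finset.mem_filter.1 a.2).2⟩) (fun C => ?_)
      induction C using SimpleGraph.ConnectedComponent.ind with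
      | _ y =>
        obtain ⟨y, hy⟩ := y
        obtain ⟨a, hax, ha, hav⟩ := hT.exists_avoids hTF x y hy
        refine ⟨⟨a, Finset.mem_filter.2 ⟨?_, hax⟩⟩, ?_⟩
        · rw [hA, Finset.mem_union]
          by_cases hv : a = v
          · right
            subst hv
            simp [Ne.symm hax]
          · left
            have h1 := ha.resolve_right hv
            simp [hv, (hf a hv x h1).symm]
        · exact SimpleGraph.ConnectedComponent.sound ((reachable_induce_ne_iff hax hy).2 hav)
    refine hsurj.trans ((Finset.card_filter_le _ _).trans ((Finset.card_union_le _ _).trans ?_))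
    split_ifs <;> simp
  have hsum := Finset.sum_le_sum (s := Finset.univ) (fun x _ => hbound x)
  rw [Finset.sum_add_distrib] at hsum
  have h1 : ∑ x, ((Finset.univ.erase v).filter (fun y => f y = x)).card =
      (Finset.univ.erase v).card :=
    (Finset.card_eq_sum_card_fiberwise (fun _ _ => Finset.mem_coe.2 (Finset.mem_univ _))).symm
  have h2 : ∑ x : V, (if x = v then 0 else 1) = (Finset.univ.erase v).card := by
    rw [← Finset.filter_ne', Finset.card_filter]
    exact Finset.sum_congr rfl fun x _ => by split_ifs <;> simp_all
  have h3 : (Finset.univ.erase v).card + 1 = Fintype.card V := by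
    rw [Finset.card_erase_add_one (Finset.mem_univ v), Finset.card_univ]
  omega

theorem AugmentStep.subset {E F F' : Set (V × V)} (h : AugmentStep E F F') : F ⊆ F' := by
  obtain ⟨-, u, w, -, -, rfl⟩ := h
  exact Set.subset_insert _ _

theorem PartialRun.init_subset {E : Set (V × V)} {v : V} {T T' : Set (V × V)} {k : ℕ}
    {F : ℕ → Set (V × V)} (h : PartialRun E v T T' k F) : ∀ i ≤ k, F 0 ⊆ F i := by
  intro i
  induction i with
  | zero => exact fun _ => le_rfl
  | succ i ih => exact fun hi => (ih (by omega)).trans (h.augment i (by omega)).subset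

theorem hasPath_of_trees {E : Set (V × V)} {v : V} {T T' F : Set (V × V)}
    (hT : IsRootedSpanningTree E v T) (hT' : IsRootedSpanningTree (revEdges E) v T')
    (hF : T ∪ revEdges T' ⊆ F) (u w : V) : (digraphOf F).HasPath u w := by
  have h1 : (digraphOf F).HasPath v w :=
    Relation.ReflTransGen.mono (fun a b h => hF (Or.inl h)) _ _ (hT.reach w)
  have h2 : Relation.ReflTransGen (Function.swap (digraphOf F).Adj) v u :=
    Relation.ReflTransGen.mono (fun a b h => hF (Or.inr h)) _ _ (hT'.reach u)
  exact Relation.ReflTransGen.trans (Relation.reflTransGen_swap.1 h2) h1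

/-- The edge that is added joins two vertices that some vertex `x` separates. -/
theorem AugmentStep.sum_lt [Fintype V] {E F F' : Set (V × V)} (h : AugmentStep E F F')
    (hF : ∀ u w, (digraphOf F).HasPath u w) :
    ∑ x, componentsWithout (underlying F') x < ∑ x, componentsWithout (underlying F) x := by
  have hsub := underlying_mono h.subset
  obtain ⟨-, u, w, -, hn, rfl⟩ := h
  have : Nonempty V := ⟨u⟩
  rw [exists_isSBComponent_iff hF] at hn
  push Not at hn
  obtain ⟨x, hxu, hxw, hx⟩ := hn
  have huw : u ≠ w := by
    rintro rfl
    exact hx (.refl _)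
  refine Finset.sum_lt_sum (fun x _ => componentsWithout_anti hsub x) ⟨x, Finset.mem_univ x, ?_⟩
  exact componentsWithout_lt hsub hxu.symm hxw.symm hx
    (underlying_adj.2 ⟨huw, Or.inl (Set.mem_insert _ _)⟩)

/-- While the underlying graph is not biconnected, an edge that joins different components exists:
a path of `E` around an articulation point must use one. -/
theorem exists_separated_edge {E F : Set (V × V)} (hE : (digraphOf E).StronglyBiconnected)
    (hF : ∀ u w, (digraphOf F).HasPath u w) (hn : ¬ IsBiconnected (underlying F)) :
    ∃ u w, (u, w) ∈ E ∧ ∃ x, x ≠ u ∧ x ≠ w ∧ ¬ Avoids (underlying F) x u w := by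
  have : Nonempty V := hE.1
  rw [isBiconnected_iff_nonSep (connected_of_hasPath hF)] at hn
  unfold NonSep at hn
  push Not at hn
  obtain ⟨a, -, b, -, x, hxa, hxb, hx⟩ := hn
  by_contra hc
  push Not at hc
  have hab : Avoids (underlying E) x a b := by
    by_contra hn
    exact hE.2.2 x (isArticulationPoint_iff.2 ⟨a, b, hxa.symm, hxb.symm,
      (hE.2.1 a b).reachable, hn⟩)
  apply hx
  have step : ∀ u w, ((underlying E).Adj u w ∧ u ≠ x ∧ w ≠ x) → Avoids (underlying F) x u w := by
    rintro u w ⟨h1, h2, h3⟩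
    rcases (underlying_adj.1 h1).2 with h | h
    · exact hc u w h x h2.symm h3.symm
    · exact (hc w u h x h3.symm h2.symm).symm
  refine Relation.ReflTransGen.trans_induction_on (motive := fun {u w} _ =>
    Avoids (underlying F) x u w) hab (fun u => .refl u) (fun h => step _ _ h)
    (fun _ _ h1 h2 => h1.trans h2)

/-- An edge of `E` whose ends are separated in `(V, F)` may be added to `F`. -/
theorem augmentStep_insert [Finite V] {E F : Set (V × V)} (hF : ∀ u w, (digraphOf F).HasPath u w)
    {u w x : V} (huw : (u, w) ∈ E) (hxu : x ≠ u) (hxw : x ≠ w)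
    (hx : ¬ Avoids (underlying F) x u w) : AugmentStep E F (insert (u, w) F) := by
  have : Nonempty V := ⟨u⟩
  refine ⟨?_, u, w, ⟨huw, fun h => ?_⟩, ?_, rfl⟩
  · rw [isBiconnected_iff_nonSep (connected_of_hasPath hF)]
    exact fun h => hx (h u trivial w trivial x hxu hxw)
  · apply hx
    by_cases e : u = w
    · exact e ▸ .refl _
    · exact .of_adj (underlying_adj.2 ⟨e, Or.inl h⟩) hxu.symm hxw.symm
  · rw [exists_isSBComponent_iff hF]
    exact fun h => hx (h x hxu hxw)

theorem PartialRun.exists_augmentStep [Finite V] {E : Set (V × V)}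
    (hE : (digraphOf E).StronglyBiconnected)
    {v : V} {T T' : Set (V × V)} {k : ℕ} {F : ℕ → Set (V × V)} (h : PartialRun E v T T' k F)
    (hn : ¬ IsBiconnected (underlying (F k))) : ∃ F', AugmentStep E (F k) F' := by
  have hF := hasPath_of_trees h.tree h.revTree (h.init ▸ h.init_subset k le_rfl)
  obtain ⟨u, w, huw, x, hxu, hxw, hx⟩ := exists_separated_edge hE hF hn
  exact ⟨_, augmentStep_insert hF huw hxu hxw hx⟩

/-- The sum of the numbers of components drops in every iteration, from at most `2 n - 2` to at
least `n` (if `n ≥ 2`). -/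
theorem PartialRun.le_card [Fintype V] {E : Set (V × V)} {v : V} {T T' : Set (V × V)} {k : ℕ}
    {F : ℕ → Set (V × V)} (h : PartialRun E v T T' k F) : k ≤ Fintype.card V := by
  have hsub : ∀ i ≤ k, T ∪ revEdges T' ⊆ F i := fun i hi => h.init ▸ h.init_subset i hi
  have hdrop : ∀ i ≤ k, i + ∑ x, componentsWithout (underlying (F i)) x ≤
      ∑ x, componentsWithout (underlying (F 0)) x := by
    intro i
    induction i with
    | zero => simp
    | succ i ih =>
      intro hi
      have h1 := ih (by omega)
      have h2 := (h.augment i (by omega)).sum_lt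
        (hasPath_of_trees h.tree h.revTree (hsub i (by omega)))
      omega
  have h0 := h.tree.sum_componentsWithout_le
    (Set.subset_union_left.trans (hsub 0 (Nat.zero_le _)))
  have hk := hdrop k le_rfl
  rcases subsingleton_or_nontrivial V with hV | hV
  · have := Fintype.card_le_one_iff_subsingleton.2 hV
    omega
  · have h2 : Fintype.card V ≤ ∑ x, componentsWithout (underlying (F k)) x := by
      rw [← Finset.card_univ, Finset.card_eq_sum_ones]
      exact Finset.sum_le_sum fun x _ => componentsWithout_pos _ x
    omega

end Iterations

/-! ### Blocks read off a depth-first search tree -/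

section DepthFirst

variable {V : Type*}

/-- `a` is an ancestor of `b`, or `b` itself, in the tree with root `r` and parent function `p`. -/
def Ancestor (r : V) (p : V → V) (a b : V) : Prop :=
  Relation.ReflTransGen (fun u w => w ≠ r ∧ p w = u) a b

/-- `p` is the parent function of a spanning tree of `H` with root `r`, numbered by `pre`
increasingly along the branches, such that every edge of `H` joins an ancestor to a descendant. -/
structure IsDepthFirstTree (H : SimpleGraph V) (r : V) (p : V → V) (pre : V → ℕ) : Prop where
  parent_adj : ∀ y, y ≠ r → H.Adj (p y) y
  pre_parent_lt : ∀ y, y ≠ r → pre (p y) < pre y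
  related : ∀ u w, H.Adj u w → Ancestor r p u w ∨ Ancestor r p w u

/-- `low x` is the least number of a vertex in the subtree of `x` or adjacent to it.  A vertex other
than the root inherits the label of its parent if an edge leads from its subtree beyond the parent,
and starts a new label, named by itself, otherwise. -/
structure IsBlockLabelling (H : SimpleGraph V) (r : V) (p : V → V) (pre low : V → ℕ)
    (lab : V → V) : Prop where
  low_le : ∀ x w, H.Adj x w → low x ≤ pre w
  low_parent_le : ∀ y, y ≠ r → low (p y) ≤ low y
  low_attained : ∀ x, ∃ z, Ancestor r p x z ∧ (low x = pre z ∨ ∃ w, H.Adj z w ∧ low x = pre w)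
  lab_root : lab r = r
  lab_eq : ∀ x, x ≠ r → lab x = if low x < pre (p x) then lab (p x) else x

/-- The block that hangs from the parent of `c`: the vertices labelled `c`, and the parent of `c`.
-/
def labelBlock (p lab : V → V) (c : V) : Set V := {x | lab x = c ∨ x = p c}

theorem IsBlockLabelling.low_le_of_ancestor {H : SimpleGraph V} {r : V} {p : V → V}
    {pre low : V → ℕ} {lab : V → V} (hl : IsBlockLabelling H r p pre low lab) {x z : V}
    (h : Ancestor r p x z) : low x ≤ low z := by
  induction h with
  | refl => exact le_rfl
  | tail _ h3 ih =>
    obtain ⟨h3, rfl⟩ := h3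
    exact ih.trans (hl.low_parent_le _ h3)

namespace IsDepthFirstTree

variable {H : SimpleGraph V} {r : V} {p : V → V} {pre low : V → ℕ} {lab : V → V}

theorem pre_le (h : IsDepthFirstTree H r p pre) {a b : V} (hab : Ancestor r p a b) :
    pre a ≤ pre b := by
  induction hab with
  | refl => exact le_rfl
  | tail _ h2 ih =>
    obtain ⟨h3, rfl⟩ := h2
    exact ih.trans (h.pre_parent_lt _ h3).le

theorem ancestor_parent_or_eq {a b : V} (hab : Ancestor r p a b) :
    a = b ∨ (b ≠ r ∧ Ancestor r p a (p b)) := by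
  rcases Relation.ReflTransGen.cases_tail hab with h | ⟨c, h1, h2, rfl⟩
  · exact Or.inl h.symm
  · exact Or.inr ⟨h2, h1⟩

theorem ancestor_parent {b : V} (hb : b ≠ r) : Ancestor r p (p b) b :=
  Relation.ReflTransGen.single ⟨hb, rfl⟩

theorem pre_lt (h : IsDepthFirstTree H r p pre) {a b : V} (hab : Ancestor r p a b) (hne : a ≠ b) :
    pre a < pre b := by
  rcases ancestor_parent_or_eq hab with e | ⟨hb, h1⟩
  · exact absurd e hne
  · exact (h.pre_le h1).trans_lt (h.pre_parent_lt b hb)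

theorem ancestor_antisymm (h : IsDepthFirstTree H r p pre) {a b : V} (hab : Ancestor r p a b)
    (hba : Ancestor r p b a) : a = b := by
  by_contra hne
  exact absurd (h.pre_le hba) (not_le.2 (h.pre_lt hab hne))

theorem ancestor_comparable {a b c : V} (ha : Ancestor r p a c) (hb : Ancestor r p b c) :
    Ancestor r p a b ∨ Ancestor r p b a := by
  induction ha with
  | refl => exact Or.inr hb
  | @tail y z _ hyz ih =>
    rcases ancestor_parent_or_eq hb with rfl | ⟨_, hb'⟩
    · left
      exact Relation.ReflTransGen.tail ‹_› hyz
    · exact ih (hyz.2 ▸ hb')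

theorem root_ancestor (h : IsDepthFirstTree H r p pre) (y : V) : Ancestor r p r y := by
  induction hn : pre y using Nat.strong_induction_on generalizing y with
  | _ n ih =>
    by_cases hy : y = r
    · exact hy ▸ .refl
    · exact (ih _ (hn ▸ h.pre_parent_lt y hy) (p y) rfl).tail ⟨hy, rfl⟩

/-- The branch from `b` up to `a` avoids every vertex that is not on it. -/
theorem avoids_of_ancestor (h : IsDepthFirstTree H r p pre) {a b x : V} (hab : Ancestor r p a b)
    (hx : ¬ (Ancestor r p a x ∧ Ancestor r p x b)) : Avoids H x a b := by
  induction hab with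
  | refl => exact .refl _
  | @tail y z hy hyz ih =>
    obtain ⟨hz, rfl⟩ := hyz
    have hzp := ancestor_parent (p := p) hz
    have h1 : p z ≠ x := by
      rintro rfl
      exact hx ⟨hy, hzp⟩
    have h2 : z ≠ x := by
      rintro rfl
      exact hx ⟨hy.trans hzp, .refl⟩
    exact (ih fun h' => hx ⟨h'.1, h'.2.trans hzp⟩).trans (.of_adj (h.parent_adj z hz) h1 h2)

/-- If `low x` is not below the number of the parent of `x`, then the parent separates the subtree
of `x` from all other vertices. -/
theorem ancestor_of_adj_of_le_low (h : IsDepthFirstTree H r p pre)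
    (hl : IsBlockLabelling H r p pre low lab) {x z w : V} (hx : x ≠ r) (hlow : pre (p x) ≤ low x)
    (hxz : Ancestor r p x z) (hzw : H.Adj z w) (hw : w ≠ p x) : Ancestor r p x w := by
  rcases h.related z w hzw with h1 | h1
  · exact hxz.trans h1
  rcases ancestor_comparable h1 hxz with h2 | h2
  · rcases ancestor_parent_or_eq h2 with rfl | ⟨_, h3⟩
    · exact .refl
    exfalso
    have hle : low x ≤ pre w := (hl.low_le_of_ancestor hxz).trans (hl.low_le z w hzw)
    have := h.pre_lt h3 hw
    omega
  · exact h2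

/-- An edge that makes `low x` small leads from the subtree of `x` to a proper ancestor of the
parent of `x`. -/
theorem exists_adj_of_low_lt (h : IsDepthFirstTree H r p pre)
    (hl : IsBlockLabelling H r p pre low lab) {x : V} (hx : x ≠ r) (hlow : low x < pre (p x)) :
    ∃ z w, Ancestor r p x z ∧ H.Adj z w ∧ Ancestor r p w (p x) ∧ w ≠ p x := by
  have hpx := h.pre_parent_lt x hx
  obtain ⟨z, hxz, hz | ⟨w, hzw, hw⟩⟩ := hl.low_attained x
  · have := h.pre_le hxz
    omega
  refine ⟨z, w, hxz, hzw, ?_, fun e => by subst e; omega⟩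
  have hnot : ¬ Ancestor r p x w := fun hc => by
    have := h.pre_le hc
    omega
  have hwz : Ancestor r p w z := (h.related z w hzw).resolve_left fun hc => hnot (hxz.trans hc)
  have hwx : Ancestor r p w x := (ancestor_comparable hwz hxz).resolve_right hnot
  rcases ancestor_parent_or_eq hwx with rfl | h1
  · exact absurd .refl hnot
  · exact h1.2

theorem pre_root_le_low (h : IsDepthFirstTree H r p pre)
    (hl : IsBlockLabelling H r p pre low lab) (x : V) : pre r ≤ low x := by
  obtain ⟨z, _, hz | ⟨w, _, hw⟩⟩ := hl.low_attained x
  · exact hz ▸ h.pre_le (h.root_ancestor z)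
  · exact hw ▸ h.pre_le (h.root_ancestor w)

theorem lab_spec (h : IsDepthFirstTree H r p pre) (hl : IsBlockLabelling H r p pre low lab)
    {x : V} (hx : x ≠ r) : lab x ≠ r ∧ lab (lab x) = lab x ∧ Ancestor r p (lab x) x := by
  induction hn : pre x using Nat.strong_induction_on generalizing x with
  | _ n ih =>
    by_cases hlow : low x < pre (p x)
    · have hpx : p x ≠ r := by
        intro e
        have := h.pre_root_le_low hl x
        rw [e] at hlow
        omega
      obtain ⟨h1, h2, h3⟩ := ih _ (hn ▸ h.pre_parent_lt x hx) hpx rfl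
      rw [hl.lab_eq x hx, if_pos hlow]
      exact ⟨h1, h2, h3.trans (ancestor_parent hx)⟩
    · have e : lab x = x := by rw [hl.lab_eq x hx, if_neg hlow]
      rw [e]
      exact ⟨hx, e, .refl⟩

theorem eq_root_of_lab_eq_root (h : IsDepthFirstTree H r p pre)
    (hl : IsBlockLabelling H r p pre low lab) {x : V} (hx : lab x = r) : x = r := by
  by_contra hc
  exact (h.lab_spec hl hc).1 hx

theorem le_low_of_lab_eq_self (h : IsDepthFirstTree H r p pre)
    (hl : IsBlockLabelling H r p pre low lab) {c : V} (hc : c ≠ r) (hcl : lab c = c) :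
    pre (p c) ≤ low c := by
  by_contra hlow
  push Not at hlow
  have h1 := hl.lab_eq c hc
  rw [if_pos hlow, hcl] at h1
  have hpc : p c ≠ r := fun e => hc (by rw [h1, e, hl.lab_root])
  have h2 := h.pre_le (h.lab_spec hl hpc).2.2
  rw [← h1] at h2
  have := h.pre_parent_lt c hc
  omega

theorem lab_eq_of_between (h : IsDepthFirstTree H r p pre)
    (hl : IsBlockLabelling H r p pre low lab) {c x y : V} (hxc : lab x = c)
    (hcy : Ancestor r p c y) (hyx : Ancestor r p y x) : lab y = c := by
  induction hyx with
  | refl => exact hxc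
  | @tail z x hyz hzx ih =>
    obtain ⟨hx, rfl⟩ := hzx
    have h1 := hl.lab_eq x hx
    split_ifs at h1 with hlow
    · exact ih (h1 ▸ hxc)
    · have hxc' : x = c := h1.symm.trans hxc
      subst hxc'
      have := h.ancestor_antisymm (hcy.trans hyz) (ancestor_parent hx)
      have h2 := h.pre_parent_lt x hx
      rw [← this] at h2
      omega

/-- The parent of a vertex `c` that starts a label separates the subtree of `c` from the rest. -/
theorem not_avoids_parent (h : IsDepthFirstTree H r p pre)
    (hl : IsBlockLabelling H r p pre low lab) {c z w : V} (hc : c ≠ r) (hcl : lab c = c)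
    (hz : Ancestor r p c z) (hw : ¬ Ancestor r p c w) : ¬ Avoids H (p c) z w := by
  intro hzw
  apply hw
  clear hw
  induction hzw with
  | refl => exact hz
  | tail _ h2 ih =>
    exact h.ancestor_of_adj_of_le_low hl hc (h.le_low_of_lab_eq_self hl hc hcl) ih h2.1 h2.2.2

/-- From a vertex labelled `c`, the parent of `c` can be reached around every other vertex `x`: if
`x` is on the branch, then an edge leads from below `x` to above `x`, as the vertex below `x` on the
branch does not start a label. -/
theorem avoids_of_lab_eq (h : IsDepthFirstTree H r p pre)
    (hl : IsBlockLabelling H r p pre low lab) {c a x : V} (hc : c ≠ r) (ha : lab a = c)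
    (hxa : x ≠ a) (hxc : x ≠ p c) : Avoids H x a (p c) := by
  have har : a ≠ r := fun e => hc (by rw [← ha, e, hl.lab_root])
  have hca : Ancestor r p c a := ha ▸ (h.lab_spec hl har).2.2
  have hpca : Ancestor r p (p c) a := (ancestor_parent hc).trans hca
  by_cases hx : Ancestor r p (p c) x ∧ Ancestor r p x a
  swap
  · exact (h.avoids_of_ancestor hpca hx).symm
  obtain ⟨hx1, hx2⟩ := hx
  have hcx : Ancestor r p c x := by
    rcases ancestor_comparable hca hx2 with h1 | h1
    · exact h1
    · rcases ancestor_parent_or_eq h1 with rfl | ⟨_, h2⟩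
      · exact .refl
      · exact absurd (h.ancestor_antisymm h2 hx1) hxc
  rcases Relation.ReflTransGen.cases_head hx2 with e | ⟨y, ⟨hy, rfl⟩, hya⟩
  · exact absurd e hxa
  have hyp := h.pre_parent_lt y hy
  have hylab : lab y = c :=
    h.lab_eq_of_between hl ha (hcx.trans (ancestor_parent hy)) hya
  have hlow : low y < pre (p y) := by
    by_contra hlow
    have h1 := hl.lab_eq y hy
    rw [if_neg hlow, hylab] at h1
    have := h.pre_le hcx
    subst h1
    omega
  obtain ⟨z, w, hyz, hzw, hw, hwne⟩ := h.exists_adj_of_low_lt hl hy hlow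
  have hz : z ≠ p y := by
    rintro rfl
    have := h.pre_le hyz
    omega
  have haz : Avoids H (p y) a z := by
    have h1 : Avoids H (p y) y a := h.avoids_of_ancestor hya fun hc => by
      have := h.pre_le hc.1
      omega
    have h2 : Avoids H (p y) y z := h.avoids_of_ancestor hyz fun hc => by
      have := h.pre_le hc.1
      omega
    exact h1.symm.trans h2
  have hwc : Avoids H (p y) w (p c) := by
    -- two proper ancestors of `x` are joined by the branch between them
    have h1 : ∀ b, Ancestor r p b (p y) → b ≠ p y → Avoids H (p y) r b := fun b hb hbne =>
      h.avoids_of_ancestor (h.root_ancestor b) fun hc => hbne (h.ancestor_antisymm hb hc.2)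
    exact (h1 w hw hwne).symm.trans (h1 (p c) hx1 (Ne.symm hxc))
  exact (haz.trans (.of_adj hzw hz hwne)).trans hwc

theorem nonSep_labelBlock (h : IsDepthFirstTree H r p pre)
    (hl : IsBlockLabelling H r p pre low lab) {c : V} (hc : c ≠ r) :
    NonSep H (labelBlock p lab c) := by
  intro a ha b hb x hxa hxb
  by_cases hx : x = p c
  · have key : ∀ y, y ∈ labelBlock p lab c → x ≠ y → Avoids H x c y := by
      intro y hy hxy
      have hyl : lab y = c := hy.resolve_right fun e => hxy (hx.trans e.symm)
      have hyr : y ≠ r := fun e => hc (by rw [← hyl, e, hl.lab_root])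
      refine h.avoids_of_ancestor (hyl ▸ (h.lab_spec hl hyr).2.2) fun hc' => ?_
      have h1 := h.pre_le hc'.1
      have h2 := h.pre_parent_lt c hc
      rw [hx] at h1
      omega
    exact (key a ha hxa).symm.trans (key b hb hxb)
  · have key : ∀ y, y ∈ labelBlock p lab c → x ≠ y → Avoids H x y (p c) := by
      rintro y (hy | rfl) hxy
      · exact h.avoids_of_lab_eq hl hc hy hxy hx
      · exact .refl _
    exact (key a ha hxa).trans (key b hb hxb).symm

/-- A vertex outside a block is separated from the block by one of its vertices, the gate: the top
of the block, or a proper ancestor of the vertex. -/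
theorem exists_gate (h : IsDepthFirstTree H r p pre) (hl : IsBlockLabelling H r p pre low lab)
    {c z : V} (hc : c ≠ r) (hcl : lab c = c) (hz : z ∉ labelBlock p lab c) :
    ∃ g ∈ labelBlock p lab c, (g = p c ∨ (Ancestor r p g z ∧ g ≠ z)) ∧
      ∀ b ∈ labelBlock p lab c, b ≠ g → ¬ Avoids H g z b := by
  have hdesc : ∀ b, lab b = c → Ancestor r p c b := fun b hb =>
    hb ▸ (h.lab_spec hl fun e => hc (by rw [← hb, e, hl.lab_root])).2.2
  by_cases hcz : Ancestor r p c z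
  · -- `d` is the first vertex on the branch from `c` to `z` that does not have label `c`
    have hd : ∃ d, d ≠ r ∧ lab (p d) = c ∧ lab d ≠ c ∧ Ancestor r p c (p d) ∧
        Ancestor r p d z := by
      have hzl : lab z ≠ c := fun e => hz (Or.inl e)
      clear hz
      induction hcz with
      | refl => exact absurd hcl hzl
      | @tail y z hy hyz ih =>
        obtain ⟨hzr, rfl⟩ := hyz
        by_cases hyl : lab (p z) = c
        · exact ⟨z, hzr, hyl, hzl, hy, .refl⟩
        · obtain ⟨d, h1, h2, h3, h4, h5⟩ := ih hyl
          exact ⟨d, h1, h2, h3, h4, h5.trans (ancestor_parent hzr)⟩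
    obtain ⟨d, hdr, hpd, hdl, hcd, hdz⟩ := hd
    have hdd : lab d = d := by
      have h1 := hl.lab_eq d hdr
      split_ifs at h1
      · exact absurd (h1.trans hpd) hdl
      · exact h1
    refine ⟨p d, Or.inl hpd, Or.inr ⟨(ancestor_parent hdr).trans hdz, ?_⟩, ?_⟩
    · rintro rfl
      have := h.pre_le hdz
      have := h.pre_parent_lt d hdr
      omega
    · intro b hb _
      refine h.not_avoids_parent hl hdr hdd hdz fun hdb => ?_
      rcases hb with hb | rfl
      · exact hdl (h.lab_eq_of_between hl hb (hcd.trans (ancestor_parent hdr)) hdb)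
      · have := h.pre_le hdb
        have := h.pre_le hcd
        have := h.pre_parent_lt c hc
        have := h.pre_parent_lt d hdr
        omega
  · refine ⟨p c, Or.inr rfl, Or.inl rfl, fun b hb hne hzb => ?_⟩
    exact h.not_avoids_parent hl hc hcl (hdesc b (hb.resolve_right hne)) hcz hzb.symm

theorem mem_labelBlock_of_nonSep (h : IsDepthFirstTree H r p pre)
    (hl : IsBlockLabelling H r p pre low lab) {a b : V} (hab : a ≠ b) (hpre : pre a ≤ pre b)
    (hn : ∀ x, x ≠ a → x ≠ b → Avoids H x a b) : b ≠ r ∧ a ∈ labelBlock p lab (lab b) := by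
  have hb : b ≠ r := by
    rintro rfl
    have := h.pre_lt (h.root_ancestor a) (Ne.symm hab)
    omega
  obtain ⟨h1, h2, h3⟩ := h.lab_spec hl hb
  refine ⟨hb, ?_⟩
  by_contra ha
  obtain ⟨g, hg, hg', hsep⟩ := h.exists_gate hl h1 h2 ha
  have hgb : g ≠ b := by
    rintro rfl
    rcases hg' with e | ⟨h4, h5⟩
    · have h6 := h.pre_le h3
      have h7 := h.pre_parent_lt _ h1
      rw [← e] at h7
      omega
    · have := h.pre_lt h4 h5
      omega
  exact hsep b (Or.inl rfl) (Ne.symm hgb) (hn g (fun e => ha (e ▸ hg)) hgb)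

/-- Two vertices are separated by no third one exactly if they have the same label or one is the
top of the block that the label of the other one names. -/
theorem nonSep_pair_iff (h : IsDepthFirstTree H r p pre)
    (hl : IsBlockLabelling H r p pre low lab) (a b : V) :
    (∀ x, x ≠ a → x ≠ b → Avoids H x a b) ↔
      lab a = lab b ∨ (b ≠ r ∧ p (lab b) = a) ∨ (a ≠ r ∧ p (lab a) = b) := by
  constructor
  · intro hn
    by_cases hab : a = b
    · exact Or.inl (hab ▸ rfl)
    rcases le_total (pre a) (pre b) with hle | hle
    · obtain ⟨hb, h1 | h1⟩ := h.mem_labelBlock_of_nonSep hl hab hle hn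
      · exact Or.inl h1
      · exact Or.inr (Or.inl ⟨hb, h1.symm⟩)
    · obtain ⟨ha, h1 | h1⟩ := h.mem_labelBlock_of_nonSep hl (Ne.symm hab) hle
        (fun x hx hx' => (hn x hx' hx).symm)
      · exact Or.inl h1.symm
      · exact Or.inr (Or.inr ⟨ha, h1.symm⟩)
  · rintro (h1 | ⟨hb, h1⟩ | ⟨ha, h1⟩)
    · by_cases ha : a = r
      · have hb : b = r := h.eq_root_of_lab_eq_root hl (by rw [← h1, ha, hl.lab_root])
        exact fun x _ _ => ha ▸ hb ▸ .refl _
      · exact h.nonSep_labelBlock hl (h.lab_spec hl ha).1 a (Or.inl rfl) b (Or.inl h1.symm)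
    · exact h.nonSep_labelBlock hl (h.lab_spec hl hb).1 a (Or.inr h1.symm) b (Or.inl rfl)
    · exact h.nonSep_labelBlock hl (h.lab_spec hl ha).1 a (Or.inl rfl) b (Or.inr h1.symm)

theorem maximal_nonSep_labelBlock (h : IsDepthFirstTree H r p pre)
    (hl : IsBlockLabelling H r p pre low lab) {c : V} (hc : c ≠ r) (hcl : lab c = c) :
    Maximal (NonSep H) (labelBlock p lab c) := by
  refine ⟨h.nonSep_labelBlock hl hc, fun S hS hle z hz => ?_⟩
  by_contra hzB
  obtain ⟨g, hg, -, hsep⟩ := h.exists_gate hl hc hcl hzB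
  have hgz : g ≠ z := fun e => hzB (e ▸ hg)
  have hin : ∀ b ∈ labelBlock p lab c, b = g := fun b hb => by
    by_contra hbg
    exact hsep b hb hbg (hS z hz b (hle hb) g hgz (Ne.symm hbg))
  have hpc := h.pre_parent_lt c hc
  rw [hin (p c) (Or.inr rfl), ← hin c (Or.inl hcl)] at hpc
  exact lt_irrefl _ hpc

theorem exists_labelBlock_of_maximal (h : IsDepthFirstTree H r p pre)
    (hl : IsBlockLabelling H r p pre low lab) (hV : ∃ y, y ≠ r) {S : Set V}
    (hS : Maximal (NonSep H) S) : ∃ c, c ≠ r ∧ lab c = c ∧ S = labelBlock p lab c := by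
  suffices key : ∃ c, c ≠ r ∧ lab c = c ∧ S ⊆ labelBlock p lab c by
    obtain ⟨c, hc, hcl, hle⟩ := key
    exact ⟨c, hc, hcl, hle.antisymm (hS.le_of_ge (h.nonSep_labelBlock hl hc) hle)⟩
  by_cases hsub : S ⊆ {r}
  · -- a child of the root starts a label, so `{r}` is not maximal
    obtain ⟨y, hy⟩ := hV
    rcases Relation.ReflTransGen.cases_head (h.root_ancestor y) with e | ⟨c, ⟨hc, hpc⟩, _⟩
    · exact absurd e.symm hy
    have hcl : lab c = c := by
      have h1 := hl.lab_eq c hc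
      rw [hpc, if_neg (not_lt.2 (h.pre_root_le_low hl c))] at h1
      exact h1
    refine ⟨c, hc, hcl, fun x hx => Or.inr ?_⟩
    rw [hpc]
    exact hsub hx
  obtain ⟨b, hbS, hbr⟩ := Set.not_subset.1 hsub
  have hbr : b ≠ r := hbr
  obtain ⟨h1, h2, -⟩ := h.lab_spec hl hbr
  by_cases hb : S ⊆ labelBlock p lab (lab b)
  · exact ⟨_, h1, h2, hb⟩
  obtain ⟨a, haS, ha⟩ := Set.not_subset.1 hb
  obtain ⟨c, hc, hcl, haB, hbB, hab⟩ : ∃ c, c ≠ r ∧ lab c = c ∧ a ∈ labelBlock p lab c ∧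
      b ∈ labelBlock p lab c ∧ a ≠ b := by
    have hab : a ≠ b := fun e => ha (Or.inl (by rw [e]))
    rcases (h.nonSep_pair_iff hl a b).1 (hS.prop a haS b hbS) with e | ⟨_, e⟩ | ⟨har, e⟩
    · exact absurd (Or.inl e) ha
    · exact absurd (Or.inr e.symm) ha
    · obtain ⟨h3, h4, -⟩ := h.lab_spec hl har
      exact ⟨lab a, h3, h4, Or.inl rfl, Or.inr e.symm, hab⟩
  refine ⟨c, hc, hcl, fun z hz => ?_⟩
  by_contra hzB
  -- A vertex outside the block is separated from all vertices of the block but the gate.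
  obtain ⟨g, hg, -, hsep⟩ := h.exists_gate hl hc hcl hzB
  have hgz : g ≠ z := fun e => hzB (e ▸ hg)
  have hin : ∀ y ∈ labelBlock p lab c, y ∈ S → y = g := fun y hyB hyS => by
    by_contra hyg
    exact hsep y hyB hyg (hS.prop z hz y hyS g hgz (Ne.symm hyg))
  exact hab ((hin a haB haS).trans (hin b hbB hbS).symm)

theorem labelBlock_injective (h : IsDepthFirstTree H r p pre) {c d : V} (hc : c ≠ r)
    (hcl : lab c = c) (hd : d ≠ r) (hdl : lab d = d)
    (hcd : labelBlock p lab c = labelBlock p lab d) : c = d := by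
  have h1 : c ∈ labelBlock p lab d := hcd ▸ Or.inl hcl
  have h2 : d ∈ labelBlock p lab c := hcd ▸ Or.inl hdl
  rcases h1 with h1 | h1
  · exact hcl.symm.trans h1
  rcases h2 with h2 | h2
  · exact (hdl.symm.trans h2).symm
  have h3 := h.pre_parent_lt c hc
  have h4 := h.pre_parent_lt d hd
  rw [← h1] at h4
  rw [← h2] at h3
  omega

end IsDepthFirstTree

end DepthFirst

/-! ### Reasoning about programs -/

namespace RAM

/-- Started on top of any stack, the command `c` leads in exactly `t` steps from memory `s` to
memory `s'`. -/
def Runs (c : Cmd) (s : Store) (t : ℕ) (s' : Store) : Prop :=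
  ∀ k, step^[t] ⟨c :: k, s⟩ = ⟨k, s'⟩

theorem Runs.one {c : Cmd} {s s' : Store} (h : ∀ k, step ⟨c :: k, s⟩ = ⟨k, s'⟩) : Runs c s 1 s' :=
  h

theorem iterate_add_of_eq {f f' f'' : Config} {t t' : ℕ} (h : step^[t] f = f')
    (h' : step^[t'] f' = f'') : step^[t + t'] f = f'' := by
  rw [Nat.add_comm, Function.iterate_add_apply, h, h']

theorem Runs.seq {p q : Cmd} {s s' s'' : Store} {t t' : ℕ} (hp : Runs p s t s')
    (hq : Runs q s' t' s'') : Runs (.seq p q) s (1 + t + t') s'' := fun k =>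
  iterate_add_of_eq (iterate_add_of_eq rfl (hp (q :: k))) (hq k)

theorem Runs.ite_pos {b : Test} {p q : Cmd} {s s' : Store} {t : ℕ} (hb : b.holds s = true)
    (hp : Runs p s t s') : Runs (.ite b p q) s (1 + t) s' := fun k =>
  iterate_add_of_eq (by simp [step, hb]) (hp k)

theorem Runs.ite_neg {b : Test} {p q : Cmd} {s s' : Store} {t : ℕ} (hb : b.holds s = false)
    (hq : Runs q s t s') : Runs (.ite b p q) s (1 + t) s' := fun k =>
  iterate_add_of_eq (by simp [step, hb]) (hq k)

theorem Runs.while_false {b : Test} {p : Cmd} {s : Store} (hb : b.holds s = false) :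
    Runs (.while b p) s 1 s := Runs.one fun k => by simp [step, hb]

theorem Runs.while_true {b : Test} {p : Cmd} {s s' s'' : Store} {t t' : ℕ} (hb : b.holds s = true)
    (hp : Runs p s t s') (hw : Runs (.while b p) s' t' s'') :
    Runs (.while b p) s (1 + t + t') s'' := fun k =>
  iterate_add_of_eq (iterate_add_of_eq (by simp [step, hb]) (hp (.while b p :: k))) (hw k)

/-- Started with memory `s`, the command `c` ends after at most `T` steps with a memory that has the
property `Q`. -/
def Achieves (c : Cmd) (s : Store) (T : ℕ) (Q : Store → Prop) : Prop :=
  ∃ t ≤ T, ∃ s', Runs c s t s' ∧ Q s'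

theorem Achieves.mono {c : Cmd} {s : Store} {T T' : ℕ} {Q Q' : Store → Prop}
    (h : Achieves c s T Q) (hT : T ≤ T') (hQ : ∀ s', Q s' → Q' s') : Achieves c s T' Q' := by
  obtain ⟨t, ht, s', hr, hq⟩ := h
  exact ⟨t, ht.trans hT, s', hr, hQ s' hq⟩

theorem Achieves.seq {p q : Cmd} {s : Store} {T T' : ℕ} {Q Q' : Store → Prop}
    (hp : Achieves p s T Q) (hq : ∀ s', Q s' → Achieves q s' T' Q') :
    Achieves (.seq p q) s (1 + T + T') Q' := by
  obtain ⟨t, ht, s', hr, h1⟩ := hp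
  obtain ⟨t', ht', s'', hr', h2⟩ := hq s' h1
  exact ⟨_, by omega, s'', hr.seq hr', h2⟩

/-- The effect of a command without loops. -/
def Cmd.exec : Cmd → Store → Store
  | .const x c, s => s.setVar x c
  | .copy x y, s => s.setVar x (s.var y)
  | .inc x, s => s.setVar x (s.var x + 1)
  | .dec x, s => s.setVar x (s.var x - 1)
  | .load x a y, s => s.setVar x (s.arr a (s.var y))
  | .store a y x, s => s.setArr a (s.var y) (s.var x)
  | .skip, s => s
  | .seq p q, s => q.exec (p.exec s)
  | .ite b p q, s => if b.holds s then p.exec s else q.exec s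
  | .while _ _, s => s

/-- A bound for the number of steps of a command without loops. -/
def Cmd.cost : Cmd → ℕ
  | .seq p q => 1 + p.cost + q.cost
  | .ite _ p q => 1 + max p.cost q.cost
  | _ => 1

/-- Whether a command has no loops. -/
def Cmd.loopFree : Cmd → Bool
  | .seq p q => p.loopFree && q.loopFree
  | .ite _ p q => p.loopFree && q.loopFree
  | .while _ _ => false
  | _ => true

theorem Cmd.exec_runs {c : Cmd} (hc : c.loopFree = true) (s : Store) :
    ∃ t ≤ c.cost, Runs c s t (c.exec s) := by
  induction c generalizing s with
  | seq p q ihp ihq =>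
    simp only [Cmd.loopFree, Bool.and_eq_true] at hc
    obtain ⟨t, ht, hr⟩ := ihp hc.1 s
    obtain ⟨t', ht', hr'⟩ := ihq hc.2 (p.exec s)
    exact ⟨1 + t + t', by simp only [Cmd.cost]; omega, hr.seq hr'⟩
  | ite b p q ihp ihq =>
    simp only [Cmd.loopFree, Bool.and_eq_true] at hc
    cases hb : b.holds s
    · obtain ⟨t, ht, hr⟩ := ihq hc.2 s
      refine ⟨1 + t, by simp only [Cmd.cost]; omega, ?_⟩
      simpa [Cmd.exec, hb] using Runs.ite_neg (p := p) hb hr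
    · obtain ⟨t, ht, hr⟩ := ihp hc.1 s
      refine ⟨1 + t, by simp only [Cmd.cost]; omega, ?_⟩
      simpa [Cmd.exec, hb] using Runs.ite_pos (q := q) hb hr
  | const | copy | inc | dec | load | store | skip => exact ⟨1, le_rfl, Runs.one fun _ => rfl⟩
  | _ => exact absurd hc Bool.false_ne_true

/-- The variables that a command may change. -/
def Cmd.vars : Cmd → List ℕ
  | .const x _ | .copy x _ | .inc x | .dec x | .load x _ _ => [x]
  | .store _ _ _ | .skip => []
  | .seq p q | .ite _ p q => p.vars ++ q.vars
  | .while _ p => p.vars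

/-- The arrays that a command may change. -/
def Cmd.arrs : Cmd → List ℕ
  | .store a _ _ => [a]
  | .seq p q | .ite _ p q => p.arrs ++ q.arrs
  | .while _ p => p.arrs
  | _ => []

/-- The memories `s` and `s'` agree on all that the command `c` does not change. -/
structure Frame (c : Cmd) (s s' : Store) : Prop where
  var : ∀ x, x ∉ c.vars → s'.var x = s.var x
  arr : ∀ a, a ∉ c.arrs → s'.arr a = s.arr a

theorem Frame.refl (c : Cmd) (s : Store) : Frame c s s := ⟨fun _ _ => rfl, fun _ _ => rfl⟩

theorem Frame.trans {c : Cmd} {s s' s'' : Store} (h : Frame c s s') (h' : Frame c s' s'') :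
    Frame c s s'' :=
  ⟨fun x hx => (h'.var x hx).trans (h.var x hx), fun a ha => (h'.arr a ha).trans (h.arr a ha)⟩

theorem Frame.weaken {c d : Cmd} {s s' : Store} (h : Frame c s s') (hv : c.vars ⊆ d.vars)
    (ha : c.arrs ⊆ d.arrs) : Frame d s s' :=
  ⟨fun x hx => h.var x fun hc => hx (hv hc), fun a hx => h.arr a fun hc => hx (ha hc)⟩

theorem step_frame (p : Cmd) (f : Config)
    (h : ∀ c ∈ f.todo, c.vars ⊆ p.vars ∧ c.arrs ⊆ p.arrs) :
    (∀ c ∈ (step f).todo, c.vars ⊆ p.vars ∧ c.arrs ⊆ p.arrs) ∧ Frame p f.mem (step f).mem := by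
  obtain ⟨l, s⟩ := f
  cases l with
  | nil => exact ⟨h, .refl _ _⟩
  | cons c k =>
    simp only [List.mem_cons, forall_eq_or_imp] at h
    obtain ⟨⟨hv, ha⟩, hk⟩ := h
    have hset : ∀ x y, x ∈ p.vars → Frame p s (s.setVar x y) := fun x y hx =>
      ⟨fun z hz => Function.update_of_ne (fun e : z = _ => hz (e ▸ hx)) _ _, fun _ _ => rfl⟩
    have hseta : ∀ a i y, a ∈ p.arrs → Frame p s (s.setArr a i y) := fun a i y hx =>
      ⟨fun _ _ => rfl, fun z hz => Function.update_of_ne (fun e : z = _ => hz (e ▸ hx)) _ _⟩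
    cases c with
    | seq q r =>
      simp only [Cmd.vars, Cmd.arrs, List.append_subset] at hv ha
      refine ⟨?_, .refl _ _⟩
      simp only [step, List.mem_cons, forall_eq_or_imp]
      exact ⟨⟨hv.1, ha.1⟩, ⟨hv.2, ha.2⟩, hk⟩
    | ite b q r =>
      simp only [Cmd.vars, Cmd.arrs, List.append_subset] at hv ha
      simp only [step]
      split_ifs
      · refine ⟨?_, .refl _ _⟩
        simp only [List.mem_cons, forall_eq_or_imp]
        exact ⟨⟨hv.1, ha.1⟩, hk⟩
      · refine ⟨?_, .refl _ _⟩
        simp only [List.mem_cons, forall_eq_or_imp]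
        exact ⟨⟨hv.2, ha.2⟩, hk⟩
    | skip => exact ⟨hk, .refl _ _⟩
    | store a x y => exact ⟨hk, hseta _ _ _ (ha (by simp [Cmd.arrs]))⟩
    | const | copy | inc | dec | load => exact ⟨hk, hset _ _ (hv (by simp [Cmd.vars]))⟩
    | _ =>
      simp only [step]
      split_ifs
      · refine ⟨?_, .refl _ _⟩
        simp only [List.mem_cons, forall_eq_or_imp]
        exact ⟨⟨hv, ha⟩, ⟨hv, ha⟩, hk⟩
      · exact ⟨hk, .refl _ _⟩

theorem Runs.frame {c : Cmd} {s s' : Store} {t : ℕ} (h : Runs c s t s') : Frame c s s' := by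
  have key : ∀ t, (∀ d ∈ (step^[t] ⟨[c], s⟩).todo, d.vars ⊆ c.vars ∧ d.arrs ⊆ c.arrs) ∧
      Frame c s (step^[t] ⟨[c], s⟩).mem := by
    intro t
    induction t with
    | zero => exact ⟨by simp, .refl _ _⟩
    | succ t ih =>
      rw [Function.iterate_succ_apply']
      have h1 := step_frame c _ ih.1
      exact ⟨h1.1, ih.2.trans h1.2⟩
  have := (key t).2
  rwa [h []] at this

theorem Achieves.frame {c : Cmd} {s : Store} {T : ℕ} {Q : Store → Prop} (h : Achieves c s T Q) :
    Achieves c s T fun s' => Q s' ∧ Frame c s s' := by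
  obtain ⟨t, ht, s', hr, hq⟩ := h
  exact ⟨t, ht, s', hr, hq, hr.frame⟩

theorem achieves_exec {c : Cmd} (hc : c.loopFree = true) (s : Store) :
    Achieves c s c.cost fun s' => s' = c.exec s := by
  obtain ⟨t, ht, hr⟩ := Cmd.exec_runs hc s
  exact ⟨t, ht, _, hr, rfl⟩

/-- The rule for loops with a loop-free body; the number in the invariant `I` bounds the number of
iterations that remain. -/
theorem achieves_while {b : Test} {c : Cmd} (hc : c.loopFree = true) {s₀ : Store} {N : ℕ}
    {I : ℕ → Store → Prop} (h0 : I N s₀)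
    (hstep : ∀ k s, Frame c s₀ s → I k s → b.holds s = true → ∃ k' < k, I k' (c.exec s)) :
    Achieves (.while b c) s₀ (N * (c.cost + 1) + 1) fun s' =>
      Frame c s₀ s' ∧ b.holds s' = false ∧ ∃ k', I k' s' := by
  suffices key : ∀ k s, Frame c s₀ s → I k s → Achieves (.while b c) s (k * (c.cost + 1) + 1)
      fun s' => Frame c s₀ s' ∧ b.holds s' = false ∧ ∃ k', I k' s' from
    key N s₀ (.refl _ _) h0
  intro k
  induction k using Nat.strong_induction_on with
  | _ k ih =>
    intro s hf hI
    cases hb : b.holds s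
    · exact ⟨1, by omega, s, Runs.while_false hb, hf, hb, k, hI⟩
    · obtain ⟨k', hk', hI'⟩ := hstep k s hf hI hb
      obtain ⟨t, ht, hr⟩ := Cmd.exec_runs hc s
      obtain ⟨t', ht', s', hr', hQ⟩ := ih k' hk' _ (hf.trans hr.frame) hI'
      refine ⟨1 + t + t', ?_, s', Runs.while_true hb hr hr', hQ⟩
      have : (k' + 1) * (c.cost + 1) ≤ k * (c.cost + 1) := Nat.mul_le_mul_right _ hk'
      rw [Nat.add_mul] at this
      omega

/-- The rule for counting loops with a loop-free body. -/
theorem achieves_count {i lim : ℕ} {c : Cmd} (hc : c.loopFree = true)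
    (hlim : lim ∉ c.vars) {s₀ : Store} {N j₀ : ℕ} (hN : s₀.var lim = N) (hj₀ : s₀.var i = j₀) (hle : j₀ ≤ N)
    {I : ℕ → Store → Prop} (h0 : I j₀ s₀)
    (hstep : ∀ j s, Frame c s₀ s → s.var i = j → j₀ ≤ j → j < N → I j s →
      (c.exec s).var i = j + 1 ∧ I (j + 1) (c.exec s)) :
    Achieves (.while (.lt i lim) c) s₀ (N * (c.cost + 1) + 1) fun s' =>
      Frame c s₀ s' ∧ I N s' := by
  have h := achieves_while (b := .lt i lim) hc (N := N - j₀) (s₀ := s₀)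
    (I := fun k s => ∃ j, s.var i = j ∧ j₀ ≤ j ∧ k + j = N ∧ I j s)
    ⟨j₀, hj₀, le_rfl, by omega, h0⟩ ?_
  · refine h.mono ?_ ?_
    · have := Nat.mul_le_mul_right (c.cost + 1) (Nat.sub_le N j₀)
      omega
    · rintro s' ⟨hf, hb, k, j, hj, -, hk, hI⟩
      have hl : s'.var lim = N := (hf.var lim hlim).trans hN
      simp only [Test.holds, hj, hl, decide_eq_false_iff_not] at hb
      obtain rfl : j = N := by omega
      exact ⟨hf, hI⟩
  · rintro k s hf ⟨j, hj, hle', hk, hI⟩ hb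
    have hl : s.var lim = N := (hf.var lim hlim).trans hN
    simp only [Test.holds, hj, hl, decide_eq_true_eq] at hb
    obtain ⟨h1, h2⟩ := hstep j s hf hj hle' hb hI
    exact ⟨k - 1, by omega, j + 1, h1, by omega, by omega, h2⟩

theorem Frame.seq_while {p c : Cmd} {b : Test} {s s' s'' : Store} (h : Frame p s s')
    (h' : Frame c s' s'') : Frame (.seq p (.while b c)) s s'' :=
  (h.weaken (by simp [Cmd.vars]) (by simp [Cmd.arrs])).trans
    (h'.weaken (by simp [Cmd.vars]) (by simp [Cmd.arrs]))

/-- A loop-free command followed by a counting loop. -/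
theorem achieves_for {p c : Cmd} {i lim : ℕ} (hp : p.loopFree = true) (hc : c.loopFree = true)
    (hlim : lim ∉ c.vars) {s : Store} {N j₀ : ℕ} (hN : (p.exec s).var lim = N)
    (hj₀ : (p.exec s).var i = j₀) (hle : j₀ ≤ N) {I : ℕ → Store → Prop} (h0 : I j₀ (p.exec s))
    (hstep : ∀ j s', Frame (.seq p (.while (.lt i lim) c)) s s' → s'.var i = j → j₀ ≤ j → j < N →
      I j s' → (c.exec s').var i = j + 1 ∧ I (j + 1) (c.exec s')) :
    Achieves (.seq p (.while (.lt i lim) c)) s (p.cost + 2 + N * (c.cost + 1)) fun s' =>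
      Frame (.seq p (.while (.lt i lim) c)) s s' ∧ I N s' := by
  obtain ⟨_, -, hr⟩ := Cmd.exec_runs hp s
  refine ((achieves_exec hp s).seq (Q' := fun s' => I N s') ?_).frame.mono
    (T := 1 + p.cost + (N * (c.cost + 1) + 1)) (by omega) (fun s' h => ⟨h.2, h.1⟩)
  rintro _ rfl
  refine (achieves_count hc hlim hN hj₀ hle h0 fun j s' hf' => ?_).mono le_rfl (fun _ h => h.2)
  exact hstep j s' (hr.frame.seq_while hf')

/-! ### Adjacency lists -/

/-- The arcs `1, …, M` of a directed graph on `0, …, n - 1`, with sources `src` and targets `dst`,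
are linked into one list for each vertex: the list of `x` starts with the arc `cur x`, the arc `a`
is followed by the arc `next a`, and `0` marks the end of a list.  The numbers of the arcs decrease
along the lists, so that the part of the list of `x` that starts with `a` consists of the arcs with
source `x` and number at most `a`. -/
structure LinkedArcs (n M : ℕ) (src dst next cur : ℕ → ℕ) : Prop where
  src_lt : ∀ a, 1 ≤ a → a ≤ M → src a < n
  dst_lt : ∀ a, 1 ≤ a → a ≤ M → dst a < n
  next_lt : ∀ a, 1 ≤ a → a ≤ M → next a < a
  src_next : ∀ a, 1 ≤ a → a ≤ M → next a ≠ 0 → src (next a) = src a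
  le_next : ∀ a, 1 ≤ a → a ≤ M → ∀ b, 1 ≤ b → b < a → src b = src a → b ≤ next a
  cur_le : ∀ x < n, cur x ≤ M
  src_cur : ∀ x < n, cur x ≠ 0 → src (cur x) = x
  le_cur : ∀ b, 1 ≤ b → b ≤ M → b ≤ cur (src b)

open Function in
theorem LinkedArcs.push {n M : ℕ} {src dst next cur : ℕ → ℕ}
    (h : LinkedArcs n M src dst next cur) {x y : ℕ} (hx : x < n) (hy : y < n) :
    LinkedArcs n (M + 1) (update src (M + 1) x) (update dst (M + 1) y)
      (update next (M + 1) (cur x)) (update cur x (M + 1)) := by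
  have hne : ∀ a, a ≤ M → a ≠ M + 1 := fun a ha => by omega
  have hcur := h.cur_le x hx
  constructor
  · intro a h1 h2
    rcases Nat.le_succ_iff.1 h2 with h3 | rfl
    · rw [update_of_ne (hne a h3)]; exact h.src_lt a h1 h3
    · simpa using hx
  · intro a h1 h2
    rcases Nat.le_succ_iff.1 h2 with h3 | rfl
    · rw [update_of_ne (hne a h3)]; exact h.dst_lt a h1 h3
    · simpa using hy
  · intro a h1 h2
    rcases Nat.le_succ_iff.1 h2 with h3 | rfl
    · rw [update_of_ne (hne a h3)]; exact h.next_lt a h1 h3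
    · rw [update_self]; omega
  · intro a h1 h2
    rcases Nat.le_succ_iff.1 h2 with h3 | rfl
    · have := h.next_lt a h1 h3
      rw [update_of_ne (hne a h3), update_of_ne (hne a h3), update_of_ne (by omega)]
      exact h.src_next a h1 h3
    · rw [update_self, update_self, update_of_ne (hne _ hcur)]
      exact h.src_cur x hx
  · intro a h1 h2 b hb hba
    rcases Nat.le_succ_iff.1 h2 with h3 | rfl
    · rw [update_of_ne (hne a h3), update_of_ne (hne a h3), update_of_ne (by omega)]
      exact h.le_next a h1 h3 b hb hba
    · rw [update_self, update_self, update_of_ne (by omega)]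
      rintro rfl
      exact h.le_cur b hb (by omega)
  · intro z hz
    have := h.cur_le z hz
    simp only [update_apply]
    split_ifs <;> omega
  · intro z hz
    have := h.cur_le z hz
    by_cases e : z = x
    · subst e; simp
    · rw [update_of_ne e, update_of_ne (by omega)]
      exact h.src_cur z hz
  · intro b h1 h2
    rcases Nat.le_succ_iff.1 h2 with h3 | rfl
    · rw [update_of_ne (hne b h3)]
      have := h.le_cur b h1 h3
      simp only [update_apply]
      split_ifs <;> omega
    · simp

/-! ### Depth-first search -/

/-- In the course of a search, `a` is an ancestor of `b`, or `b` itself; the visited vertices are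
those with a number `pre` other than `0`, and the root is `0`. -/
def SearchAncestor (par pre : ℕ → ℕ) (a b : ℕ) : Prop :=
  Relation.ReflTransGen (fun u w => w ≠ 0 ∧ pre w ≠ 0 ∧ par w = u) a b

/-- The state of a depth-first search from `0` that stands at the vertex `x`, or has ended if `x =
n`.  `D` is the set of the finished vertices, from which the search has returned; the visited
vertices outside `D` are the ancestors of `x`.  The part of the list of arcs of `y` that starts
with `cur y` has not yet been scanned. -/
structure SearchState (n M : ℕ) (src dst cur par parc pre ord : ℕ → ℕ) (x cnt : ℕ)
    (D : Finset ℕ) : Prop where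
  x_le : x ≤ n
  x_open : x < n → pre x ≠ 0 ∧ x ∉ D
  done : ∀ y ∈ D, y < n ∧ pre y ≠ 0 ∧ cur y = 0
  ancestor : ∀ y < n, pre y ≠ 0 → y ∉ D → x < n ∧ SearchAncestor par pre y x
  root : pre 0 = 1 ∧ par 0 = n
  parent : ∀ y < n, pre y ≠ 0 → y ≠ 0 → par y < n ∧ pre (par y) ≠ 0 ∧ pre (par y) < pre y ∧
    1 ≤ parc y ∧ parc y ≤ M ∧ src (parc y) = par y ∧ dst (parc y) = y ∧ (par y ∈ D → y ∈ D)
  cur_le : ∀ y < n, cur y ≤ M ∧ (cur y ≠ 0 → src (cur y) = y)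
  scanned : ∀ b, 1 ≤ b → b ≤ M → cur (src b) < b → pre (dst b) ≠ 0
  order : ∀ y < n, pre y ≠ 0 → pre y ≤ cnt ∧ ord (pre y) = y
  order_inv : ∀ i, 1 ≤ i → i ≤ cnt → ord i < n ∧ pre (ord i) = i
  related : ∀ b c, 1 ≤ b → b ≤ M → 1 ≤ c → c ≤ M → src c = dst b → dst c = src b →
    pre (src b) ≠ 0 → pre (dst b) ≠ 0 →
      SearchAncestor par pre (src b) (dst b) ∨ SearchAncestor par pre (dst b) (src b)

/-- The number of arcs that have not yet been scanned. -/
def unscanned (M : ℕ) (src cur : ℕ → ℕ) : ℕ :=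
  ((Finset.Icc 1 M).filter fun b => b ≤ cur (src b)).card

section Search

open Function

variable {n M : ℕ} {src dst next cur₀ cur par parc pre ord : ℕ → ℕ} {x cnt : ℕ} {D : Finset ℕ}

theorem SearchState.init (hn : 0 < n) (h : LinkedArcs n M src dst next cur)
    (hpre : ∀ y < n, pre y = 0) (par parc ord : ℕ → ℕ) :
    SearchState n M src dst cur (update par 0 n) parc (update pre 0 1) (update ord 1 0) 0 1 ∅ := by
  have hvis : ∀ y < n, update pre 0 1 y ≠ 0 → y = 0 := by
    intro y hy h1
    by_contra hc
    rw [update_of_ne hc] at h1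
    exact h1 (hpre y hy)
  constructor
  · omega
  · simp
  · simp
  · intro y hy h1 _
    exact ⟨hn, hvis y hy h1 ▸ .refl⟩
  · simp
  · intro y hy h1 h2
    exact absurd (hvis y hy h1) h2
  · exact fun y hy => ⟨h.cur_le y hy, h.src_cur y hy⟩
  · intro b h1 h2 h3
    have := h.le_cur b h1 h2
    omega
  · intro y hy h1
    rw [hvis y hy h1]
    simp
  · intro i h1 h2
    obtain rfl : i = 1 := by omega
    simpa using hn
  · intro b c h1 h2 h3 h4 h5 h6 h7 h8
    left
    rw [hvis _ (h.src_lt b h1 h2) h7, hvis _ (h.dst_lt b h1 h2) h8]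
    exact .refl

/-- Facts common to both kinds of steps that scan the arc `cur x`. -/
theorem SearchState.scan_aux (h : SearchState n M src dst cur par parc pre ord x cnt D)
    (hl : LinkedArcs n M src dst next cur₀) (hx : x < n) (hc : cur x ≠ 0) :
    (∀ y < n, update cur x (next (cur x)) y ≤ M ∧ (update cur x (next (cur x)) y ≠ 0 →
      src (update cur x (next (cur x)) y) = y)) ∧
    (∀ b, 1 ≤ b → b ≤ M → update cur x (next (cur x)) (src b) < b → b = cur x ∨
      cur (src b) < b) ∧
    unscanned M src (update cur x (next (cur x))) < unscanned M src cur := by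
  obtain ⟨hM, hsrc⟩ := h.cur_le x hx
  have hsrc := hsrc hc
  have hlt := hl.next_lt _ (Nat.one_le_iff_ne_zero.2 hc) hM
  refine ⟨?_, ?_, ?_⟩
  · intro y hy
    by_cases e : y = x
    · subst e
      rw [update_self]
      refine ⟨by omega, fun hne => ?_⟩
      rw [hl.src_next _ (Nat.one_le_iff_ne_zero.2 hc) hM hne, hsrc]
    · rw [update_of_ne e]
      exact h.cur_le y hy
  · intro b h1 h2 h3
    by_cases e : src b = x
    · rw [e, update_self] at h3
      by_contra hcon
      push Not at hcon
      rw [e] at hcon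
      have := hl.le_next _ (Nat.one_le_iff_ne_zero.2 hc) hM b h1 (by omega) (by rw [e, hsrc])
      omega
    · rw [update_of_ne e] at h3
      exact Or.inr h3
  · refine Finset.card_lt_card (Finset.ssubset_iff_of_subset ?_ |>.2 ⟨cur x, ?_, ?_⟩)
    · intro b hb
      simp only [Finset.mem_filter, Finset.mem_Icc] at hb ⊢
      refine ⟨hb.1, ?_⟩
      by_cases e : src b = x
      · rw [e, update_self] at hb
        rw [e]
        omega
      · rw [update_of_ne e] at hb
        exact hb.2
    · simp only [Finset.mem_filter, Finset.mem_Icc, hsrc]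
      omega
    · simp only [Finset.mem_filter, Finset.mem_Icc, hsrc, update_self]
      omega

theorem SearchState.skip (h : SearchState n M src dst cur par parc pre ord x cnt D)
    (hl : LinkedArcs n M src dst next cur₀) (hx : x < n) (hc : cur x ≠ 0)
    (hd : pre (dst (cur x)) ≠ 0) :
    SearchState n M src dst (update cur x (next (cur x))) par parc pre ord x cnt D := by
  obtain ⟨h1, h2, -⟩ := h.scan_aux hl hx hc
  refine { h with done := ?_, cur_le := h1, scanned := ?_ }
  · intro y hy
    have := h.done y hy
    rw [update_of_ne]
    · exact this
    · rintro rfl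
      exact (h.x_open hx).2 hy
  · intro b h3 h4 h5
    rcases h2 b h3 h4 h5 with rfl | h6
    · exact hd
    · exact h.scanned b h3 h4 h6

/-- Visiting a new vertex `y`.  No finished vertex is adjacent to `y`, as its arcs have been
scanned; so all visited neighbours of `y` are on the branch that ends in `y`. -/
theorem SearchState.visit (h : SearchState n M src dst cur par parc pre ord x cnt D)
    (hl : LinkedArcs n M src dst next cur₀) (hx : x < n) (hc : cur x ≠ 0) {y : ℕ}
    (hy : dst (cur x) = y) (hd : pre y = 0) :
    SearchState n M src dst (update cur x (next (cur x))) (update par y x)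
      (update parc y (cur x)) (update pre y (cnt + 1)) (update ord (cnt + 1) y) y (cnt + 1) D := by
  obtain ⟨h1, h2, -⟩ := h.scan_aux hl hx hc
  obtain ⟨hM, hsrc⟩ := h.cur_le x hx
  have hsrc := hsrc hc
  have hyn : y < n := hy ▸ hl.dst_lt _ (Nat.one_le_iff_ne_zero.2 hc) hM
  have hne : ∀ z, pre z ≠ 0 → z ≠ y := fun z hz e => hz (e ▸ hd)
  have hy0 : y ≠ 0 := fun e => by
    have := h.root.1
    rw [← e, hd] at this
    omega
  have hxv := (h.x_open hx).1
  have hvis : ∀ z, update pre y (cnt + 1) z ≠ 0 → z ≠ y → pre z ≠ 0 := fun z hz hzy => by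
    rwa [update_of_ne hzy] at hz
  have hvis' : ∀ z, pre z ≠ 0 → update pre y (cnt + 1) z ≠ 0 := fun z hz => by
    rwa [update_of_ne (hne z hz)]
  have hmono : ∀ a b, SearchAncestor par pre a b →
      SearchAncestor (update par y x) (update pre y (cnt + 1)) a b := by
    intro a b hab
    refine Relation.ReflTransGen.mono (fun u w hw => ?_) _ _ hab
    refine ⟨hw.1, hvis' _ hw.2.1, ?_⟩
    rw [update_of_ne (hne w hw.2.1)]
    exact hw.2.2
  have hxy : SearchAncestor (update par y x) (update pre y (cnt + 1)) x y :=
    Relation.ReflTransGen.single ⟨hy0, by simp, by simp⟩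
  have hyD : y ∉ D := fun hyD => (h.done y hyD).2.1 hd
  have hanc : ∀ z < n, pre z ≠ 0 → z ∉ D →
      SearchAncestor (update par y x) (update pre y (cnt + 1)) z y := fun z hz hz1 hz2 =>
    (hmono _ _ (h.ancestor z hz hz1 hz2).2).trans hxy
  -- a finished vertex has no arc to `y`
  have hfin : ∀ b, 1 ≤ b → b ≤ M → dst b = y → src b ∉ D := by
    intro b h3 h4 h5 h6
    refine h.scanned b h3 h4 ?_ (h5 ▸ hd)
    rw [(h.done _ h6).2.2]
    omega
  constructor
  · omega
  · exact fun _ => ⟨by simp, hyD⟩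
  · intro z hz
    obtain ⟨h3, h4, h5⟩ := h.done z hz
    refine ⟨h3, hvis' z h4, ?_⟩
    rw [update_of_ne]
    · exact h5
    · rintro rfl
      exact (h.x_open hx).2 hz
  · intro z hz hz1 hz2
    refine ⟨hyn, ?_⟩
    by_cases e : z = y
    · exact e ▸ .refl
    · exact hanc z hz (hvis z hz1 e) hz2
  · rw [update_of_ne (Ne.symm hy0), update_of_ne (Ne.symm hy0)]
    exact h.root
  · intro z hz hz1 hz0
    by_cases e : z = y
    · subst e
      have := (h.order x hx hxv).1
      rw [update_self, update_self, update_self, update_of_ne (hne x hxv)]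
      refine ⟨hx, hxv, by omega, Nat.one_le_iff_ne_zero.2 hc, hM, hsrc, hy, fun hD => ?_⟩
      exact absurd hD (h.x_open hx).2
    · obtain ⟨h3, h4, h5, h6⟩ := h.parent z hz (hvis z hz1 e) hz0
      rw [update_of_ne e, update_of_ne e, update_of_ne e, update_of_ne (hne _ h4)]
      exact ⟨h3, h4, h5, h6⟩
  · exact h1
  · intro b h3 h4 h5
    rcases h2 b h3 h4 h5 with rfl | h6
    · rw [hy]
      simp
    · exact hvis' _ (h.scanned b h3 h4 h6)
  · intro z hz hz1
    by_cases e : z = y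
    · subst e
      simp
    · obtain ⟨h3, h4⟩ := h.order z hz (hvis z hz1 e)
      rw [update_of_ne e, update_of_ne (by omega)]
      exact ⟨by omega, h4⟩
  · intro i hi hi'
    rcases Nat.le_succ_iff.1 hi' with h3 | rfl
    · obtain ⟨h4, h5⟩ := h.order_inv i hi h3
      rw [update_of_ne (by omega : i ≠ cnt + 1), update_of_ne (hne _ (by omega))]
      exact ⟨h4, h5⟩
    · simpa using hyn
  · intro b c hb hb' hcc hc' h3 h4 h5 h6
    by_cases e : src b = y
    · by_cases e' : dst b = y
      · rw [e, e']
        exact Or.inl .refl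
      · right
        rw [e]
        refine hanc _ (hl.dst_lt b hb hb') (hvis _ h6 e') ?_
        rw [← h3]
        exact hfin c hcc hc' (h4.trans e)
    · by_cases e' : dst b = y
      · left
        rw [e']
        exact hanc _ (hl.src_lt b hb hb') (hvis _ h5 e) (hfin b hb hb' e')
      · exact (h.related b c hb hb' hcc hc' h3 h4 (hvis _ h5 e) (hvis _ h6 e')).imp
          (hmono _ _) (hmono _ _)

theorem SearchState.finish (h : SearchState n M src dst cur par parc pre ord x cnt D)
    (hx : x < n) (hc : cur x = 0) :
    SearchState n M src dst cur par parc pre ord (par x) cnt (insert x D) := by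
  obtain ⟨hxv, hxD⟩ := h.x_open hx
  have hroot := h.root
  refine { h with x_le := ?_, x_open := ?_, done := ?_, ancestor := ?_, parent := ?_ }
  · by_cases e : x = 0
    · rw [e, hroot.2]
    · exact (h.parent x hx hxv e).1.le
  · intro hpx
    have e : x ≠ 0 := fun e => by
      rw [e, hroot.2] at hpx
      omega
    obtain ⟨h1, h2, h3, -, -, -, -, h4⟩ := h.parent x hx hxv e
    refine ⟨h2, fun hm => ?_⟩
    rcases Finset.mem_insert.1 hm with h5 | h5
    · rw [h5] at h3
      omega
    · exact hxD (h4 h5)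
  · intro y hy
    rcases Finset.mem_insert.1 hy with rfl | hy
    · exact ⟨hx, hxv, hc⟩
    · exact h.done y hy
  · intro y hy hy1 hy2
    rw [Finset.mem_insert, not_or] at hy2
    rcases Relation.ReflTransGen.cases_tail (h.ancestor y hy hy1 hy2.2).2 with e |
      ⟨z, h1, h2, h3, rfl⟩
    · exact absurd e.symm hy2.1
    · exact ⟨(h.parent x hx hxv h2).1, h1⟩
  · intro y hy hy1 hy0
    obtain ⟨h1, h2, h3, h4, h5, h6, h7, h8⟩ := h.parent y hy hy1 hy0
    refine ⟨h1, h2, h3, h4, h5, h6, h7, fun hm => ?_⟩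
    rw [Finset.mem_insert] at hm ⊢
    rcases hm with hm | hm
    · by_contra hyD
      push Not at hyD
      -- an open child of `x` would be an ancestor of `x`
      have h9 := (h.ancestor y hy hy1 hyD.2).2
      have h10 : ∀ b, SearchAncestor par pre y b → b < n → pre y ≤ pre b := by
        intro b hb
        induction hb with
        | refl => exact fun _ => le_rfl
        | tail _ hbc ih =>
          intro hbn
          obtain ⟨h11, h12, rfl⟩ := hbc
          obtain ⟨h13, -, h14, -⟩ := h.parent _ hbn h12 h11
          exact (ih h13).trans h14.le
      have h15 := h10 x h9 hx
      rw [hm] at h3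
      omega
    · exact Or.inr (h8 hm)

end Search

/-! ### The program -/

-- The scalar variables.  Those for the input, the root and the number of entries in the list of
-- components are prescribed; `runᵥ` tells whether the main loop goes on, `arcsᵥ` is the number of
-- arcs, `cntᵥ` the number of vertices visited, `foundᵥ` the edge found, and `oneᵥ` and `zeroᵥ` are
-- constants.  The other ones are temporary.
notation "nᵥ" => 0
notation "mᵥ" => 1
notation "rootᵥ" => 2
notation "lenᵥ" => 3
notation "runᵥ" => 4
notation "arcsᵥ" => 5
notation "iᵥ" => 6
notation "xᵥ" => 7
notation "yᵥ" => 8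
notation "aᵥ" => 9
notation "bᵥ" => 10
notation "pᵥ" => 11
notation "qᵥ" => 12
notation "cntᵥ" => 13
notation "foundᵥ" => 14
notation "oneᵥ" => 15
notation "zeroᵥ" => 16

-- The arrays.  The first seven are prescribed.  The next three are indexed by arcs (source, target,
-- next arc with the same source); the other ones belong to the vertices, except for `ordₐ`, which
-- holds the vertices in the order of their numbers `preₐ`.
notation "tailₐ" => 0
notation "headₐ" => 1
notation "treeₐ" => 2
notation "revTreeₐ" => 3
notation "edgesₐ" => 4
notation "vertexₐ" => 5
notation "nameₐ" => 6
notation "srcₐ" => 7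
notation "dstₐ" => 8
notation "nextₐ" => 9
notation "curₐ" => 10
notation "parₐ" => 11
notation "parArcₐ" => 12
notation "preₐ" => 13
notation "ordₐ" => 14
notation "lowₐ" => 15
notation "labₐ" => 16

infixr:60 " ;; " => Cmd.seq

/-- Empty all lists of arcs and make all vertices unvisited. -/
def clear : Cmd :=
  (.const arcsᵥ 0 ;; .const iᵥ 0) ;;
  .while (.lt iᵥ nᵥ) (.store curₐ iᵥ zeroᵥ ;; .store preₐ iᵥ zeroᵥ ;; .inc iᵥ)

/-- Put a new arc from the vertex in variable `x` to the vertex in variable `y` at the front of the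
list of the former. -/
def push (x y : ℕ) : Cmd :=
  .inc arcsᵥ ;; .store srcₐ arcsᵥ x ;; .store dstₐ arcsᵥ y ;; .load bᵥ curₐ x ;;
  .store nextₐ arcsᵥ bᵥ ;; .store curₐ x arcsᵥ

/-- Build the lists for the graph in which arc `j + 1` leads from entry `j` of array `a` to entry
`j` of array `b`. -/
def linkAll (a b : ℕ) : Cmd :=
  .const iᵥ 0 ;;
  .while (.lt iᵥ mᵥ) (.load xᵥ a iᵥ ;; .load yᵥ b iᵥ ;; push xᵥ yᵥ ;; .inc iᵥ)

/-- Build the lists for the graph that has two opposite arcs for each edge in the set under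
construction. -/
def linkChosen : Cmd :=
  .const iᵥ 0 ;;
  .while (.lt iᵥ mᵥ)
    (.load pᵥ edgesₐ iᵥ ;;
    .ite (.ne pᵥ zeroᵥ)
      (.load xᵥ tailₐ iᵥ ;; .load yᵥ headₐ iᵥ ;; push xᵥ yᵥ ;; push yᵥ xᵥ)
      .skip ;;
    .inc iᵥ)

/-- One step of the depth-first search at the vertex in variable `xᵥ`. -/
def searchStep : Cmd :=
  .load aᵥ curₐ xᵥ ;;
  .ite (.ne aᵥ zeroᵥ)
    (.load bᵥ nextₐ aᵥ ;; .store curₐ xᵥ bᵥ ;; .load yᵥ dstₐ aᵥ ;; .load pᵥ preₐ yᵥ ;;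
    .ite (.eq pᵥ zeroᵥ)
      (.inc cntᵥ ;; .store preₐ yᵥ cntᵥ ;; .store ordₐ cntᵥ yᵥ ;; .store parₐ yᵥ xᵥ ;;
      .store parArcₐ yᵥ aᵥ ;; .copy xᵥ yᵥ)
      .skip)
    (.load xᵥ parₐ xᵥ)

/-- Depth-first search from the root, whose parent is set to `n`. -/
def search : Cmd :=
  (.store preₐ rootᵥ oneᵥ ;; .const cntᵥ 1 ;; .store ordₐ cntᵥ rootᵥ ;;
  .store parₐ rootᵥ nᵥ ;; .copy xᵥ rootᵥ) ;;
  .while (.lt xᵥ nᵥ) searchStep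

/-- Mark the edges of the tree that has been found, in array `a` and among the chosen edges. -/
def markTree (a : ℕ) : Cmd :=
  .const iᵥ 0 ;;
  .while (.lt iᵥ nᵥ)
    (.ite (.ne iᵥ rootᵥ)
      (.load aᵥ parArcₐ iᵥ ;; .dec aᵥ ;; .store a aᵥ oneᵥ ;; .store edgesₐ aᵥ oneᵥ)
      .skip ;;
    .inc iᵥ)

/-- Start the computation of the low numbers with the numbers of the vertices. -/
def lowInit : Cmd :=
  .const iᵥ 0 ;;
  .while (.lt iᵥ nᵥ) (.load pᵥ preₐ iᵥ ;; .store lowₐ iᵥ pᵥ ;; .inc iᵥ)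

/-- Take the neighbours of each vertex into account. -/
def lowArcs : Cmd :=
  .const iᵥ 0 ;;
  .while (.lt iᵥ arcsᵥ)
    (.inc iᵥ ;; .load xᵥ srcₐ iᵥ ;; .load yᵥ dstₐ iᵥ ;; .load pᵥ preₐ yᵥ ;; .load qᵥ lowₐ xᵥ ;;
    .ite (.lt pᵥ qᵥ) (.store lowₐ xᵥ pᵥ) .skip)

/-- Take the subtree of each vertex into account, from the last vertex visited to the first one. -/
def lowTree : Cmd :=
  .copy iᵥ cntᵥ ;;
  .while (.lt oneᵥ iᵥ)
    (.load xᵥ ordₐ iᵥ ;; .load yᵥ parₐ xᵥ ;; .load pᵥ lowₐ xᵥ ;; .load qᵥ lowₐ yᵥ ;;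
    .ite (.lt pᵥ qᵥ) (.store lowₐ yᵥ pᵥ) .skip ;; .dec iᵥ)

/-- Add the vertex in variable `x` to the component that is named by the number in variable `c`. -/
def listVertex (x c : ℕ) : Cmd :=
  .store vertexₐ lenᵥ x ;; .store nameₐ lenᵥ c ;; .inc lenᵥ

/-- Compute the labels, from the first vertex visited to the last one, and list the components. -/
def labelling : Cmd :=
  (.const lenᵥ 0 ;; .store labₐ rootᵥ rootᵥ ;; .const iᵥ 1) ;;
  .while (.lt iᵥ cntᵥ)
    (.inc iᵥ ;; .load xᵥ ordₐ iᵥ ;; .load yᵥ parₐ xᵥ ;; .load pᵥ lowₐ xᵥ ;; .load qᵥ preₐ yᵥ ;;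
    .ite (.lt pᵥ qᵥ) (.load bᵥ labₐ yᵥ) (.copy bᵥ xᵥ ;; listVertex yᵥ bᵥ) ;;
    .store labₐ xᵥ bᵥ ;; listVertex xᵥ bᵥ)

/-- Look for an edge outside the chosen set whose ends lie in no common component; if edge `j` is
the last one then `foundᵥ` is set to `j + 1`. -/
def findEdge : Cmd :=
  (.const foundᵥ 0 ;; .const iᵥ 0) ;;
  .while (.lt iᵥ mᵥ)
    (.load pᵥ edgesₐ iᵥ ;;
    .ite (.eq pᵥ zeroᵥ)
      (.load xᵥ tailₐ iᵥ ;; .load yᵥ headₐ iᵥ ;; .load pᵥ labₐ xᵥ ;; .load qᵥ labₐ yᵥ ;;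
      .ite (.ne pᵥ qᵥ)
        (.load aᵥ parₐ pᵥ ;; .load bᵥ parₐ qᵥ ;;
        .ite (.ne aᵥ yᵥ) (.ite (.ne bᵥ xᵥ) (.copy foundᵥ iᵥ ;; .inc foundᵥ) .skip) .skip)
        .skip)
      .skip ;;
    .inc iᵥ)

/-- The strongly biconnected components of the graph with the chosen edges. -/
def components : Cmd :=
  clear ;; linkChosen ;; search ;; lowInit ;; lowArcs ;; lowTree ;; labelling

/-- Add an edge whose ends lie in no common component; if there is none, clear `runᵥ`. -/
def addEdge : Cmd :=
  findEdge ;;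
  .ite (.ne foundᵥ zeroᵥ)
    (.dec foundᵥ ;; .store edgesₐ foundᵥ oneᵥ)
    (.const runᵥ 0)

/-- Compute a spanning tree, rooted at `rootᵥ`, of the graph whose edges lead from the entries of
array `a` to those of array `b`, and mark it in array `c`. -/
def spanningTree (a b c : ℕ) : Cmd :=
  clear ;; linkAll a b ;; search ;; markTree c

/-- The main loop. -/
def mainLoop : Cmd := .while (.ne runᵥ zeroᵥ) (components ;; addEdge)

/-- The whole program. -/
def augmentationProgram : Cmd :=
  ((.const oneᵥ 1 ;; .const rootᵥ 0) ;; spanningTree tailₐ headₐ treeₐ) ;;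
  spanningTree headₐ tailₐ revTreeₐ ;; .const runᵥ 1 ;; mainLoop

/-! ### Correctness of the parts -/

@[simp] theorem var_setVar_self (s : Store) (x c : ℕ) : (s.setVar x c).var x = c :=
  Function.update_self _ _ _

@[simp] theorem var_setVar_of_ne (s : Store) {x y : ℕ} (c : ℕ) (h : y ≠ x) :
    (s.setVar x c).var y = s.var y := Function.update_of_ne h _ _

@[simp] theorem arr_setVar (s : Store) (x c : ℕ) : (s.setVar x c).arr = s.arr := rfl

@[simp] theorem var_setArr (s : Store) (a i c : ℕ) : (s.setArr a i c).var = s.var := rfl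

@[simp] theorem arr_setArr_self (s : Store) (a i c : ℕ) :
    (s.setArr a i c).arr a = Function.update (s.arr a) i c := Function.update_self _ _ _

@[simp] theorem arr_setArr_of_ne (s : Store) {a b : ℕ} (i c : ℕ) (h : b ≠ a) :
    (s.setArr a i c).arr b = s.arr b := Function.update_of_ne h _ _

/-- The memory holds the input and the constants of the program. -/
structure HoldsInput {n m : ℕ} (e : Fin m → Fin n × Fin n) (s : Store) : Prop where
  var_n : s.var nᵥ = n
  var_m : s.var mᵥ = m
  var_root : s.var rootᵥ = 0
  var_one : s.var oneᵥ = 1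
  var_zero : s.var zeroᵥ = 0
  tail : ∀ j : Fin m, s.arr tailₐ j = (e j).1
  head : ∀ j : Fin m, s.arr headₐ j = (e j).2

/-- The command `c` leaves the input and the constants alone. -/
def Cmd.KeepsInput (c : Cmd) : Prop :=
  (∀ x ∈ [nᵥ, mᵥ, rootᵥ, oneᵥ, zeroᵥ], x ∉ c.vars) ∧ ∀ a ∈ [tailₐ, headₐ], a ∉ c.arrs

instance (c : Cmd) : Decidable c.KeepsInput := by
  unfold Cmd.KeepsInput
  infer_instance

section Parts

variable {n m : ℕ} {e : Fin m → Fin n × Fin n} {s s' : Store}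

theorem HoldsInput.of_frame (h : HoldsInput e s) {c : Cmd} (hc : c.KeepsInput)
    (hf : Frame c s s') : HoldsInput e s' := by
  obtain ⟨h1, h2⟩ := hc
  simp only [List.mem_cons, List.not_mem_nil, or_false, forall_eq_or_imp, forall_eq] at h1 h2
  obtain ⟨a1, a2, a3, a4, a5⟩ := h1
  obtain ⟨b1, b2⟩ := h2
  constructor
  · rw [hf.var _ a1]; exact h.var_n
  · rw [hf.var _ a2]; exact h.var_m
  · rw [hf.var _ a3]; exact h.var_root
  · rw [hf.var _ a4]; exact h.var_one
  · rw [hf.var _ a5]; exact h.var_zero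
  · rw [hf.arr _ b1]; exact h.tail
  · rw [hf.arr _ b2]; exact h.head

/-- The arcs in memory are linked. -/
def Linked (n : ℕ) (s : Store) : Prop :=
  LinkedArcs n (s.var arcsᵥ) (s.arr srcₐ) (s.arr dstₐ) (s.arr nextₐ) (s.arr curₐ)

theorem clear_achieves (h : HoldsInput e s) :
    Achieves clear s (10 * (n + 1)) fun s' => s'.var arcsᵥ = 0 ∧ Linked n s' ∧
      ∀ y < n, s'.arr preₐ y = 0 := by
  refine (achieves_for (N := n) (j₀ := 0) (I := fun j s => s.var arcsᵥ = 0 ∧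
    ∀ y < j, s.arr curₐ y = 0 ∧ s.arr preₐ y = 0) rfl rfl (by decide) ?_ ?_
      (Nat.zero_le _) ?_ ?_).mono ?_ ?_
  · simp [Cmd.exec, h.var_n]
  · simp [Cmd.exec]
  · simp [Cmd.exec]
  · intro j s1 hf hj _ hjn ⟨h1, h2⟩
    have hz := (h.of_frame (by decide) hf).var_zero
    simp only [Cmd.exec, var_setVar_self, var_setArr, arr_setVar, hj, true_and,
      arr_setArr_self, arr_setArr_of_ne, hz, ne_eq, Nat.reduceEqDiff,
      not_false_eq_true, var_setVar_of_ne]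
    refine ⟨h1, fun y hy => ?_⟩
    by_cases e : y = j
    · subst e; simp
    · simp [e, h2 y (by omega)]
  · simp [Cmd.cost]; omega
  · rintro s' ⟨-, h1, h2⟩
    refine ⟨h1, ?_, fun y hy => (h2 y hy).2⟩
    unfold Linked
    rw [h1]
    constructor <;> intro a ha <;> try omega
    · rw [(h2 a ha).1]
    · exact fun hc => absurd (h2 a ha).1 hc

end Parts

theorem exec_frame {c : Cmd} (hc : c.loopFree = true) (s : Store) : Frame c s (c.exec s) := by
  obtain ⟨_, -, hr⟩ := Cmd.exec_runs hc s
  exact hr.frame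

section Links

variable {n m : ℕ} {e : Fin m → Fin n × Fin n} {s s' : Store}

theorem push_exec {x y : ℕ} (hx : x ≠ arcsᵥ) (hx' : x ≠ bᵥ) (hy : y ≠ arcsᵥ) (s : Store) :
    ((push x y).exec s).var arcsᵥ = s.var arcsᵥ + 1 ∧
    ((push x y).exec s).arr srcₐ =
      Function.update (s.arr srcₐ) (s.var arcsᵥ + 1) (s.var x) ∧
    ((push x y).exec s).arr dstₐ =
      Function.update (s.arr dstₐ) (s.var arcsᵥ + 1) (s.var y) ∧
    ((push x y).exec s).arr nextₐ =
      Function.update (s.arr nextₐ) (s.var arcsᵥ + 1) (s.arr curₐ (s.var x)) ∧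
    ((push x y).exec s).arr curₐ =
      Function.update (s.arr curₐ) (s.var x) (s.var arcsᵥ + 1) := by
  simp [push, Cmd.exec, hx, hx', hy]

theorem Linked.push {x y : ℕ} (h : Linked n s) (hx : x ≠ arcsᵥ) (hx' : x ≠ bᵥ) (hy : y ≠ arcsᵥ)
    (hxn : s.var x < n) (hyn : s.var y < n) : Linked n ((RAM.push x y).exec s) := by
  obtain ⟨h1, h2, h3, h4, h5⟩ := push_exec hx hx' hy s
  unfold Linked
  rw [h1, h2, h3, h4, h5]
  exact LinkedArcs.push h hxn hyn

theorem linkAll_achieves (h : HoldsInput e s) (hl : Linked n s) (h0 : s.var arcsᵥ = 0) {a b : ℕ}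
    (ha : a < srcₐ) (hb : b < srcₐ) (han : ∀ j < m, s.arr a j < n) (hbn : ∀ j < m, s.arr b j < n) :
    Achieves (linkAll a b) s (20 * (m + 1)) fun s' => s'.var arcsᵥ = m ∧ Linked n s' ∧
      ∀ j < m, s'.arr srcₐ (j + 1) = s.arr a j ∧ s'.arr dstₐ (j + 1) = s.arr b j := by
  refine (achieves_for (N := m) (j₀ := 0) (I := fun j s' => s'.var arcsᵥ = j ∧ Linked n s' ∧
    ∀ k < j, s'.arr srcₐ (k + 1) = s.arr a k ∧ s'.arr dstₐ (k + 1) = s.arr b k) rfl rfl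
      (by simp [Cmd.vars, RAM.push]) ?_ ?_ (Nat.zero_le _) ?_ ?_).mono ?_ ?_
  · simp [Cmd.exec, h.var_m]
  · simp [Cmd.exec]
  · refine ⟨by simp [Cmd.exec, h0], ?_, by simp⟩
    simpa [Linked, Cmd.exec] using hl
  · intro j s1 hf hj _ hjm ⟨h1, h2, h3⟩
    have hin := h.of_frame (by simp [Cmd.KeepsInput, Cmd.vars, Cmd.arrs, RAM.push]) hf
    have ea : s1.arr a = s.arr a := hf.arr _ (by simp [Cmd.arrs, RAM.push]; omega)
    have eb : s1.arr b = s.arr b := hf.arr _ (by simp [Cmd.arrs, RAM.push]; omega)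
    -- the memory after the two ends of the edge have been loaded
    obtain ⟨s2, hs2⟩ : ∃ s2, s2 = (Cmd.load yᵥ b iᵥ).exec ((Cmd.load xᵥ a iᵥ).exec s1) := ⟨_, rfl⟩
    have hx : s2.var xᵥ = s.arr a j := by simp [hs2, Cmd.exec, hj, ea]
    have hy : s2.var yᵥ = s.arr b j := by simp [hs2, Cmd.exec, hj, eb]
    have hi : s2.var iᵥ = j := by simp [hs2, Cmd.exec, hj]
    have hM : s2.var arcsᵥ = j := by simp [hs2, Cmd.exec, h1]
    have hl2 : Linked n s2 := by simpa [hs2, Linked, Cmd.exec] using h2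
    have hsd : s2.arr = s1.arr := by simp [hs2, Cmd.exec]
    have he : (Cmd.load xᵥ a iᵥ ;; .load yᵥ b iᵥ ;; push xᵥ yᵥ ;; .inc iᵥ).exec s1 =
        (Cmd.inc iᵥ).exec ((push xᵥ yᵥ).exec s2) := by rw [hs2]; rfl
    rw [he]
    have hf2 := exec_frame (c := push xᵥ yᵥ) rfl s2
    have hp := push_exec (x := xᵥ) (y := yᵥ) (by decide) (by decide) (by decide) s2
    have hl3 := hl2.push (x := xᵥ) (y := yᵥ) (by decide) (by decide) (by decide)
      (by rw [hx]; exact han j hjm) (by rw [hy]; exact hbn j hjm)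
    generalize (push xᵥ yᵥ).exec s2 = s3 at hf2 hp hl3
    obtain ⟨p1, p2, p3, p4, p5⟩ := hp
    have hi3 : s3.var iᵥ = j := (hf2.var _ (by decide)).trans hi
    refine ⟨by simp [Cmd.exec, hi3], by simp [Cmd.exec, p1, hM], ?_, ?_⟩
    · simpa [Linked, Cmd.exec] using hl3
    · intro k hk
      simp only [Cmd.exec, arr_setVar, p2, p3, hM, hx, hy, hsd]
      by_cases ek : k = j
      · subst ek; simp
      · rw [Function.update_of_ne (by omega), Function.update_of_ne (by omega)]
        exact h3 k (by omega)
  · simp [Cmd.cost, push]; omega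
  · rintro s' ⟨-, h1⟩
    exact h1

/-- The arcs in memory are the edges of `F`, in both directions. -/
def LinksBothWays (F : Set (Fin n × Fin n)) (s : Store) : Prop :=
  (∀ b, 1 ≤ b → b ≤ s.var arcsᵥ → ∃ u w, ((u, w) ∈ F ∨ (w, u) ∈ F) ∧
    s.arr srcₐ b = (u : ℕ) ∧ s.arr dstₐ b = (w : ℕ)) ∧
  ∀ u w, (u, w) ∈ F ∨ (w, u) ∈ F → ∃ b, 1 ≤ b ∧ b ≤ s.var arcsᵥ ∧
    s.arr srcₐ b = (u : ℕ) ∧ s.arr dstₐ b = (w : ℕ)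

theorem LinksBothWays.push {F : Set (Fin n × Fin n)} (h : LinksBothWays F s) {u w : Fin n}
    (hx : s.var xᵥ = u) (hy : s.var yᵥ = w) :
    LinksBothWays (insert (u, w) F) ((RAM.push yᵥ xᵥ).exec ((RAM.push xᵥ yᵥ).exec s)) := by
  obtain ⟨p1, p2, p3, -, -⟩ := push_exec (x := xᵥ) (y := yᵥ) (by decide) (by decide) (by decide) s
  have hf := exec_frame (c := RAM.push xᵥ yᵥ) rfl s
  generalize (RAM.push xᵥ yᵥ).exec s = s1 at *
  have hx1 : s1.var xᵥ = u := (hf.var _ (by decide)).trans hx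
  have hy1 : s1.var yᵥ = w := (hf.var _ (by decide)).trans hy
  obtain ⟨q1, q2, q3, -, -⟩ := push_exec (x := yᵥ) (y := xᵥ) (by decide) (by decide) (by decide) s1
  generalize (RAM.push yᵥ xᵥ).exec s1 = s2 at *
  rw [hx1, hy1, p1] at *
  rw [hx, hy] at *
  constructor
  · intro b h1 h2
    rw [q2, q3, p2, p3]
    rw [q1] at h2
    rcases Nat.lt_trichotomy b (s.var arcsᵥ + 1) with hb | rfl | hb
    · obtain ⟨u', w', h3, h4, h5⟩ := h.1 b h1 (by omega)
      refine ⟨u', w', h3.imp (Or.inr) (Or.inr), ?_⟩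
      rw [Function.update_of_ne (by omega), Function.update_of_ne (by omega),
        Function.update_of_ne (by omega), Function.update_of_ne (by omega)]
      exact ⟨h4, h5⟩
    · exact ⟨u, w, Or.inl (Or.inl rfl), by simp, by simp⟩
    · obtain rfl : b = s.var arcsᵥ + 1 + 1 := by omega
      exact ⟨w, u, Or.inr (Or.inl rfl), by simp, by simp⟩
  · intro u' w' huw
    rw [q1, q2, q3, p2, p3]
    have h4 : ((u' = u ∧ w' = w) ∨ (u' = w ∧ w' = u)) ∨ ((u', w') ∈ F ∨ (w', u') ∈ F) := by
      rcases huw with h3 | h3 <;> rw [Set.mem_insert_iff, Prod.mk.injEq] at h3 <;> tauto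
    rcases h4 with (⟨rfl, rfl⟩ | ⟨rfl, rfl⟩) | h4
    · exact ⟨s.var arcsᵥ + 1, by omega, by omega, by simp, by simp⟩
    · exact ⟨s.var arcsᵥ + 1 + 1, by omega, by omega, by simp, by simp⟩
    · obtain ⟨b, h5, h6, h7⟩ := h.2 u' w' h4
      refine ⟨b, h5, by omega, ?_⟩
      rw [Function.update_of_ne (by omega), Function.update_of_ne (by omega),
        Function.update_of_ne (by omega), Function.update_of_ne (by omega)]
      exact h7

theorem linkChosen_achieves (h : HoldsInput e s) (hl : Linked n s) (h0 : s.var arcsᵥ = 0)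
    {F : Set (Fin n × Fin n)} (hF : HoldsEdges e edgesₐ F s) (hFe : F ⊆ Set.range e) :
    Achieves linkChosen s (40 * (m + 1)) fun s' => s'.var arcsᵥ ≤ 2 * m ∧ Linked n s' ∧
      LinksBothWays F s' := by
  refine (achieves_for (N := m) (j₀ := 0) (I := fun j s' => s'.var arcsᵥ ≤ 2 * j ∧ Linked n s' ∧
    LinksBothWays {q | q ∈ F ∧ ∃ k : Fin m, (k : ℕ) < j ∧ e k = q} s') rfl rfl
      (by decide) ?_ ?_ (Nat.zero_le _) ?_ ?_).mono ?_ ?_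
  · simp [Cmd.exec, h.var_m]
  · simp [Cmd.exec]
  · refine ⟨by simp [Cmd.exec, h0], ?_, ?_, ?_⟩
    · simpa [Linked, Cmd.exec] using hl
    · simp [Cmd.exec, h0]
      omega
    · simp
  · intro j s1 hf hj _ hjm ⟨h1, h2, h3⟩
    have hin := h.of_frame (by decide) hf
    have hE : s1.arr edgesₐ = s.arr edgesₐ := hf.arr _ (by decide)
    have hnew : ∀ q : Fin n × Fin n, (∃ k : Fin m, (k : ℕ) < j + 1 ∧ e k = q) ↔
        (e ⟨j, hjm⟩ = q ∨ ∃ k : Fin m, (k : ℕ) < j ∧ e k = q) := by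
      intro q
      constructor
      · rintro ⟨k, hk, rfl⟩
        by_cases ek : (k : ℕ) = j
        · exact Or.inl (by congr 1; exact Fin.ext ek.symm)
        · exact Or.inr ⟨k, by omega, rfl⟩
      · rintro (rfl | ⟨k, hk, rfl⟩)
        · exact ⟨⟨j, hjm⟩, by simp, rfl⟩
        · exact ⟨k, by omega, rfl⟩
    have hjF := hF ⟨j, hjm⟩
    simp only at hjF
    by_cases hc : s.arr edgesₐ j = 0
    · have hset : {q | q ∈ F ∧ ∃ k : Fin m, (k : ℕ) < j + 1 ∧ e k = q} =
          {q | q ∈ F ∧ ∃ k : Fin m, (k : ℕ) < j ∧ e k = q} := by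
        ext q
        simp only [Set.mem_ofPred_eq, hnew]
        constructor
        · rintro ⟨hq, rfl | hq'⟩
          · exact absurd hc (hjF.2 hq)
          · exact ⟨hq, hq'⟩
        · exact fun hq => ⟨hq.1, Or.inr hq.2⟩
      rw [hset]
      simp only [Cmd.exec, Test.holds, var_setVar_self, hj, hE, hc, hin.var_zero, ne_eq,
        Nat.reduceEqDiff, not_false_eq_true, var_setVar_of_ne, not_true_eq_false, decide_false,
        Bool.false_eq_true, if_false, true_and]
      refine ⟨by omega, ?_, ?_⟩
      · simpa [Linked] using h2
      · simpa [LinksBothWays] using h3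
    · obtain ⟨⟨u, w⟩, huw⟩ : ∃ q, e ⟨j, hjm⟩ = q := ⟨_, rfl⟩
      have hset : {q | q ∈ F ∧ ∃ k : Fin m, (k : ℕ) < j + 1 ∧ e k = q} =
          insert (u, w) {q | q ∈ F ∧ ∃ k : Fin m, (k : ℕ) < j ∧ e k = q} := by
        ext q
        simp only [Set.mem_ofPred_eq, hnew, Set.mem_insert_iff, huw]
        constructor
        · rintro ⟨hq, rfl | hq'⟩
          · exact Or.inl rfl
          · exact Or.inr ⟨hq, hq'⟩
        · rintro (rfl | hq)
          · exact ⟨huw ▸ hjF.1 hc, Or.inl rfl⟩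
          · exact ⟨hq.1, Or.inr hq.2⟩
      rw [hset]
      obtain ⟨s2, hs2⟩ : ∃ s2, s2 = (Cmd.load yᵥ headₐ iᵥ).exec ((Cmd.load xᵥ tailₐ iᵥ).exec
        ((Cmd.load pᵥ edgesₐ iᵥ).exec s1)) := ⟨_, rfl⟩
      have hx : s2.var xᵥ = u := by
        have := hin.tail ⟨j, hjm⟩
        rw [huw] at this
        simpa [hs2, Cmd.exec, hj] using this
      have hy : s2.var yᵥ = w := by
        have := hin.head ⟨j, hjm⟩
        rw [huw] at this
        simpa [hs2, Cmd.exec, hj] using this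
      have hi : s2.var iᵥ = j := by simp [hs2, Cmd.exec, hj]
      have hM : s2.var arcsᵥ = s1.var arcsᵥ := by simp [hs2, Cmd.exec]
      have hl2 : Linked n s2 := by simpa [hs2, Linked, Cmd.exec] using h2
      have hb2 : LinksBothWays {q | q ∈ F ∧ ∃ k : Fin m, (k : ℕ) < j ∧ e k = q} s2 := by
        simpa [hs2, LinksBothWays, Cmd.exec] using h3
      have he : (Cmd.seq (.load pᵥ edgesₐ iᵥ) (.seq (.ite (.ne pᵥ zeroᵥ)
          (.load xᵥ tailₐ iᵥ ;; .load yᵥ headₐ iᵥ ;; push xᵥ yᵥ ;; push yᵥ xᵥ) .skip)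
            (.inc iᵥ))).exec s1 =
          (Cmd.inc iᵥ).exec ((push yᵥ xᵥ).exec ((push xᵥ yᵥ).exec s2)) := by
        rw [hs2]
        simp only [Cmd.exec, Test.holds, var_setVar_self, hj, hE, hin.var_zero, ne_eq,
          Nat.reduceEqDiff, not_false_eq_true, var_setVar_of_ne, hc, decide_true, if_true]
      rw [he]
      have hb3 := hb2.push hx hy
      have hl3 := hl2.push (x := xᵥ) (y := yᵥ) (by decide) (by decide) (by decide)
        (by rw [hx]; exact u.2) (by rw [hy]; exact w.2)
      have hp := (push_exec (x := xᵥ) (y := yᵥ) (by decide) (by decide) (by decide) s2).1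
      have hf2 := exec_frame (c := push xᵥ yᵥ) rfl s2
      generalize (push xᵥ yᵥ).exec s2 = s3 at hb3 hl3 hp hf2
      have hx3 : s3.var xᵥ = u := (hf2.var _ (by decide)).trans hx
      have hy3 : s3.var yᵥ = w := (hf2.var _ (by decide)).trans hy
      have hl4 := hl3.push (x := yᵥ) (y := xᵥ) (by decide) (by decide) (by decide)
        (by rw [hy3]; exact w.2) (by rw [hx3]; exact u.2)
      have hp' := (push_exec (x := yᵥ) (y := xᵥ) (by decide) (by decide) (by decide) s3).1
      have hf3 := exec_frame (c := push yᵥ xᵥ) rfl s3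
      generalize (push yᵥ xᵥ).exec s3 = s4 at hb3 hl4 hp' hf3
      have hi4 : s4.var iᵥ = j := (hf3.var _ (by decide)).trans ((hf2.var _ (by decide)).trans hi)
      refine ⟨by simp [Cmd.exec, hi4], ?_, ?_, ?_⟩
      · simp only [Cmd.exec, ne_eq, Nat.reduceEqDiff, not_false_eq_true, var_setVar_of_ne]
        omega
      · simpa [Linked, Cmd.exec] using hl4
      · simpa [LinksBothWays, Cmd.exec] using hb3
  · simp [Cmd.cost, push]; omega
  · rintro s' ⟨-, h1, h2, h3⟩
    refine ⟨h1, h2, ?_⟩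
    convert h3 using 1
    ext q
    constructor
    · intro hq
      obtain ⟨k, rfl⟩ := hFe hq
      exact ⟨hq, k, k.2, rfl⟩
    · exact fun hq => hq.1

end Links

section SearchProgram

variable {n m : ℕ} {e : Fin m → Fin n × Fin n} {s s' : Store}

/-- The state of the search that is held in memory. -/
def Searching (n : ℕ) (s : Store) (D : Finset ℕ) : Prop :=
  SearchState n (s.var arcsᵥ) (s.arr srcₐ) (s.arr dstₐ) (s.arr curₐ) (s.arr parₐ)
    (s.arr parArcₐ) (s.arr preₐ) (s.arr ordₐ) (s.var xᵥ) (s.var cntᵥ) D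

theorem searchStep_exec (h : Searching n s D) {cur₀ : ℕ → ℕ} (hz : s.var zeroᵥ = 0)
    (hl : LinkedArcs n (s.var arcsᵥ) (s.arr srcₐ) (s.arr dstₐ) (s.arr nextₐ) cur₀)
    (hx : s.var xᵥ < n) :
    ∃ D', Searching n (searchStep.exec s) D' ∧
      unscanned (s.var arcsᵥ) (s.arr srcₐ) ((searchStep.exec s).arr curₐ) + (n - D'.card) <
        unscanned (s.var arcsᵥ) (s.arr srcₐ) (s.arr curₐ) + (n - D.card) := by
  unfold Searching at h
  by_cases hc : s.arr curₐ (s.var xᵥ) = 0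
  · refine ⟨insert (s.var xᵥ) D, ?_, ?_⟩
    · simpa [Searching, searchStep, Cmd.exec, Test.holds, hz, hc] using h.finish hx hc
    · have h1 : insert (s.var xᵥ) D ⊆ Finset.range n := by
        intro y hy
        rcases Finset.mem_insert.1 hy with rfl | hy
        · exact Finset.mem_range.2 hx
        · exact Finset.mem_range.2 (h.done y hy).1
      have h2 := Finset.card_le_card h1
      rw [Finset.card_insert_of_notMem (h.x_open hx).2, Finset.card_range] at h2
      rw [Finset.card_insert_of_notMem (h.x_open hx).2]
      simp [searchStep, Cmd.exec, Test.holds, hz, hc]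
      omega
  · obtain ⟨-, -, hlt⟩ := h.scan_aux hl hx hc
    refine ⟨D, ?_, ?_⟩
    · by_cases hd : s.arr preₐ (s.arr dstₐ (s.arr curₐ (s.var xᵥ))) = 0
      · simpa [Searching, searchStep, Cmd.exec, Test.holds, hz, hc, hd] using
          h.visit hl hx hc rfl hd
      · simpa [Searching, searchStep, Cmd.exec, Test.holds, hz, hc, hd] using h.skip hl hx hc hd
    · refine Nat.add_lt_add_right (lt_of_eq_of_lt ?_ hlt) _
      by_cases hd : s.arr preₐ (s.arr dstₐ (s.arr curₐ (s.var xᵥ))) = 0 <;>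
        simp [searchStep, Cmd.exec, Test.holds, hz, hc, hd]

theorem search_achieves (hn : 0 < n) (h : HoldsInput e s) (hl : Linked n s)
    (hpre : ∀ y < n, s.arr preₐ y = 0) :
    Achieves search s (40 * (n + s.var arcsᵥ + 1)) fun s' =>
      s'.var xᵥ = n ∧ ∃ D, Searching n s' D := by
  obtain ⟨s0, hs0⟩ : ∃ s0, s0 = (Cmd.store preₐ rootᵥ oneᵥ ;; .const cntᵥ 1 ;;
    .store ordₐ cntᵥ rootᵥ ;; .store parₐ rootᵥ nᵥ ;; .copy xᵥ rootᵥ).exec s := ⟨_, rfl⟩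
  have hinit : Searching n s0 ∅ := by
    have := SearchState.init hn hl hpre (s.arr parₐ) (s.arr parArcₐ) (s.arr ordₐ)
    simpa [hs0, Searching, Cmd.exec, h.var_root, h.var_one, h.var_n] using this
  have hf0 : Frame (Cmd.store preₐ rootᵥ oneᵥ ;; .const cntᵥ 1 ;;
    .store ordₐ cntᵥ rootᵥ ;; .store parₐ rootᵥ nᵥ ;; .copy xᵥ rootᵥ) s s0 :=
    hs0 ▸ exec_frame rfl s
  have hin0 := h.of_frame (by decide) hf0
  have hl0 : Linked n s0 := by simpa [hs0, Linked, Cmd.exec] using hl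
  have hM : s0.var arcsᵥ = s.var arcsᵥ := hf0.var _ (by decide)
  refine ((achieves_exec rfl s).seq (T' := 25 * (n + s.var arcsᵥ) + 1) ?_).mono ?_ (fun _ => id)
  swap
  · simp [Cmd.cost]
    omega
  rintro _ rfl
  rw [← hs0]
  refine (achieves_while (b := .lt xᵥ nᵥ) (c := searchStep) rfl (N := s.var arcsᵥ + n)
    (I := fun k s' =>
    ∃ D, Searching n s' D ∧
      unscanned (s.var arcsᵥ) (s0.arr srcₐ) (s'.arr curₐ) + (n - D.card) ≤ k)
    ⟨∅, hinit, ?_⟩ ?_).mono ?_ ?_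
  · have h1 := Finset.card_filter_le (Finset.Icc 1 (s.var arcsᵥ))
      (fun b => b ≤ s0.arr curₐ (s0.arr srcₐ b))
    rw [Nat.card_Icc] at h1
    simp only [unscanned, Finset.card_empty]
    omega
  · rintro k s1 hf ⟨D, hD, hk⟩ hb
    have hin := hin0.of_frame (by decide) hf
    have e1 : s1.var arcsᵥ = s0.var arcsᵥ := hf.var _ (by decide)
    have e2 : s1.arr srcₐ = s0.arr srcₐ := hf.arr _ (by decide)
    have e3 : s1.arr dstₐ = s0.arr dstₐ := hf.arr _ (by decide)
    have e4 : s1.arr nextₐ = s0.arr nextₐ := hf.arr _ (by decide)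
    have hx : s1.var xᵥ < n := by simpa [Test.holds, hin.var_n] using hb
    obtain ⟨D', h1, h2⟩ := searchStep_exec hD hin.var_zero (cur₀ := s0.arr curₐ)
      (by rw [e1, e2, e3, e4]; exact hl0) hx
    rw [e1, e2, hM] at h2
    exact ⟨_, lt_of_lt_of_le h2 hk, D', h1, le_rfl⟩
  · simp [Cmd.cost, searchStep]
    omega
  · rintro s' ⟨hf, hb, k, D, hD, -⟩
    have hin := hin0.of_frame (by decide) hf
    have hx : n ≤ s'.var xᵥ := by simpa [Test.holds, hin.var_n] using hb
    exact ⟨le_antisymm hD.x_le hx, D, hD⟩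

end SearchProgram

/-! ### The spanning trees -/

section Finished

variable {n M : ℕ} {src dst cur par parc pre ord : ℕ → ℕ} {cnt : ℕ} {D : Finset ℕ}

theorem SearchState.mem_done (h : SearchState n M src dst cur par parc pre ord n cnt D) {y : ℕ}
    (hy : y < n) (hv : pre y ≠ 0) : y ∈ D := by
  by_contra hD
  exact absurd (h.ancestor y hy hv hD).1 (lt_irrefl n)

theorem SearchState.visited_dst (h : SearchState n M src dst cur par parc pre ord n cnt D) {b : ℕ}
    (h1 : 1 ≤ b) (h2 : b ≤ M) (hb : src b < n) (hv : pre (src b) ≠ 0) : pre (dst b) ≠ 0 := by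
  refine h.scanned b h1 h2 ?_
  rw [(h.done _ (h.mem_done hb hv)).2.2]
  omega

/-- When the search has ended, every vertex that can be reached from the root has been visited. -/
theorem SearchState.visited_of_reach (h : SearchState n M src dst cur par parc pre ord n cnt D)
    {r : Fin n → Fin n → Prop} {v : Fin n} (hv : (v : ℕ) = 0)
    (hr : ∀ u w, r u w → ∃ b, 1 ≤ b ∧ b ≤ M ∧ src b = (u : ℕ) ∧ dst b = (w : ℕ)) {w : Fin n}
    (hw : Relation.ReflTransGen r v w) : pre w ≠ 0 := by
  induction hw with
  | refl => rw [hv, h.root.1]; exact one_ne_zero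
  | @tail u w _ huw ih =>
    obtain ⟨b, h1, h2, h3, h4⟩ := hr u w huw
    rw [← h4]
    exact h.visited_dst h1 h2 (h3 ▸ u.2) (h3 ▸ ih)

/-- The edges by which the search has entered the vertices form a spanning tree. -/
theorem SearchState.isRootedSpanningTree {m : ℕ} {e : Fin m → Fin n × Fin n}
    (h : SearchState n m src dst cur par parc pre ord n cnt D) {v : Fin n} (hv : (v : ℕ) = 0)
    (he : ∀ j : Fin m, src (j + 1) = (e j).1 ∧ dst (j + 1) = (e j).2)
    (hvis : ∀ y < n, pre y ≠ 0) :
    IsRootedSpanningTree (Set.range e) v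
      {q | ∃ j : Fin m, e j = q ∧ ∃ x, x ≠ 0 ∧ x < n ∧ parc x = j + 1} := by
  have hpar : ∀ w : Fin n, w ≠ v → ∃ j : Fin m, parc w = j + 1 ∧ (e j).2 = w ∧
      ((e j).1 : ℕ) = par w := by
    intro w hw
    have hw0 : (w : ℕ) ≠ 0 := fun hc => hw (Fin.ext (hc.trans hv.symm))
    obtain ⟨-, -, -, h1, h2, h3, h4, -⟩ := h.parent w w.2 (hvis w w.2) hw0
    refine ⟨⟨parc w - 1, by omega⟩, by simp; omega, ?_, ?_⟩
    · have := (he ⟨parc w - 1, by omega⟩).2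
      simp only [Nat.sub_add_cancel h1] at this
      exact Fin.ext (this.symm.trans h4)
    · have := (he ⟨parc w - 1, by omega⟩).1
      simp only [Nat.sub_add_cancel h1] at this
      exact this.symm.trans h3
  have hdst : ∀ (j : Fin m) x, x ≠ 0 → x < n → parc x = j + 1 → ((e j).2 : ℕ) = x := by
    intro j x hx0 hx hj
    rw [← (he j).2, ← hj]
    exact (h.parent x hx (hvis x hx) hx0).2.2.2.2.2.2.1
  have hmem : ∀ (w : Fin n) (j : Fin m), w ≠ v → parc w = j + 1 →
      e j ∈ {q | ∃ j : Fin m, e j = q ∧ ∃ x, x ≠ 0 ∧ x < n ∧ parc x = j + 1} := fun w j hw hj =>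
    ⟨j, rfl, w, fun hc => hw (Fin.ext (hc.trans hv.symm)), w.2, hj⟩
  constructor
  · rintro q ⟨j, rfl, -⟩
    exact ⟨j, rfl⟩
  · rintro u ⟨j, hj, x, hx0, hx, hp⟩
    have := hdst j x hx0 hx hp
    rw [hj] at this
    exact hx0 (this.symm.trans hv)
  · intro w hw
    obtain ⟨j, h1, h2, h3⟩ := hpar w hw
    refine ⟨(e j).1, ?_, ?_⟩
    · have := hmem w j hw h1
      rwa [← h2]
    · rintro u ⟨j', hj', x, hx0, hx, hp⟩
      have h4 := hdst j' x hx0 hx hp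
      rw [hj'] at h4
      have h5 : (w : ℕ) = x := h4
      rw [← h5, h1] at hp
      obtain rfl : j = j' := Fin.ext (by omega)
      rw [hj']
  · intro w
    induction hk : pre w using Nat.strong_induction_on generalizing w with
    | _ k ih =>
      by_cases hw : w = v
      · exact hw ▸ .refl
      · obtain ⟨j, h1, h2, h3⟩ := hpar w hw
        have hw0 : (w : ℕ) ≠ 0 := fun hc => hw (Fin.ext (hc.trans hv.symm))
        have h4 := (h.parent w w.2 (hvis w w.2) hw0).2.2.1
        rw [← h3] at h4
        refine (ih _ (hk ▸ h4) (e j).1 rfl).tail ?_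
        have := hmem w j hw h1
        rwa [← h2]

end Finished

section Trees

variable {n m : ℕ} {e : Fin m → Fin n × Fin n} {s s' : Store}

theorem markTree_achieves (h : HoldsInput e s) {c : ℕ} (hc : c = treeₐ ∨ c = revTreeₐ)
    (hp : ∀ x, x ≠ 0 → x < n → 1 ≤ s.arr parArcₐ x) :
    Achieves (markTree c) s (20 * (n + 1)) fun s' => ∀ j,
      (s'.arr c j ≠ 0 ↔ s.arr c j ≠ 0 ∨ ∃ x, x ≠ 0 ∧ x < n ∧ s.arr parArcₐ x = j + 1) ∧
      (s'.arr edgesₐ j ≠ 0 ↔ s.arr edgesₐ j ≠ 0 ∨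
        ∃ x, x ≠ 0 ∧ x < n ∧ s.arr parArcₐ x = j + 1) := by
  have hc4 : c ≠ edgesₐ := by omega
  have hc4' : edgesₐ ≠ c := hc4.symm
  refine (achieves_for (N := n) (j₀ := 0) (I := fun k s' => ∀ j,
      (s'.arr c j ≠ 0 ↔ s.arr c j ≠ 0 ∨ ∃ x, x ≠ 0 ∧ x < k ∧ s.arr parArcₐ x = j + 1) ∧
      (s'.arr edgesₐ j ≠ 0 ↔ s.arr edgesₐ j ≠ 0 ∨
        ∃ x, x ≠ 0 ∧ x < k ∧ s.arr parArcₐ x = j + 1)) rfl rfl (by simp [Cmd.vars])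
      ?_ ?_ (Nat.zero_le _) ?_ ?_).mono ?_ ?_
  · simp [Cmd.exec, h.var_n]
  · simp [Cmd.exec]
  · simp [Cmd.exec]
  · intro k s1 hf hk _ hkn hI
    have hin := h.of_frame (by rcases hc with rfl | rfl <;> decide) hf
    have ep : s1.arr parArcₐ = s.arr parArcₐ := hf.arr _ (by rcases hc with rfl | rfl <;> decide)
    by_cases hk0 : k = 0
    · subst hk0
      simp only [Cmd.exec, Test.holds, hk, hin.var_root, ne_eq, not_true_eq_false, decide_false,
        Bool.false_eq_true, if_false, var_setVar_self, arr_setVar, true_and]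
      intro j
      have hex : ∀ k', k' ≤ 1 → ¬ ∃ x, x ≠ 0 ∧ x < k' ∧ s.arr parArcₐ x = j + 1 := by
        rintro k' hk' ⟨x, hx, hx', -⟩
        omega
      have := hI j
      simp only [hex 0 (by omega), hex 1 le_rfl, or_false] at this ⊢
      exact this
    · have hpk := hp k hk0 hkn
      simp only [Cmd.exec, Test.holds, hk, hin.var_root, hin.var_one, ne_eq, hk0,
        not_false_eq_true, decide_true, if_true, var_setVar_self, arr_setVar, var_setVar_of_ne,
        Nat.reduceEqDiff, var_setArr, arr_setArr_self, hc4, hc4', arr_setArr_of_ne, ep, true_and]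
      intro j
      have hex : (∃ x, x ≠ 0 ∧ x < k + 1 ∧ s.arr parArcₐ x = j + 1) ↔
          (j = s.arr parArcₐ k - 1 ∨ ∃ x, x ≠ 0 ∧ x < k ∧ s.arr parArcₐ x = j + 1) := by
        constructor
        · rintro ⟨x, h1, h2, h3⟩
          by_cases hx : x = k
          · subst hx
            exact Or.inl (by omega)
          · exact Or.inr ⟨x, h1, by omega, h3⟩
        · rintro (h1 | ⟨x, h1, h2, h3⟩)
          · exact ⟨k, hk0, by omega, by omega⟩
          · exact ⟨x, h1, by omega, h3⟩
      have := hI j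
      simp only [← ne_eq] at this ⊢
      rw [hex]
      by_cases hj : j = s.arr parArcₐ k - 1
      · simp [← hj]
      · rw [Function.update_of_ne hj, Function.update_of_ne hj]
        simp only [hj, false_or]
        exact this
  · simp [Cmd.cost]; omega
  · rintro s' ⟨-, hI⟩
    exact hI

/-- The edges in the arrays `a` and `b` are given by `e'`; this is `e` or the list of the reversed
edges. -/
theorem spanningTree_achieves (h : HoldsInput e s) {v : Fin n} (hv : (v : ℕ) = 0) {a b c : ℕ}
    (ha : a = tailₐ ∨ a = headₐ) (hb : b = tailₐ ∨ b = headₐ) (hc : c = treeₐ ∨ c = revTreeₐ)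
    {e' : Fin m → Fin n × Fin n} (he' : Function.Injective e')
    (hea : ∀ j : Fin m, s.arr a j = (e' j).1) (heb : ∀ j : Fin m, s.arr b j = (e' j).2)
    (hreach : ∀ w, (digraphOf (Set.range e')).HasPath v w) (hc0 : ∀ j : Fin m, s.arr c j = 0) :
    Achieves (spanningTree a b c) s (100 * (n + m + 1)) fun s' => ∃ T,
      IsRootedSpanningTree (Set.range e') v T ∧ (∀ j : Fin m, s'.arr c j ≠ 0 ↔ e' j ∈ T) ∧
      ∀ j : Fin m, s'.arr edgesₐ j ≠ 0 ↔ s.arr edgesₐ j ≠ 0 ∨ e' j ∈ T := by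
  have hn : 0 < n := Nat.lt_of_le_of_lt (Nat.zero_le _) v.2
  refine ((clear_achieves h).frame.seq (T' := 20 * (m + 1) + 40 * (n + m + 1) + 20 * (n + 1) + 2)
    ?_).mono (by omega) (fun _ => id)
  rintro s1 ⟨⟨hM1, hl1, hpre1⟩, hf1⟩
  have hin1 := h.of_frame (by decide) hf1
  have ea1 : s1.arr a = s.arr a := hf1.arr _ (by rcases ha with rfl | rfl <;> decide)
  have eb1 : s1.arr b = s.arr b := hf1.arr _ (by rcases hb with rfl | rfl <;> decide)
  have hlink := linkAll_achieves hin1 hl1 hM1 (a := a) (b := b) (by omega) (by omega)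
    (fun j hj => by
      have := hea ⟨j, hj⟩
      simp only at this
      rw [ea1, this]
      exact (e' ⟨j, hj⟩).1.2)
    (fun j hj => by
      have := heb ⟨j, hj⟩
      simp only at this
      rw [eb1, this]
      exact (e' ⟨j, hj⟩).2.2)
  refine (hlink.frame.seq (T' := 40 * (n + m + 1) + 20 * (n + 1) + 1) ?_).mono (by omega)
    (fun _ => id)
  rintro s2 ⟨⟨hM2, hl2, harc⟩, hf2⟩
  have hin2 := hin1.of_frame (by simp [Cmd.KeepsInput, Cmd.vars, Cmd.arrs, RAM.push, linkAll]) hf2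
  have epre : s2.arr preₐ = s1.arr preₐ := hf2.arr _ (by simp [Cmd.arrs, RAM.push, linkAll])
  refine ((search_achieves hn hin2 hl2 (by rw [epre]; exact hpre1)).frame.seq
    (T' := 20 * (n + 1)) ?_).mono (by rw [hM2]; omega) (fun _ => id)
  rintro s3 ⟨⟨hx3, D, hD⟩, hf3⟩
  have hin3 := hin2.of_frame (by decide) hf3
  have eM : s3.var arcsᵥ = m := (hf3.var _ (by decide)).trans hM2
  have esrc : s3.arr srcₐ = s2.arr srcₐ := hf3.arr _ (by decide)
  have edst : s3.arr dstₐ = s2.arr dstₐ := hf3.arr _ (by decide)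
  unfold Searching at hD
  rw [hx3, eM] at hD
  have harc' : ∀ j : Fin m, s3.arr srcₐ (j + 1) = (e' j).1 ∧ s3.arr dstₐ (j + 1) = (e' j).2 := by
    intro j
    rw [esrc, edst, (harc j j.2).1, (harc j j.2).2, ea1, eb1]
    exact ⟨hea j, heb j⟩
  have hvis : ∀ y < n, s3.arr preₐ y ≠ 0 := by
    intro y hy
    refine hD.visited_of_reach hv (r := (digraphOf (Set.range e')).Adj) ?_ (hreach ⟨y, hy⟩)
    rintro u w ⟨j, hj⟩
    refine ⟨j + 1, by omega, by omega, ?_⟩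
    rw [(harc' j).1, (harc' j).2, hj]
    exact ⟨rfl, rfl⟩
  have htree := hD.isRootedSpanningTree hv harc' hvis
  refine (markTree_achieves hin3 hc fun x hx0 hx => (hD.parent x hx (hvis x hx) hx0).2.2.2.1).mono
    le_rfl ?_
  intro s4 h4
  have ec : s3.arr c = s.arr c := by
    rw [hf3.arr _ (by rcases hc with rfl | rfl <;> decide),
      hf2.arr _ (by rcases hc with rfl | rfl <;> simp [Cmd.arrs, RAM.push, linkAll]),
      hf1.arr _ (by rcases hc with rfl | rfl <;> decide)]
  have eE : s3.arr edgesₐ = s.arr edgesₐ := by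
    rw [hf3.arr _ (by decide), hf2.arr _ (by simp [Cmd.arrs, RAM.push, linkAll]),
      hf1.arr _ (by decide)]
  have hmem : ∀ j : Fin m, (∃ x, x ≠ 0 ∧ x < n ∧ s3.arr parArcₐ x = (j : ℕ) + 1) ↔
      e' j ∈ {q | ∃ j : Fin m, e' j = q ∧ ∃ x, x ≠ 0 ∧ x < n ∧ s3.arr parArcₐ x = j + 1} := by
    intro j
    constructor
    · exact fun hx => ⟨j, rfl, hx⟩
    · rintro ⟨j', hj', hx⟩
      obtain rfl := he' hj'
      exact hx
  refine ⟨_, htree, fun j => ?_, fun j => ?_⟩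
  · rw [(h4 j).1, ec, hc0 j, ← hmem j]
    simp
  · rw [(h4 j).2, eE, ← hmem j]

end Trees

/-! ### The low numbers and the labels -/

section Numbers

open Function

variable {n M : ℕ} {src dst cur par parc pre ord low lab : ℕ → ℕ} {x cnt : ℕ} {D : Finset ℕ}

theorem SearchState.cnt_le (h : SearchState n M src dst cur par parc pre ord x cnt D) :
    cnt ≤ n := by
  have h1 := Finset.card_le_card_of_injOn (s := Finset.Icc 1 cnt) (t := Finset.range n) ord
    (fun i hi => by
      rw [Finset.coe_Icc, Set.mem_Icc] at hi
      simpa using (h.order_inv i hi.1 hi.2).1)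
    (fun i hi j hj hij => by
      rw [Finset.coe_Icc, Set.mem_Icc] at hi hj
      rw [← (h.order_inv i hi.1 hi.2).2, hij, (h.order_inv j hj.1 hj.2).2])
  simpa using h1

/-- The values `low` of the vertices when the arcs and the vertices with numbers above `i` have been
taken into account: `low y` is the number of a vertex in the subtree of `y` or adjacent to it. -/
structure LowState (n M : ℕ) (src dst par pre low : ℕ → ℕ) (i : ℕ) : Prop where
  low_le : ∀ b, 1 ≤ b → b ≤ M → low (src b) ≤ pre (dst b)
  low_parent_le : ∀ y < n, y ≠ 0 → i < pre y → low (par y) ≤ low y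
  low_attained : ∀ y < n, ∃ z < n, SearchAncestor par pre y z ∧
    (low y = pre z ∨ ∃ b, 1 ≤ b ∧ b ≤ M ∧ src b = z ∧ low y = pre (dst b))

theorem LowState.step (h : LowState n M src dst par pre low (x + 1))
    (hs : SearchState n M src dst cur par parc pre ord n cnt D) (hvis : ∀ y < n, pre y ≠ 0)
    (hx : 1 ≤ x) (hxc : x + 1 ≤ cnt) :
    LowState n M src dst par pre (if low (ord (x + 1)) < low (par (ord (x + 1))) then
      update low (par (ord (x + 1))) (low (ord (x + 1))) else low) x := by
  obtain ⟨h1, h2⟩ := hs.order_inv (x + 1) (by omega) hxc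
  generalize ord (x + 1) = z at h1 h2 ⊢
  have hz0 : z ≠ 0 := by
    rintro rfl
    have := hs.root.1
    omega
  obtain ⟨h3, h4, h5, -⟩ := hs.parent z h1 (hvis z h1) hz0
  have huniq : ∀ y < n, pre y = x + 1 → y = z := by
    intro y hy hyx
    rw [← (hs.order y hy (hvis y hy)).2, hyx, ← h2, (hs.order z h1 (hvis z h1)).2]
  set low' := if low z < low (par z) then update low (par z) (low z) else low with hlow'
  have hle : ∀ y, low' y ≤ low y := by
    intro y
    rw [hlow']
    split_ifs with hc
    · by_cases e : y = par z
      · rw [e, update_self]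
        exact hc.le
      · rw [update_of_ne e]
    · exact le_rfl
  have hne : ∀ y, y ≠ par z → low' y = low y := by
    intro y hy
    rw [hlow']
    split_ifs
    · rw [update_of_ne hy]
    · rfl
  constructor
  · exact fun b hb hb' => (hle _).trans (h.low_le b hb hb')
  · intro y hy hy0 hyx
    by_cases e : y = z
    · subst e
      rw [hne y (fun e => by rw [← e] at h5; omega), hlow']
      split_ifs with hc
      · simp
      · omega
    · have h6 : x + 1 < pre y := by
        by_contra hc
        exact e (huniq y hy (by omega))
      rw [hne y (fun e => by rw [e] at h6; omega)]
      exact (hle _).trans (h.low_parent_le y hy hy0 h6)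
  · intro y hy
    rw [hlow']
    split_ifs with hc
    · by_cases e : y = par z
      · obtain ⟨w, hw, h6, h7⟩ := h.low_attained z h1
        rw [e, update_self]
        exact ⟨w, hw, Relation.ReflTransGen.head ⟨hz0, hvis z h1, rfl⟩ h6, h7⟩
      · rw [update_of_ne e]
        exact h.low_attained y hy
    · exact h.low_attained y hy

end Numbers

section LowPrograms

variable {n m : ℕ} {e : Fin m → Fin n × Fin n} {s s' : Store} {D : Finset ℕ}

/-- The memory holds a finished search. -/
def Searched (n : ℕ) (s : Store) (D : Finset ℕ) : Prop :=
  SearchState n (s.var arcsᵥ) (s.arr srcₐ) (s.arr dstₐ) (s.arr curₐ) (s.arr parₐ)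
    (s.arr parArcₐ) (s.arr preₐ) (s.arr ordₐ) n (s.var cntᵥ) D

theorem Searched.of_frame (h : Searched n s D) {c : Cmd}
    (hv : ∀ x ∈ [arcsᵥ, cntᵥ], x ∉ c.vars)
    (ha : ∀ a ∈ [srcₐ, dstₐ, curₐ, parₐ, parArcₐ, preₐ, ordₐ], a ∉ c.arrs) (hf : Frame c s s') :
    Searched n s' D := by
  unfold Searched
  rw [hf.var arcsᵥ (hv _ (by simp)), hf.var cntᵥ (hv _ (by simp)), hf.arr srcₐ (ha _ (by simp)),
    hf.arr dstₐ (ha _ (by simp)), hf.arr curₐ (ha _ (by simp)), hf.arr parₐ (ha _ (by simp)),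
    hf.arr parArcₐ (ha _ (by simp)), hf.arr preₐ (ha _ (by simp)), hf.arr ordₐ (ha _ (by simp))]
  exact h

theorem lowInit_achieves (h : HoldsInput e s) :
    Achieves lowInit s (10 * (n + 1)) fun s' => ∀ y < n, s'.arr lowₐ y = s.arr preₐ y := by
  refine (achieves_for (N := n) (j₀ := 0) (I := fun k s' => ∀ y < k,
    s'.arr lowₐ y = s.arr preₐ y) rfl rfl (by decide) ?_ ?_ (Nat.zero_le _) ?_ ?_).mono ?_ ?_
  · simp [Cmd.exec, h.var_n]
  · simp [Cmd.exec]
  · simp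
  · intro k s1 hf hk _ hkn hI
    have ep : s1.arr preₐ = s.arr preₐ := hf.arr _ (by decide)
    simp only [Cmd.exec, hk, ne_eq, not_false_eq_true, var_setVar_self, arr_setVar,
      var_setVar_of_ne, Nat.reduceEqDiff, var_setArr, arr_setArr_self, ep, true_and]
    intro y hy
    by_cases ey : y = k
    · subst ey; simp
    · rw [Function.update_of_ne ey]
      exact hI y (by omega)
  · simp [Cmd.cost]; omega
  · rintro s' ⟨-, hI⟩
    exact hI

theorem lowArcs_achieves (h0 : ∀ y < n, s.arr lowₐ y = s.arr preₐ y) :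
    Achieves lowArcs s (20 * (s.var arcsᵥ + 1)) fun s' =>
      (∀ b, 1 ≤ b → b ≤ s.var arcsᵥ → s'.arr lowₐ (s.arr srcₐ b) ≤ s.arr preₐ (s.arr dstₐ b)) ∧
      ∀ y < n, s'.arr lowₐ y = s.arr preₐ y ∨ ∃ b, 1 ≤ b ∧ b ≤ s.var arcsᵥ ∧
        s.arr srcₐ b = y ∧ s'.arr lowₐ y = s.arr preₐ (s.arr dstₐ b) := by
  refine (achieves_for (N := s.var arcsᵥ) (j₀ := 0) (I := fun k s' =>
      (∀ b, 1 ≤ b → b ≤ k → s'.arr lowₐ (s.arr srcₐ b) ≤ s.arr preₐ (s.arr dstₐ b)) ∧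
      ∀ y < n, s'.arr lowₐ y = s.arr preₐ y ∨ ∃ b, 1 ≤ b ∧ b ≤ s.var arcsᵥ ∧
        s.arr srcₐ b = y ∧ s'.arr lowₐ y = s.arr preₐ (s.arr dstₐ b)) rfl rfl (by decide)
      ?_ ?_ (Nat.zero_le _) ?_ ?_).mono ?_ ?_
  · simp [Cmd.exec]
  · simp [Cmd.exec]
  · refine ⟨fun b h1 h2 => by omega, fun y hy => Or.inl ?_⟩
    simpa [Cmd.exec] using h0 y hy
  · intro k s1 hf hk _ hkn ⟨h1, h2⟩
    have ep : s1.arr preₐ = s.arr preₐ := hf.arr _ (by decide)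
    have es : s1.arr srcₐ = s.arr srcₐ := hf.arr _ (by decide)
    have ed : s1.arr dstₐ = s.arr dstₐ := hf.arr _ (by decide)
    by_cases hc : s.arr preₐ (s.arr dstₐ (k + 1)) < s1.arr lowₐ (s.arr srcₐ (k + 1))
    · simp only [Cmd.exec, Test.holds, hk, ne_eq, not_false_eq_true, var_setVar_self, arr_setVar,
        var_setVar_of_ne, Nat.reduceEqDiff, var_setArr, arr_setArr_self, ep, es, ed, hc,
        decide_true, if_true, true_and]
      constructor
      · intro b hb hb'
        by_cases eb : s.arr srcₐ b = s.arr srcₐ (k + 1)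
        · rw [eb, Function.update_self]
          rcases Nat.le_succ_iff.1 hb' with h3 | rfl
          · have := h1 b hb h3
            rw [eb] at this
            omega
          · exact le_rfl
        · rw [Function.update_of_ne eb]
          refine h1 b hb ?_
          rcases Nat.le_succ_iff.1 hb' with h3 | rfl
          · exact h3
          · exact absurd rfl eb
      · intro y hy
        by_cases ey : y = s.arr srcₐ (k + 1)
        · rw [ey, Function.update_self]
          exact Or.inr ⟨k + 1, by omega, by omega, rfl, rfl⟩
        · rw [Function.update_of_ne ey]
          exact h2 y hy
    · simp only [Cmd.exec, Test.holds, hk, ne_eq, not_false_eq_true, var_setVar_self, arr_setVar,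
        var_setVar_of_ne, Nat.reduceEqDiff, ep, es, ed, hc, decide_false, Bool.false_eq_true,
        if_false, true_and]
      refine ⟨fun b hb hb' => ?_, h2⟩
      rcases Nat.le_succ_iff.1 hb' with h3 | rfl
      · exact h1 b hb h3
      · exact not_lt.1 hc
  · simp [Cmd.cost]; omega
  · rintro s' ⟨-, hI⟩
    exact hI

/-- The values `low` in memory are correct for the vertices with numbers above `i`. -/
def HasLow (n : ℕ) (s : Store) (i : ℕ) : Prop :=
  LowState n (s.var arcsᵥ) (s.arr srcₐ) (s.arr dstₐ) (s.arr parₐ) (s.arr preₐ) (s.arr lowₐ) i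

theorem lowTree_achieves (h : HoldsInput e s) (hs : Searched n s D)
    (hvis : ∀ y < n, s.arr preₐ y ≠ 0) (hn : 0 < n) (hlow : HasLow n s (s.var cntᵥ)) :
    Achieves lowTree s (20 * (n + 1)) fun s' => HasLow n s' 1 := by
  unfold Searched at hs
  have hcn := hs.cnt_le
  have hc1 := (hs.order 0 hn (hvis 0 hn)).1
  rw [hs.root.1] at hc1
  refine ((achieves_exec (c := .copy iᵥ cntᵥ) rfl s).seq (T' := 20 * n + 1) ?_).mono
    (by simp [Cmd.cost]; omega) (fun _ => id)
  rintro s1 hs1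
  have hf1 : Frame lowTree s s1 := by
    rw [hs1]
    exact (exec_frame (c := .copy iᵥ cntᵥ) rfl s).weaken (by simp [Cmd.vars, lowTree])
      (by simp [Cmd.arrs])
  refine (achieves_while (b := .lt oneᵥ iᵥ) rfl (N := s.var cntᵥ - 1) (I := fun k s' =>
    s'.var iᵥ = k + 1 ∧ k + 1 ≤ s.var cntᵥ ∧ HasLow n s' (k + 1)) ?_ ?_).mono ?_ ?_
  · subst hs1
    rw [Nat.sub_add_cancel hc1]
    refine ⟨by simp [Cmd.exec], le_rfl, ?_⟩
    simpa [HasLow, Cmd.exec] using hlow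
  · rintro k s2 hf ⟨h1, h2, h3⟩ hb
    have hf2 := hf1.trans (hf.weaken (d := lowTree) (by simp [Cmd.vars, lowTree])
      (by simp [Cmd.arrs, lowTree]))
    have hin := h.of_frame (by decide) hf2
    have ea : s2.var arcsᵥ = s.var arcsᵥ := hf2.var _ (by decide)
    have es : s2.arr srcₐ = s.arr srcₐ := hf2.arr _ (by decide)
    have ed : s2.arr dstₐ = s.arr dstₐ := hf2.arr _ (by decide)
    have ep : s2.arr parₐ = s.arr parₐ := hf2.arr _ (by decide)
    have ee : s2.arr preₐ = s.arr preₐ := hf2.arr _ (by decide)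
    have eo : s2.arr ordₐ = s.arr ordₐ := hf2.arr _ (by decide)
    simp only [Test.holds, hin.var_one, h1, decide_eq_true_eq] at hb
    unfold HasLow at h3 ⊢
    rw [ea, es, ed, ep, ee] at h3
    obtain ⟨j, rfl⟩ : ∃ j, k = j + 1 := ⟨k - 1, by omega⟩
    have h4 := h3.step hs hvis (by omega) h2
    refine ⟨j, by omega, ?_⟩
    split_ifs at h4 with hc
    · simp only [Cmd.exec, Test.holds, h1, ne_eq, not_false_eq_true, var_setVar_self, arr_setVar,
        var_setVar_of_ne, Nat.reduceEqDiff, var_setArr, arr_setArr_self, arr_setArr_of_ne, ep, eo,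
        hc, decide_true, if_true, ea, es, ed, ee]
      exact ⟨by omega, by omega, h4⟩
    · simp only [Cmd.exec, Test.holds, h1, ne_eq, not_false_eq_true, var_setVar_self, arr_setVar,
        var_setVar_of_ne, Nat.reduceEqDiff, ep, eo, hc, decide_false, Bool.false_eq_true,
        if_false, ea, es, ed, ee]
      exact ⟨by omega, by omega, h4⟩
  · have : (s.var cntᵥ - 1) * 15 ≤ n * 15 := Nat.mul_le_mul_right _ (by omega)
    simp [Cmd.cost]
    omega
  · rintro s' ⟨hf, hb, k, h1, h2, h3⟩
    have hf2 := hf1.trans (hf.weaken (d := lowTree) (by simp [Cmd.vars, lowTree])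
      (by simp [Cmd.arrs, lowTree]))
    have hin := h.of_frame (by decide) hf2
    simp only [Test.holds, hin.var_one, h1, decide_eq_false_iff_not] at hb
    obtain rfl : k = 0 := by omega
    exact h3

/-- The vertex `v` is listed under the name `c`. -/
def Listed (s : Store) (v c : ℕ) : Prop :=
  ∃ k < s.var lenᵥ, s.arr vertexₐ k = v ∧ s.arr nameₐ k = c

theorem listed_listVertex (x c : ℕ) (s : Store) (v d : ℕ) :
    Listed ((listVertex x c).exec s) v d ↔ Listed s v d ∨ (v = s.var x ∧ d = s.var c) := by
  simp only [Listed, listVertex, Cmd.exec, var_setVar_self, var_setArr, arr_setVar,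
    arr_setArr_self, arr_setArr_of_ne, ne_eq, Nat.reduceEqDiff, not_false_eq_true]
  constructor
  · rintro ⟨k, hk, h1, h2⟩
    by_cases e : k = s.var lenᵥ
    · subst e
      rw [Function.update_self] at h1 h2
      exact Or.inr ⟨h1.symm, h2.symm⟩
    · rw [Function.update_of_ne e] at h1 h2
      exact Or.inl ⟨k, by omega, h1, h2⟩
  · rintro (⟨k, hk, h1, h2⟩ | ⟨rfl, rfl⟩)
    · refine ⟨k, by omega, ?_⟩
      rw [Function.update_of_ne (by omega), Function.update_of_ne (by omega)]
      exact ⟨h1, h2⟩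
    · exact ⟨s.var lenᵥ, by omega, by simp, by simp⟩

/-- The labels of the vertices with numbers at most `i` are in memory, and these vertices are listed
under their labels; a vertex that starts a new label is accompanied by its parent. -/
structure HasLabels (n : ℕ) (s : Store) (i : ℕ) : Prop where
  root : s.arr labₐ 0 = 0
  lab_eq : ∀ y < n, y ≠ 0 → s.arr preₐ y ≤ i → s.arr labₐ y =
    if s.arr lowₐ y < s.arr preₐ (s.arr parₐ y) then s.arr labₐ (s.arr parₐ y) else y
  listed : ∀ v c, Listed s v c ↔ ∃ y < n, y ≠ 0 ∧ s.arr preₐ y ≤ i ∧ c = s.arr labₐ y ∧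
    (v = y ∨ (¬ s.arr lowₐ y < s.arr preₐ (s.arr parₐ y) ∧ v = s.arr parₐ y))

/-- The effect of setting the label of the vertex with the number `i + 1`. -/
theorem HasLabels.step {i b x : ℕ} (h : HasLabels n s i) (hx0 : x ≠ 0) (hxn : x < n)
    (hxi : s.arr preₐ x = i + 1) (huniq : ∀ y < n, s.arr preₐ y = i + 1 → y = x)
    (hpar : ∀ y < n, y ≠ 0 → s.arr preₐ (s.arr parₐ y) < s.arr preₐ y)
    (hpre : s'.arr preₐ = s.arr preₐ) (hpa : s'.arr parₐ = s.arr parₐ)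
    (hlow : s'.arr lowₐ = s.arr lowₐ) (hlab : s'.arr labₐ = Function.update (s.arr labₐ) x b)
    (hb : b = if s.arr lowₐ x < s.arr preₐ (s.arr parₐ x) then s.arr labₐ (s.arr parₐ x) else x)
    (hlist : ∀ v c, Listed s' v c ↔ Listed s v c ∨ (c = b ∧ (v = x ∨
      (¬ s.arr lowₐ x < s.arr preₐ (s.arr parₐ x) ∧ v = s.arr parₐ x)))) :
    HasLabels n s' (i + 1) := by
  have hle : ∀ y < n, s.arr preₐ y ≤ i + 1 → y ≠ x → s.arr preₐ y ≤ i := by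
    intro y hy h1 h2
    by_contra hc
    exact h2 (huniq y hy (by omega))
  constructor
  · rw [hlab, Function.update_of_ne (Ne.symm hx0)]
    exact h.root
  · intro y hy hy0 hyi
    have h1 := hpar y hy hy0
    rw [hpre] at hyi
    have h2 : s.arr parₐ y ≠ x := by
      intro e
      rw [e] at h1
      omega
    rw [hpre, hpa, hlow, hlab, Function.update_of_ne h2]
    by_cases e : y = x
    · subst e
      rw [Function.update_self]
      exact hb
    · rw [Function.update_of_ne e]
      exact h.lab_eq y hy hy0 (hle y hy hyi e)
  · intro v c
    rw [hlist, h.listed, hpre, hpa, hlow, hlab]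
    constructor
    · rintro (⟨y, hy, hy0, hyi, h1, h2⟩ | ⟨h1, h2⟩)
      · refine ⟨y, hy, hy0, by omega, ?_, h2⟩
        rw [Function.update_of_ne]
        · exact h1
        · rintro rfl
          omega
      · exact ⟨x, hxn, hx0, hxi.le, by rw [Function.update_self]; exact h1, h2⟩
    · rintro ⟨y, hy, hy0, hyi, h1, h2⟩
      by_cases e : y = x
      · subst e
        rw [Function.update_self] at h1
        exact Or.inr ⟨h1, h2⟩
      · rw [Function.update_of_ne e] at h1
        exact Or.inl ⟨y, hy, hy0, hle y hy hyi e, h1, h2⟩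

theorem labelling_achieves (h : HoldsInput e s) (hs : Searched n s D)
    (hvis : ∀ y < n, s.arr preₐ y ≠ 0) (hn : 0 < n) :
    Achieves labelling s (40 * (n + 1)) fun s' => HasLabels n s' (s.var cntᵥ) := by
  have hcn := hs.cnt_le
  have hc1 := (hs.order 0 hn (hvis 0 hn)).1
  rw [hs.root.1] at hc1
  have hpar : ∀ y < n, y ≠ 0 → s.arr preₐ (s.arr parₐ y) < s.arr preₐ y := fun y hy hy0 =>
    (hs.parent y hy (hvis y hy) hy0).2.2.1
  refine (achieves_for (N := s.var cntᵥ) (j₀ := 1) (I := fun k s' => HasLabels n s' k) rfl rfl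
    (by decide) ?_ ?_ hc1 ?_ ?_).mono ?_ ?_
  · simp [Cmd.exec]
  · simp [Cmd.exec]
  · have hno : ∀ y < n, y ≠ 0 → ¬ s.arr preₐ y ≤ 1 := by
      intro y hy hy0 hle
      have := (hs.parent y hy (hvis y hy) hy0).2.1
      have := hpar y hy hy0
      omega
    constructor
    · simp [Cmd.exec, h.var_root]
    · intro y hy hy0 h1
      simp only [Cmd.exec, arr_setVar, arr_setArr_of_ne, ne_eq, Nat.reduceEqDiff,
        not_false_eq_true] at h1
      exact absurd h1 (hno y hy hy0)
    · intro v c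
      constructor
      · rintro ⟨k, hk, -⟩
        simp [Cmd.exec] at hk
      · rintro ⟨y, hy, hy0, h1, -⟩
        simp only [Cmd.exec, arr_setVar, arr_setArr_of_ne, ne_eq, Nat.reduceEqDiff,
          not_false_eq_true] at h1
        exact absurd h1 (hno y hy hy0)
  · intro k s1 hf hk hk1 hkn hI
    have ep : s1.arr parₐ = s.arr parₐ := hf.arr _ (by decide)
    have ee : s1.arr preₐ = s.arr preₐ := hf.arr _ (by decide)
    have eo : s1.arr ordₐ = s.arr ordₐ := hf.arr _ (by decide)
    obtain ⟨hxn, hxi⟩ := hs.order_inv (k + 1) (by omega) hkn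
    obtain ⟨x, hx⟩ : ∃ x, x = s.arr ordₐ (k + 1) := ⟨_, rfl⟩
    rw [← hx] at hxn hxi
    have hx0 : x ≠ 0 := by
      intro e
      rw [e, hs.root.1] at hxi
      omega
    have huniq : ∀ y < n, s1.arr preₐ y = k + 1 → y = x := by
      intro y hy hyk
      rw [ee] at hyk
      rw [hx, ← hyk, (hs.order y hy (hvis y hy)).2]
    rw [← ee] at hxi
    rw [← ee, ← ep] at hpar
    -- the memory before the test
    obtain ⟨s2, hs2⟩ : ∃ s2, s2 = (Cmd.inc iᵥ ;; .load xᵥ ordₐ iᵥ ;; .load yᵥ parₐ xᵥ ;;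
      .load pᵥ lowₐ xᵥ ;; .load qᵥ preₐ yᵥ).exec s1 := ⟨_, rfl⟩
    have hi2 : s2.var iᵥ = k + 1 := by simp [hs2, Cmd.exec, hk]
    have hx2 : s2.var xᵥ = x := by simp [hs2, Cmd.exec, hk, eo, hx]
    have hy2 : s2.var yᵥ = s1.arr parₐ x := by simp [hs2, Cmd.exec, hk, eo, hx]
    have hp2 : s2.var pᵥ = s1.arr lowₐ x := by simp [hs2, Cmd.exec, hk, eo, hx]
    have hq2 : s2.var qᵥ = s1.arr preₐ (s1.arr parₐ x) := by simp [hs2, Cmd.exec, hk, eo, hx]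
    have hl2 : s2.var lenᵥ = s1.var lenᵥ := by simp [hs2, Cmd.exec]
    have ha2 : s2.arr = s1.arr := by simp [hs2, Cmd.exec]
    have hL2 : ∀ v c, Listed s2 v c ↔ Listed s1 v c := by
      intro v c
      simp [Listed, ha2, hl2]
    have he : (Cmd.inc iᵥ ;; .load xᵥ ordₐ iᵥ ;; .load yᵥ parₐ xᵥ ;; .load pᵥ lowₐ xᵥ ;;
        .load qᵥ preₐ yᵥ ;; .ite (.lt pᵥ qᵥ) (.load bᵥ labₐ yᵥ)
          (.copy bᵥ xᵥ ;; listVertex yᵥ bᵥ) ;; .store labₐ xᵥ bᵥ ;; listVertex xᵥ bᵥ).exec s1 =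
        (listVertex xᵥ bᵥ).exec ((Cmd.store labₐ xᵥ bᵥ).exec
          ((Cmd.ite (.lt pᵥ qᵥ) (.load bᵥ labₐ yᵥ)
            (.copy bᵥ xᵥ ;; listVertex yᵥ bᵥ)).exec s2)) := by
      rw [hs2]
      rfl
    rw [he]
    clear he hs2
    by_cases hc : s1.arr lowₐ x < s1.arr preₐ (s1.arr parₐ x)
    · have h3 : (Cmd.ite (.lt pᵥ qᵥ) (.load bᵥ labₐ yᵥ)
          (.copy bᵥ xᵥ ;; listVertex yᵥ bᵥ)).exec s2 =
            s2.setVar bᵥ (s1.arr labₐ (s1.arr parₐ x)) := by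
        simp only [Cmd.exec, Test.holds, hp2, hq2, hc, decide_true, if_true, ha2, hy2]
      rw [h3]
      refine ⟨by simp [Cmd.exec, listVertex, hi2], ?_⟩
      refine hI.step (b := s1.arr labₐ (s1.arr parₐ x)) hx0 hxn hxi huniq hpar
        ?_ ?_ ?_ ?_ (by rw [if_pos hc]) ?_
      · simp [Cmd.exec, listVertex, ha2]
      · simp [Cmd.exec, listVertex, ha2]
      · simp [Cmd.exec, listVertex, ha2]
      · simp [Cmd.exec, listVertex, ha2, hx2]
      · intro v c
        rw [listed_listVertex, ← hL2 v c]
        simp [Cmd.exec, Listed, hx2, hc, and_comm]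
    · have h3 : (Cmd.ite (.lt pᵥ qᵥ) (.load bᵥ labₐ yᵥ)
          (.copy bᵥ xᵥ ;; listVertex yᵥ bᵥ)).exec s2 =
            (listVertex yᵥ bᵥ).exec (s2.setVar bᵥ x) := by
        simp only [Cmd.exec, Test.holds, hp2, hq2, hc, decide_false, Bool.false_eq_true, if_false,
          hx2]
      rw [h3]
      refine ⟨by simp [Cmd.exec, listVertex, hi2], ?_⟩
      refine hI.step (b := x) hx0 hxn hxi huniq hpar ?_ ?_ ?_ ?_ (by rw [if_neg hc]) ?_
      · simp [Cmd.exec, listVertex, ha2]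
      · simp [Cmd.exec, listVertex, ha2]
      · simp [Cmd.exec, listVertex, ha2]
      · simp [Cmd.exec, listVertex, ha2, hx2]
      · intro v c
        have h4 : ∀ s3 : Store, Listed ((Cmd.store labₐ xᵥ bᵥ).exec s3) v c ↔ Listed s3 v c := by
          intro s3
          simp [Listed, Cmd.exec]
        rw [listed_listVertex, h4,
          listed_listVertex, ← hL2 v c]
        have h5 : Listed (s2.setVar bᵥ x) v c ↔ Listed s2 v c := by simp [Listed]
        rw [h5]
        simp only [Cmd.exec, listVertex, var_setArr, var_setVar_self, ne_eq, Nat.reduceEqDiff,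
          not_false_eq_true, var_setVar_of_ne, hx2, hy2, hc, true_and]
        tauto
  · have : s.var cntᵥ * 30 ≤ n * 30 := Nat.mul_le_mul_right _ hcn
    simp [Cmd.cost, listVertex]
    omega
  · rintro s' ⟨-, hI⟩
    exact hI

end LowPrograms

/-! ### The components in memory -/

section Components

variable {n m : ℕ} {e : Fin m → Fin n × Fin n} {s s' : Store} {D : Finset ℕ}

/-- A finished search of the graph that has both directions of the edges of `F`, together with its
low numbers and labels, determines a depth-first search tree of the underlying graph of `(V, F)`
and a labelling of its blocks. -/
theorem exists_isBlockLabelling {F : Set (Fin n × Fin n)} {v : Fin n} (hv : (v : ℕ) = 0)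
    (hs : Searched n s D)
    (hvis : ∀ y < n, s.arr preₐ y ≠ 0) (hF : LinksBothWays F s) (hlow : HasLow n s 1)
    (hlab : HasLabels n s (s.var cntᵥ)) :
    ∃ (p lab : Fin n → Fin n) (pre low : Fin n → ℕ),
      (∀ y, pre y = s.arr preₐ y) ∧ (∀ y, low y = s.arr lowₐ y) ∧
      (∀ y, y ≠ v → (p y : ℕ) = s.arr parₐ y) ∧ (∀ y, (lab y : ℕ) = s.arr labₐ y) ∧
      IsDepthFirstTree (underlying F) v p pre ∧
      IsBlockLabelling (underlying F) v p pre low lab := by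
  have hne : ∀ y : Fin n, y ≠ v → (y : ℕ) ≠ 0 := fun y hy hc => hy (Fin.ext (hc.trans hv.symm))
  have hpre_le : ∀ y < n, s.arr preₐ y ≤ s.var cntᵥ := fun y hy => (hs.order y hy (hvis y hy)).1
  have hpar : ∀ y < n, y ≠ 0 → s.arr parₐ y < n ∧ s.arr preₐ (s.arr parₐ y) < s.arr preₐ y :=
    fun y hy hy0 => ⟨(hs.parent y hy (hvis y hy) hy0).1, (hs.parent y hy (hvis y hy) hy0).2.2.1⟩
  have hp : ∀ y : Fin n, ∃ z : Fin n, y ≠ v → (z : ℕ) = s.arr parₐ y := by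
    intro y
    by_cases hy : y = v
    · exact ⟨v, fun h => absurd hy h⟩
    · exact ⟨⟨_, (hpar y y.2 (hne y hy)).1⟩, fun _ => rfl⟩
  choose p hp using hp
  have hlabn : ∀ y < n, s.arr labₐ y < n := by
    intro y hy
    induction hk : s.arr preₐ y using Nat.strong_induction_on generalizing y with
    | _ k ih =>
      by_cases hy0 : y = 0
      · rw [hy0, hlab.root]
        omega
      · rw [hlab.lab_eq y hy hy0 (hpre_le y hy)]
        obtain ⟨h1, h2⟩ := hpar y hy hy0
        split_ifs
        · exact ih _ (hk ▸ h2) _ h1 rfl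
        · exact hy
  have hanc : ∀ a b : ℕ, SearchAncestor (s.arr parₐ) (s.arr preₐ) a b → ∀ hb : b < n,
      ∃ ha : a < n, Ancestor v p ⟨a, ha⟩ ⟨b, hb⟩ := by
    intro a b hab
    induction hab with
    | refl => exact fun hb => ⟨hb, .refl⟩
    | @tail b c _ hbc ih =>
      intro hc
      obtain ⟨hc0, hcv, rfl⟩ := hbc
      obtain ⟨ha, h1⟩ := ih (hpar c hc hc0).1
      have hcv' : (⟨c, hc⟩ : Fin n) ≠ v := fun e => hc0 (by rw [← hv, ← e])
      exact ⟨ha, h1.tail ⟨hcv', Fin.ext (hp _ hcv')⟩⟩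
  refine ⟨p, fun y => ⟨_, hlabn y y.2⟩, fun y => s.arr preₐ y, fun y => s.arr lowₐ y,
    fun _ => rfl, fun _ => rfl, hp, fun _ => rfl, ?_, ?_⟩
  · constructor
    · intro y hy
      obtain ⟨-, -, h1, h2, h3, h4, h5, -⟩ := hs.parent y y.2 (hvis y y.2) (hne y hy)
      obtain ⟨u, w, h6, h7, h8⟩ := hF.1 _ h2 h3
      have h9 : u = p y := Fin.ext (by rw [hp y hy, ← h4, h7])
      have h10 : w = y := Fin.ext (by rw [← h8, h5])
      subst h9
      subst h10
      refine underlying_adj.2 ⟨fun hc => ?_, h6⟩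
      rw [← hp w hy, hc] at h1
      exact lt_irrefl _ h1
    · intro y hy
      rw [hp y hy]
      exact (hpar y y.2 (hne y hy)).2
    · intro u w huw
      have h1 := (underlying_adj.1 huw).2
      obtain ⟨b, hb1, hb2, hb3, hb4⟩ := hF.2 u w h1
      obtain ⟨c, hc1, hc2, hc3, hc4⟩ := hF.2 w u h1.symm
      have h2 := hs.related b c hb1 hb2 hc1 hc2 (by rw [hc3, hb4]) (by rw [hc4, hb3])
        (by rw [hb3]; exact hvis u u.2) (by rw [hb4]; exact hvis w w.2)
      rw [hb3, hb4] at h2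
      exact h2.imp (fun h => (hanc _ _ h w.2).2) (fun h => (hanc _ _ h u.2).2)
  · constructor
    · intro x w hxw
      obtain ⟨b, hb1, hb2, hb3, hb4⟩ := hF.2 x w (underlying_adj.1 hxw).2
      have := hlow.low_le b hb1 hb2
      rwa [hb3, hb4] at this
    · intro y hy
      rw [hp y hy]
      refine hlow.low_parent_le y y.2 (hne y hy) ?_
      have h1 := (hs.parent y y.2 (hvis y y.2) (hne y hy)).2
      omega
    · intro x
      obtain ⟨z, hz, h1, h2⟩ := hlow.low_attained x x.2
      refine ⟨⟨z, hz⟩, (hanc _ _ h1 hz).2, ?_⟩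
      rcases h2 with h2 | ⟨b, hb1, hb2, hb3, hb4⟩
      · exact Or.inl h2
      · obtain ⟨u, w, h6, h7, h8⟩ := hF.1 b hb1 hb2
        have hu : u = ⟨z, hz⟩ := Fin.ext (by rw [← h7, hb3])
        subst hu
        rw [h8] at hb4
        by_cases e : (⟨z, hz⟩ : Fin n) = w
        · exact Or.inl (by rw [hb4, ← e])
        · exact Or.inr ⟨w, underlying_adj.2 ⟨e, h6⟩, hb4⟩
    · exact Fin.ext (by simp only [hv, hlab.root])
    · intro x hx
      have h1 := hlab.lab_eq x x.2 (hne x hx) (hpre_le x x.2)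
      rw [← hp x hx] at h1
      split_ifs with h2
      · rw [if_pos h2] at h1
        exact Fin.ext h1
      · rw [if_neg h2] at h1
        exact Fin.ext h1

/-- What the computation of the components leaves in memory: the list of the components, and labels
that tell whether two vertices lie in a common component. -/
structure HoldsBlocks (F : Set (Fin n × Fin n)) (s : Store) : Prop where
  components : (∃ u w : Fin n, u ≠ w) → HoldsComponents F s
  nonSep_iff : ∀ u w : Fin n, (∀ x, x ≠ u → x ≠ w → Avoids (underlying F) x u w) ↔
    (s.arr labₐ u = s.arr labₐ w ∨ s.arr parₐ (s.arr labₐ w) = u ∨ s.arr parₐ (s.arr labₐ u) = w)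

theorem holdsBlocks_of_labels {F : Set (Fin n × Fin n)}
    (hconn : ∀ u w, (digraphOf F).HasPath u w) {v : Fin n} (hv : (v : ℕ) = 0)
    (hs : Searched n s D)
    (hvis : ∀ y < n, s.arr preₐ y ≠ 0) (hF : LinksBothWays F s) (hlow : HasLow n s 1)
    (hlab : HasLabels n s (s.var cntᵥ)) : HoldsBlocks F s := by
  obtain ⟨p, lab, pre, low, epre, elow, ep, elb, ht, hl⟩ :=
    exists_isBlockLabelling hv hs hvis hF hlow hlab
  have : Nonempty (Fin n) := ⟨v⟩
  have hne : ∀ y : Fin n, y ≠ v → (y : ℕ) ≠ 0 := fun y hy hc => hy (Fin.ext (hc.trans hv.symm))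
  have hlisted : ∀ (u : Fin n) (c : ℕ), Listed s u c ↔
      ∃ y, y ≠ v ∧ c = lab y ∧ (u = y ∨ (lab y = y ∧ u = p y)) := by
    intro u c
    rw [hlab.listed]
    constructor
    · rintro ⟨y, hy, hy0, -, h1, h2⟩
      have hyv : (⟨y, hy⟩ : Fin n) ≠ v := fun e => hy0 (by rw [← hv, ← e])
      refine ⟨⟨y, hy⟩, hyv, by rw [h1, elb], ?_⟩
      rcases h2 with h2 | ⟨h2, h3⟩
      · exact Or.inl (Fin.ext h2)
      · right
        refine ⟨?_, Fin.ext (by rw [h3, ep _ hyv])⟩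
        have h4 : ¬ low ⟨y, hy⟩ < pre (p ⟨y, hy⟩) := by rw [elow, epre, ep _ hyv]; exact h2
        rw [hl.lab_eq _ hyv, if_neg h4]
    · rintro ⟨y, hy, rfl, h2⟩
      refine ⟨y, y.2, hne y hy, (hs.order y y.2 (hvis y y.2)).1, elb y, ?_⟩
      rcases h2 with rfl | ⟨h2, rfl⟩
      · exact Or.inl rfl
      · right
        have := ht.le_low_of_lab_eq_self hl hy h2
        rw [elow, epre, ep y hy] at this
        exact ⟨by omega, ep y hy⟩
  have hnames : ∀ c, c ∈ compNames s ↔ ∃ d : Fin n, d ≠ v ∧ lab d = d ∧ c = d := by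
    intro c
    have h0 : c ∈ compNames s ↔ ∃ k, Listed s k c := by
      simp [compNames, Listed]
    rw [h0]
    constructor
    · rintro ⟨k, hk⟩
      obtain ⟨y, hy, hy0, -, h1, -⟩ := (hlab.listed k c).1 hk
      have hyv : (⟨y, hy⟩ : Fin n) ≠ v := fun e => hy0 (by rw [← hv, ← e])
      obtain ⟨h2, h3, -⟩ := ht.lab_spec hl hyv
      exact ⟨lab ⟨y, hy⟩, h2, h3, by rw [h1, elb]⟩
    · rintro ⟨d, hd, hdl, rfl⟩
      exact ⟨d, (hlisted d d).2 ⟨d, hd, by rw [hdl], Or.inl rfl⟩⟩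
  have hverts : ∀ d : Fin n, d ≠ v → lab d = d → compVertices n s d = labelBlock p lab d := by
    intro d hd hdl
    ext u
    have h0 : u ∈ compVertices n s d ↔ Listed s u d := by
      simp only [compVertices, Listed, Set.mem_ofPred_eq]
      constructor <;> rintro ⟨k, h1, h2, h3⟩ <;> exact ⟨k, h1, h3, h2⟩
    rw [h0, hlisted]
    constructor
    · rintro ⟨y, hy, h1, rfl | ⟨h2, rfl⟩⟩
      · exact Or.inl (Fin.ext h1.symm)
      · exact Or.inr (by rw [Fin.ext h1, h2])
    · rintro (h1 | h1)
      · refine ⟨u, fun e => hd ?_, by rw [h1], Or.inl rfl⟩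
        rw [← h1, e, hl.lab_root]
      · exact ⟨d, hd, by rw [hdl], Or.inr ⟨hdl, h1⟩⟩
  constructor
  · rintro ⟨a, b, hab⟩
    have hV : ∃ y, y ≠ v := by
      by_cases ha : a = v
      · exact ⟨b, fun e => hab (ha.trans e.symm)⟩
      · exact ⟨a, ha⟩
    constructor
    · intro c hc
      obtain ⟨d, hd, hdl, rfl⟩ := (hnames c).1 hc
      rw [hverts d hd hdl, isSBComponent_iff_maximal_nonSep hconn]
      exact ht.maximal_nonSep_labelBlock hl hd hdl
    · intro S hS
      rw [isSBComponent_iff_maximal_nonSep hconn] at hS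
      obtain ⟨d, hd, hdl, rfl⟩ := ht.exists_labelBlock_of_maximal hl hV hS
      refine ⟨d, ⟨(hnames d).2 ⟨d, hd, hdl, rfl⟩, hverts d hd hdl⟩, ?_⟩
      rintro c ⟨hc, h1⟩
      obtain ⟨d', hd', hdl', rfl⟩ := (hnames c).1 hc
      rw [hverts d' hd' hdl'] at h1
      rw [ht.labelBlock_injective hd' hdl' hd hdl h1]
  · intro u w
    -- the parent of the root is stored as `n`, so that it equals no vertex
    have hpar : ∀ a b : Fin n, s.arr parₐ (s.arr labₐ a) = b ↔ a ≠ v ∧ p (lab a) = b := by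
      intro a b
      by_cases ha : a = v
      · rw [ha, hv, hlab.root, hs.root.2]
        have := b.2
        simp only [ne_eq, not_true_eq_false, false_and, iff_false]
        omega
      · rw [← elb a, ← ep _ (ht.lab_spec hl ha).1]
        simp [ha, Fin.ext_iff]
    rw [ht.nonSep_pair_iff hl u w, ← elb u, ← elb w, Fin.ext_iff]
    rw [elb u, elb w, hpar, hpar]

theorem components_achieves (h : HoldsInput e s) {F : Set (Fin n × Fin n)}
    (hF : HoldsEdges e edgesₐ F s) (hFe : F ⊆ Set.range e)
    (hconn : ∀ u w, (digraphOf F).HasPath u w) {v : Fin n} (hv : (v : ℕ) = 0) :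
    Achieves components s (400 * (n + m + 1)) (HoldsBlocks F) := by
  have hn : 0 < n := Nat.lt_of_le_of_lt (Nat.zero_le _) v.2
  refine ((clear_achieves h).frame.seq (T' := 300 * (n + m + 1)) ?_).mono (by omega) (fun _ => id)
  rintro s1 ⟨⟨hM1, hl1, hpre1⟩, hf1⟩
  have hin1 := h.of_frame (by decide) hf1
  have hF1 : HoldsEdges e edgesₐ F s1 := fun j => by
    rw [hf1.arr edgesₐ (by decide)]
    exact hF j
  refine ((linkChosen_achieves hin1 hl1 hM1 hF1 hFe).frame.seq (T' := 250 * (n + m + 1)) ?_).mono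
    (by omega) (fun _ => id)
  rintro s2 ⟨⟨hM2, hl2, hb2⟩, hf2⟩
  have hin2 := hin1.of_frame (by decide) hf2
  have epre : s2.arr preₐ = s1.arr preₐ := hf2.arr _ (by decide)
  refine ((search_achieves hn hin2 hl2 (by rw [epre]; exact hpre1)).frame.seq
    (T' := 150 * (n + m + 1)) ?_).mono (by omega) (fun _ => id)
  rintro s3 ⟨⟨hx3, D, hD⟩, hf3⟩
  have hin3 := hin2.of_frame (by decide) hf3
  have eM3 : s3.var arcsᵥ = s2.var arcsᵥ := hf3.var _ (by decide)
  have esrc3 : s3.arr srcₐ = s2.arr srcₐ := hf3.arr _ (by decide)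
  have edst3 : s3.arr dstₐ = s2.arr dstₐ := hf3.arr _ (by decide)
  have hb3 : LinksBothWays F s3 := by
    unfold LinksBothWays
    rw [eM3, esrc3, edst3]
    exact hb2
  have hs3 : Searched n s3 D := by
    unfold Searching at hD
    rw [hx3] at hD
    exact hD
  have hvis3 : ∀ y < n, s3.arr preₐ y ≠ 0 := by
    intro y hy
    refine SearchState.visited_of_reach hs3 hv (r := (digraphOf F).Adj) ?_ (hconn v ⟨y, hy⟩)
    exact fun u w huw => hb3.2 u w (Or.inl huw)
  refine ((lowInit_achieves hin3).frame.seq (T' := 130 * (n + m + 1)) ?_).mono (by omega)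
    (fun _ => id)
  rintro s4 ⟨hlow4, hf4⟩
  have hin4 := hin3.of_frame (by decide) hf4
  have hs4 := hs3.of_frame (by decide) (by decide) hf4
  have eM4 : s4.var arcsᵥ = s3.var arcsᵥ := hf4.var _ (by decide)
  refine ((lowArcs_achieves (n := n) (s := s4) ?_).frame.seq (T' := 80 * (n + m + 1)) ?_).mono
    (by omega) (fun _ => id)
  · rw [hf4.arr preₐ (by decide)]
    exact hlow4
  rintro s5 ⟨⟨hlow5, hatt5⟩, hf5⟩
  have hin5 := hin4.of_frame (by decide) hf5
  have hs5 := hs4.of_frame (by decide) (by decide) hf5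
  have epre5 : s5.arr preₐ = s3.arr preₐ := by
    rw [hf5.arr preₐ (by decide), hf4.arr preₐ (by decide)]
  have hlow5' : HasLow n s5 (s5.var cntᵥ) := by
    unfold HasLow
    rw [hf5.arr srcₐ (by decide), hf5.arr dstₐ (by decide), hf5.var arcsᵥ (by decide),
      hf5.arr preₐ (by decide)]
    refine ⟨hlow5, fun y hy hy0 hc => ?_, fun y hy => ⟨y, hy, .refl, hatt5 y hy⟩⟩
    have h1 := (hs5.order y hy (by rw [epre5]; exact hvis3 y hy)).1
    rw [hf5.arr preₐ (by decide)] at h1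
    omega
  refine ((lowTree_achieves hin5 hs5 (by rw [epre5]; exact hvis3) hn hlow5').frame.seq
    (T' := 40 * (n + 1)) ?_).mono (by omega) (fun _ => id)
  rintro s6 ⟨hlow6, hf6⟩
  have hin6 := hin5.of_frame (by decide) hf6
  have hs6 := hs5.of_frame (by decide) (by decide) hf6
  have hvis6 : ∀ y < n, s6.arr preₐ y ≠ 0 := by
    rw [hf6.arr preₐ (by decide), epre5]
    exact hvis3
  refine (labelling_achieves hin6 hs6 hvis6 hn).frame.mono le_rfl ?_
  rintro s7 ⟨hlab7, hf7⟩
  have hs7 := hs6.of_frame (by decide) (by decide) hf7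
  refine holdsBlocks_of_labels hconn hv hs7 ?_ ?_ ?_ ?_
  · rw [hf7.arr preₐ (by decide)]
    exact hvis6
  · unfold LinksBothWays
    rw [hf7.var arcsᵥ (by decide), hf7.arr srcₐ (by decide), hf7.arr dstₐ (by decide),
      hf6.var arcsᵥ (by decide), hf6.arr srcₐ (by decide), hf6.arr dstₐ (by decide),
      hf5.var arcsᵥ (by decide), hf5.arr srcₐ (by decide), hf5.arr dstₐ (by decide),
      hf4.var arcsᵥ (by decide), hf4.arr srcₐ (by decide), hf4.arr dstₐ (by decide)]
    exact hb3
  · unfold HasLow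
    rw [hf7.var arcsᵥ (by decide), hf7.arr srcₐ (by decide), hf7.arr dstₐ (by decide),
      hf7.arr parₐ (by decide), hf7.arr preₐ (by decide), hf7.arr lowₐ (by decide)]
    exact hlow6
  · rw [hf7.var cntᵥ (by decide)]
    exact hlab7

end Components

/-! ### The main loop -/

section MainLoop

variable {n m : ℕ} {e : Fin m → Fin n × Fin n} {s s' : Store}

/-- Edge `k` does not belong to the chosen set, and the labels of its ends tell that they lie in no
common component. -/
def Addable (s : Store) (k : ℕ) : Prop :=
  s.arr edgesₐ k = 0 ∧ s.arr labₐ (s.arr tailₐ k) ≠ s.arr labₐ (s.arr headₐ k) ∧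
    s.arr parₐ (s.arr labₐ (s.arr tailₐ k)) ≠ s.arr headₐ k ∧
    s.arr parₐ (s.arr labₐ (s.arr headₐ k)) ≠ s.arr tailₐ k

theorem findEdge_achieves (h : HoldsInput e s) :
    Achieves findEdge s (40 * (m + 1)) fun s' =>
      (s'.var foundᵥ = 0 ∧ ∀ k < m, ¬ Addable s k) ∨
      ∃ k < m, s'.var foundᵥ = k + 1 ∧ Addable s k := by
  refine (achieves_for (N := m) (j₀ := 0) (I := fun j s' =>
    (s'.var foundᵥ = 0 ∧ ∀ k < j, ¬ Addable s k) ∨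
      ∃ k < m, s'.var foundᵥ = k + 1 ∧ Addable s k) rfl rfl (by decide) ?_ ?_ (Nat.zero_le _)
      ?_ ?_).mono ?_ ?_
  · simp [Cmd.exec, h.var_m]
  · simp [Cmd.exec]
  · left
    simp [Cmd.exec]
  · intro j s1 hf hj _ hjm hI
    have hz := (h.of_frame (by decide) hf).var_zero
    have et : s1.arr tailₐ = s.arr tailₐ := hf.arr _ (by decide)
    have eh : s1.arr headₐ = s.arr headₐ := hf.arr _ (by decide)
    have ee : s1.arr edgesₐ = s.arr edgesₐ := hf.arr _ (by decide)
    have el : s1.arr labₐ = s.arr labₐ := hf.arr _ (by decide)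
    have ep : s1.arr parₐ = s.arr parₐ := hf.arr _ (by decide)
    have hkeep : ¬ Addable s j → ∀ f : ℕ, f = s1.var foundᵥ →
        (f = 0 ∧ ∀ k < j + 1, ¬ Addable s k) ∨ ∃ k < m, f = k + 1 ∧ Addable s k := by
      rintro hn f rfl
      refine hI.imp (fun h1 => ⟨h1.1, fun k hk => ?_⟩) id
      rcases Nat.lt_succ_iff_lt_or_eq.1 hk with h2 | rfl
      · exact h1.2 k h2
      · exact hn
    by_cases h1 : s.arr edgesₐ j = 0
    swap
    · refine ⟨by simp [Cmd.exec, Test.holds, hj, ee, hz, h1], hkeep (fun ha => h1 ha.1) _ ?_⟩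
      simp [Cmd.exec, Test.holds, hj, ee, hz, h1]
    by_cases h2 : s.arr labₐ (s.arr tailₐ j) = s.arr labₐ (s.arr headₐ j)
    · refine ⟨by simp [Cmd.exec, Test.holds, hj, ee, hz, et, eh, el, h1, h2],
        hkeep (fun ha => ha.2.1 h2) _ ?_⟩
      simp [Cmd.exec, Test.holds, hj, ee, hz, et, eh, el, h1, h2]
    by_cases h3 : s.arr parₐ (s.arr labₐ (s.arr tailₐ j)) = s.arr headₐ j
    · refine ⟨by simp [Cmd.exec, Test.holds, hj, ee, hz, et, eh, el, ep, h1, h2, h3],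
        hkeep (fun ha => ha.2.2.1 h3) _ ?_⟩
      simp [Cmd.exec, Test.holds, hj, ee, hz, et, eh, el, ep, h1, h2, h3]
    by_cases h4 : s.arr parₐ (s.arr labₐ (s.arr headₐ j)) = s.arr tailₐ j
    · refine ⟨by simp [Cmd.exec, Test.holds, hj, ee, hz, et, eh, el, ep, h1, h2, h3, h4],
        hkeep (fun ha => ha.2.2.2 h4) _ ?_⟩
      simp [Cmd.exec, Test.holds, hj, ee, hz, et, eh, el, ep, h1, h2, h3, h4]
    refine ⟨by simp [Cmd.exec, Test.holds, hj, ee, hz, et, eh, el, ep, h1, h2, h3, h4],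
      Or.inr ⟨j, hjm, ?_, h1, h2, h3, h4⟩⟩
    simp [Cmd.exec, Test.holds, hj, ee, hz, et, eh, el, ep, h1, h2, h3, h4]
  · simp [Cmd.cost]; omega
  · rintro s' ⟨-, hI⟩
    exact hI

/-- Edge `j` is not in `F`, and some vertex separates its ends in `(V, F)`. -/
def IsSeparatedEdge (e : Fin m → Fin n × Fin n) (F : Set (Fin n × Fin n)) (j : Fin m) : Prop :=
  e j ∉ F ∧ ∃ x, x ≠ (e j).1 ∧ x ≠ (e j).2 ∧ ¬ Avoids (underlying F) x (e j).1 (e j).2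

theorem addable_iff (h : HoldsInput e s) {F : Set (Fin n × Fin n)} (hF : HoldsEdges e edgesₐ F s)
    (hB : HoldsBlocks F s) (j : Fin m) : Addable s j ↔ IsSeparatedEdge e F j := by
  have h1 : s.arr edgesₐ j = 0 ↔ e j ∉ F := by
    rw [← hF j]
    simp
  have h2 := (hB.nonSep_iff (e j).1 (e j).2).not
  push Not at h2
  rw [Addable, IsSeparatedEdge, h1, h.tail j, h.head j, h2]
  tauto

theorem addEdge_achieves (h : HoldsInput e s) (he : Function.Injective e) (hrun : s.var runᵥ ≠ 0)
    {F : Set (Fin n × Fin n)} (hF : HoldsEdges e edgesₐ F s) (hB : HoldsBlocks F s) :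
    Achieves addEdge s (50 * (m + 1)) fun s' =>
      (s'.var runᵥ = 0 ∧ HoldsEdges e edgesₐ F s' ∧ ∀ j, ¬ IsSeparatedEdge e F j) ∨
      (s'.var runᵥ ≠ 0 ∧ ∃ j, IsSeparatedEdge e F j ∧
        HoldsEdges e edgesₐ (insert (e j) F) s') := by
  refine ((findEdge_achieves h).frame.seq (T' := 4) ?_).mono (by omega) (fun _ => id)
  rintro s1 ⟨h1, hf1⟩
  have hin := h.of_frame (by decide) hf1
  have hrun1 : s1.var runᵥ ≠ 0 := by
    rw [hf1.var _ (by decide)]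
    exact hrun
  have hF1 : HoldsEdges e edgesₐ F s1 := fun j => by
    rw [hf1.arr edgesₐ (by decide)]
    exact hF j
  refine (achieves_exec rfl s1).mono (by simp [Cmd.cost]) ?_
  rintro _ rfl
  rcases h1 with ⟨h2, h3⟩ | ⟨k, hk, h2, h3⟩
  · left
    have hex : (Cmd.ite (.ne foundᵥ zeroᵥ) (.dec foundᵥ ;; .store edgesₐ foundᵥ oneᵥ)
        (.const runᵥ 0)).exec s1 = s1.setVar runᵥ 0 := by
      simp [Cmd.exec, Test.holds, h2, hin.var_zero]
    rw [hex]
    exact ⟨by simp, by simpa [HoldsEdges] using hF1,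
      fun j hj => h3 j j.2 ((addable_iff h hF hB j).2 hj)⟩
  · right
    have hex : (Cmd.ite (.ne foundᵥ zeroᵥ) (.dec foundᵥ ;; .store edgesₐ foundᵥ oneᵥ)
        (.const runᵥ 0)).exec s1 = (s1.setVar foundᵥ k).setArr edgesₐ k 1 := by
      simp [Cmd.exec, Test.holds, h2, hin.var_zero, hin.var_one]
    rw [hex]
    refine ⟨by simpa using hrun1, ⟨k, hk⟩, (addable_iff h hF hB ⟨k, hk⟩).1 h3, fun j => ?_⟩
    simp only [arr_setArr_self, arr_setVar, Set.mem_insert_iff]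
    by_cases hj : (j : ℕ) = k
    · subst hj
      simp
    · rw [Function.update_of_ne hj, hF1 j]
      refine ⟨Or.inr, fun h4 => h4.resolve_left fun h5 => hj ?_⟩
      rw [he h5]

/-- From any moment when the main loop is about to be tested, the program carries out the rest of a
run of the algorithm. -/
theorem mainLoop_runs (hE : (digraphOf (Set.range e)).StronglyBiconnected)
    (he : Function.Injective e) {v : Fin n} (hv : (v : ℕ) = 0) (N : ℕ) :
    ∀ (s : Store) (F : Set (Fin n × Fin n)), (Set.range e \ F).ncard ≤ N → HoldsInput e s →
      s.var runᵥ ≠ 0 → HoldsEdges e edgesₐ F s → F ⊆ Set.range e →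
      (∀ u w, (digraphOf F).HasPath u w) →
      ∃ (k : ℕ) (Fs : ℕ → Set (Fin n × Fin n)) (t c : ℕ → ℕ) (tEnd : ℕ) (sEnd : Store),
        Fs 0 = F ∧ t 0 = 0 ∧ (∀ i < k, AugmentStep (Set.range e) (Fs i) (Fs (i + 1))) ∧
        IsBiconnected (underlying (Fs k)) ∧
        (∀ i ≤ k, HoldsEdges e edgesₐ (Fs i) (step^[t i] ⟨[mainLoop], s⟩).mem) ∧
        (∀ i < k, t i ≤ c i ∧ c i ≤ t (i + 1) ∧ t (i + 1) ≤ t i + 500 * (n + m + 1) ∧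
          HoldsComponents (Fs i) (step^[c i] ⟨[mainLoop], s⟩).mem) ∧
        t k ≤ tEnd ∧ tEnd ≤ t k + 500 * (n + m + 1) ∧
        step^[tEnd] ⟨[mainLoop], s⟩ = ⟨[], sEnd⟩ ∧ HoldsEdges e edgesₐ (Fs k) sEnd := by
  induction N using Nat.strong_induction_on with
  | _ N ih =>
  intro s F hN hin hrun hF hFe hconn
  have : Nonempty (Fin n) := ⟨v⟩
  obtain ⟨t₁, ht₁, s₁, hr₁, hB, hf₁⟩ := (components_achieves hin hF hFe hconn hv).frame
  have hin₁ := hin.of_frame (by decide) hf₁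
  have hF₁ : HoldsEdges e edgesₐ F s₁ := fun j => by
    rw [hf₁.arr edgesₐ (by decide)]
    exact hF j
  have hrun₁ : s₁.var runᵥ ≠ 0 := by
    rw [hf₁.var _ (by decide)]
    exact hrun
  obtain ⟨t₂, ht₂, s₂, hr₂, hQ, hf₂⟩ := (addEdge_achieves hin₁ he hrun₁ hF₁ hB).frame
  have hin₂ := hin₁.of_frame (by decide) hf₂
  have hstart : step^[2] ⟨[mainLoop], s⟩ = ⟨[components, addEdge, mainLoop], s⟩ := by
    simp [mainLoop, step, Test.holds, hin.var_zero, hrun]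
  have hmid : step^[2 + t₁] ⟨[mainLoop], s⟩ = ⟨[addEdge, mainLoop], s₁⟩ :=
    iterate_add_of_eq hstart (hr₁ _)
  have hpass : step^[2 + t₁ + t₂] ⟨[mainLoop], s⟩ = ⟨[mainLoop], s₂⟩ :=
    iterate_add_of_eq hmid (hr₂ _)
  rcases hQ with ⟨hrun₂, hF₂, hno⟩ | ⟨hrun₂, j, ⟨hjF, x, hx1, hx2, hx⟩, hF₂⟩
  · -- no separated edge is left, so the graph is biconnected
    refine ⟨0, fun _ => F, fun _ => 0, fun _ => 0, 2 + t₁ + t₂ + 1, s₂, rfl, rfl,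
      fun i hi => absurd hi (Nat.not_lt_zero i), ?_, ?_, fun i hi => absurd hi (Nat.not_lt_zero i),
      Nat.zero_le _, by omega, ?_, hF₂⟩
    · by_contra hn
      obtain ⟨u, w, ⟨j, hj⟩, x, hx1, hx2, hx⟩ := exists_separated_edge hE hconn hn
      refine hno j ⟨fun hjF => hx ?_, x, by rw [hj]; exact hx1, by rw [hj]; exact hx2,
        by rw [hj]; exact hx⟩
      rw [hj] at hjF
      by_cases huw : u = w
      · exact huw ▸ .refl _
      · exact .of_adj (underlying_adj.2 ⟨huw, Or.inl hjF⟩) hx1.symm hx2.symm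
    · intro i _
      exact hF
    · refine iterate_add_of_eq hpass ?_
      simp [mainLoop, step, Test.holds, hin₂.var_zero, hrun₂]
  · -- an edge has been added; the rest of the run starts with the larger set
    have hne : (e j).1 ≠ (e j).2 := fun h => hx (h ▸ .refl _)
    have hlt : (Set.range e \ insert (e j) F).ncard < N := by
      refine lt_of_lt_of_le (Set.ncard_lt_ncard ?_ (Set.toFinite _)) hN
      refine ⟨Set.sdiff_subset_sdiff_right (Set.subset_insert _ _), fun hc => ?_⟩
      exact (hc ⟨⟨j, rfl⟩, hjF⟩).2 (Set.mem_insert _ _)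
    obtain ⟨k, Fs, t, c, tEnd, sEnd, h1, h2, h3, h4, h5, h6, h7, h8, h9, h10⟩ :=
      ih _ hlt s₂ (insert (e j) F) le_rfl hin₂ hrun₂ hF₂
        (Set.insert_subset ⟨j, rfl⟩ hFe)
        (fun u w => Relation.ReflTransGen.mono (fun a b hab => Or.inr hab) _ _ (hconn u w))
    have hshift : ∀ t', step^[2 + t₁ + t₂ + t'] ⟨[mainLoop], s⟩ = step^[t'] ⟨[mainLoop], s₂⟩ :=
      fun t' => iterate_add_of_eq hpass rfl
    refine ⟨k + 1, fun i => Nat.casesOn i F Fs,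
      fun i => Nat.casesOn i 0 fun i => 2 + t₁ + t₂ + t i,
      fun i => Nat.casesOn i (2 + t₁) fun i => 2 + t₁ + t₂ + c i,
      2 + t₁ + t₂ + tEnd, sEnd, rfl, rfl, ?_, h4, ?_, ?_, ?_, ?_, ?_, h10⟩
    · rintro (_ | i) hi
      · have := augmentStep_insert hconn (E := Set.range e) ⟨j, rfl⟩ hx1 hx2 hx
        show AugmentStep _ F (Fs 0)
        rw [h1]
        exact this
      · exact h3 i (by omega)
    · rintro (_ | i) hi
      · exact hF
      · show HoldsEdges e edgesₐ (Fs i) (step^[2 + t₁ + t₂ + t i] ⟨[mainLoop], s⟩).mem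
        rw [hshift]
        exact h5 i (by omega)
    · rintro (_ | i) hi
      · show 0 ≤ 2 + t₁ ∧ 2 + t₁ ≤ 2 + t₁ + t₂ + t 0 ∧
          2 + t₁ + t₂ + t 0 ≤ 0 + 500 * (n + m + 1) ∧
          HoldsComponents F (step^[2 + t₁] ⟨[mainLoop], s⟩).mem
        rw [h2, hmid]
        exact ⟨by omega, by omega, by omega, hB.components ⟨_, _, hne⟩⟩
      · show 2 + t₁ + t₂ + t i ≤ 2 + t₁ + t₂ + c i ∧
          2 + t₁ + t₂ + c i ≤ 2 + t₁ + t₂ + t (i + 1) ∧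
          2 + t₁ + t₂ + t (i + 1) ≤ 2 + t₁ + t₂ + t i + 500 * (n + m + 1) ∧
          HoldsComponents (Fs i) (step^[2 + t₁ + t₂ + c i] ⟨[mainLoop], s⟩).mem
        obtain ⟨h11, h12, h13, h14⟩ := h6 i (by omega)
        rw [hshift]
        exact ⟨by omega, by omega, by omega, h14⟩
    · show 2 + t₁ + t₂ + t k ≤ _
      omega
    · show _ ≤ 2 + t₁ + t₂ + t k + _
      omega
    · rw [hshift]
      exact h9

end MainLoop

end RAM

/-! ### The running time -/

/-- A strongly connected graph with at least two vertices has at least as many edges as vertices. -/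
theorem card_le_card_of_hasPath {n m : ℕ} {e : Fin m → Fin n × Fin n}
    (h : ∀ u w, (digraphOf (Set.range e)).HasPath u w) (hn : 2 ≤ n) : n ≤ m := by
  have hsurj : Function.Surjective fun j => (e j).1 := by
    intro u
    have : Nontrivial (Fin n) := Fin.nontrivial_iff_two_le.2 hn
    obtain ⟨w, hw⟩ := exists_ne u
    rcases Relation.ReflTransGen.cases_head (h u w) with e1 | ⟨x, ⟨j, hj⟩, -⟩
    · exact absurd e1.symm hw
    · exact ⟨j, by simp [hj]⟩
  simpa using Fintype.card_le_of_surjective _ hsurj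

namespace RAM

theorem augmentationProgram_executes {n m : ℕ} {e : Fin m → Fin n × Fin n} (he : Function.Injective e)
    (hE : (digraphOf (Set.range e)).StronglyBiconnected) :
    ∃ (v : Fin n) (T T' : Set (Fin n × Fin n)) (k : ℕ) (F : ℕ → Set (Fin n × Fin n)),
      CompleteRun (Set.range e) v T T' k F ∧
      Executes augmentationProgram e v T T' k F (10000 * (n + m)) (10000 * max 1 (n * m)) := by
  obtain ⟨u₀⟩ := hE.1
  have hn : 0 < n := Nat.lt_of_le_of_lt (Nat.zero_le _) u₀.2
  obtain ⟨v, hv⟩ : ∃ v : Fin n, (v : ℕ) = 0 := ⟨⟨0, hn⟩, rfl⟩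
  set s₀ : Store := inputStore e with hs₀
  set sA : Store := (Cmd.const oneᵥ 1 ;; .const rootᵥ 0).exec s₀ with hsA
  have hinA : HoldsInput e sA := by
    constructor <;> simp [hsA, Cmd.exec, hs₀, inputStore]
  have hA0 : ∀ a j, 2 ≤ a → sA.arr a j = 0 := by
    intro a j ha
    simp only [hsA, Cmd.exec, arr_setVar, hs₀, inputStore]
    split_ifs <;> omega
  -- the first tree
  obtain ⟨t₁, ht₁, s₁, hr₁, ⟨T, hT, hTm, hTe⟩, hf₁⟩ := (spanningTree_achieves hinA hv
    (Or.inl rfl) (Or.inr rfl) (Or.inl rfl) he hinA.tail hinA.head (fun w => hE.2.1 v w)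
    (fun j => hA0 _ _ (by omega))).frame
  have hin₁ := hinA.of_frame (by
    simp [Cmd.KeepsInput, Cmd.vars, Cmd.arrs, RAM.push, linkAll, spanningTree, clear, search,
      searchStep, markTree]) hf₁
  -- the second tree
  have hrev : Set.range (fun j => (e j).swap) = revEdges (Set.range e) := by
    ext q
    constructor
    · rintro ⟨j, rfl⟩
      exact ⟨j, by simp⟩
    · rintro ⟨j, hj⟩
      exact ⟨j, by simp [hj]⟩
  have hreach' : ∀ w, (digraphOf (Set.range fun j => (e j).swap)).HasPath v w := by
    intro w
    rw [hrev]
    exact Relation.reflTransGen_swap.1 (hE.2.1 w v)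
  have h30 : ∀ j : Fin m, s₁.arr revTreeₐ j = 0 := by
    intro j
    rw [hf₁.arr revTreeₐ (by decide)]
    exact hA0 _ _ (by omega)
  obtain ⟨t₂, ht₂, s₂, hr₂, ⟨T', hT', hTm', hTe'⟩, hf₂⟩ := (spanningTree_achieves hin₁ hv
    (e' := fun j => (e j).swap) (Or.inr rfl) (Or.inl rfl) (Or.inr rfl)
    (Prod.swap_injective.comp he) hin₁.head hin₁.tail hreach' h30).frame
  rw [hrev] at hT'
  have hin₂ := hin₁.of_frame (by
    simp [Cmd.KeepsInput, Cmd.vars, Cmd.arrs, RAM.push, linkAll, spanningTree, clear, search,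
      searchStep, markTree]) hf₂
  -- the start of the main loop
  have hinB : HoldsInput e (s₂.setVar runᵥ 1) :=
    hin₂.of_frame (c := .const runᵥ 1) (by decide) (exec_frame rfl s₂)
  have hF0 : HoldsEdges e edgesₐ (T ∪ revEdges T') (s₂.setVar runᵥ 1) := by
    intro j
    rw [arr_setVar, hTe' j, hTe j, hA0 _ _ (by omega)]
    simp [revEdges]
  have hFe : T ∪ revEdges T' ⊆ Set.range e := by
    rintro q (hq | hq)
    · exact hT.subset hq
    · obtain ⟨j, hj⟩ := hT'.subset hq
      exact ⟨j, by simpa using hj⟩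
  obtain ⟨k, F, t, c, tEnd, sEnd, h1, h2, h3, h4, h5, h6, h7, h8, h9, h10⟩ :=
    mainLoop_runs hE he hv _ (s₂.setVar runᵥ 1) _ le_rfl hinB (by simp) hF0 hFe
      (hasPath_of_trees hT hT' le_rfl)
  have hrun : PartialRun (Set.range e) v T T' k F := ⟨hT, hT', h1, h3⟩
  have hk := hrun.le_card
  rw [Fintype.card_fin] at hk
  refine ⟨v, T, T', k, F, ⟨hrun, h4⟩, ?_⟩
  -- the configurations at the ends of the parts
  have hc0 : step^[5] ⟨[augmentationProgram], s₀⟩ = ⟨[spanningTree tailₐ headₐ treeₐ,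
    spanningTree headₐ tailₐ revTreeₐ ;; .const runᵥ 1 ;; mainLoop], sA⟩ := rfl
  have hca := iterate_add_of_eq hc0 (hr₁ _)
  have hca' : step^[5 + t₁ + 1] ⟨[augmentationProgram], s₀⟩ = ⟨[spanningTree headₐ tailₐ revTreeₐ,
    .const runᵥ 1 ;; mainLoop], s₁⟩ := iterate_add_of_eq hca rfl
  have hcb := iterate_add_of_eq hca' (hr₂ _)
  have hct : step^[5 + t₁ + 1 + t₂ + 2] ⟨[augmentationProgram], s₀⟩ =
    ⟨[mainLoop], s₂.setVar runᵥ 1⟩ := iterate_add_of_eq hcb rfl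
  have hshift : ∀ t', step^[5 + t₁ + 1 + t₂ + 2 + t'] ⟨[augmentationProgram], s₀⟩ =
      step^[t'] ⟨[mainLoop], s₂.setVar runᵥ 1⟩ := fun t' => iterate_add_of_eq hct rfl
  have hend := (hshift tEnd).trans h9
  -- the time of all iterations together
  have htime : ∀ i ≤ k, t i ≤ i * (500 * (n + m + 1)) := by
    intro i
    induction i with
    | zero => intro _; omega
    | succ i ih =>
      intro hi
      have h11 := ih (by omega)
      have h12 := (h6 i (by omega)).2.2.1
      rw [Nat.succ_mul]
      exact h12.trans (Nat.add_le_add_right h11 _)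
  have htotal : 5 + t₁ + 1 + t₂ + 2 + tEnd ≤ 10000 * max 1 (n * m) := by
    have h11 : t k ≤ n * (500 * (n + m + 1)) :=
      (htime k le_rfl).trans (Nat.mul_le_mul_right _ hk)
    rcases Nat.lt_or_ge n 2 with h13 | h13
    · obtain rfl : n = 1 := by omega
      have h14 : m ≤ 1 := by simpa using Fintype.card_le_of_injective e he
      have := Nat.le_max_left 1 (1 * m)
      omega
    · have h14 := card_le_card_of_hasPath hE.2.1 h13
      have h15 := Nat.le_max_right 1 (n * m)
      have h16 : n * (n + m + 1) ≤ n * (3 * m) := Nat.mul_le_mul_left _ (by omega)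
      have h17 : n * (500 * (n + m + 1)) ≤ 1500 * (n * m) := by
        calc n * (500 * (n + m + 1)) = 500 * (n * (n + m + 1)) := by ring
          _ ≤ 500 * (n * (3 * m)) := Nat.mul_le_mul_left _ h16
          _ = 1500 * (n * m) := by ring
      have h18 := h11.trans h17
      have h19 : 2 * m ≤ n * m := Nat.mul_le_mul_right _ h13
      omega
  refine ⟨5 + t₁, 5 + t₁ + 1 + t₂, fun i => 5 + t₁ + 1 + t₂ + 2 + t i,
    fun i => 5 + t₁ + 1 + t₂ + 2 + c i, 5 + t₁ + 1 + t₂ + 2 + tEnd,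
    ⟨by omega, Nat.le_trans (Nat.le_add_right _ 2) (Nat.le_add_right _ _), ?_⟩, ⟨?_, ?_⟩, ?_,
    ?_, ?_, ⟨?_, ?_, htotal⟩, ?_, ?_⟩
  · simp only [h2]
    omega
  · simp only [memAt, configAt, ← hs₀, hca, hin₁.var_root, hv]
  · simp only [memAt, configAt, ← hs₀, hca]
    exact hTm
  · simp only [memAt, configAt, ← hs₀, hcb]
    exact fun j => hTm' j
  · intro i hi
    simp only [memAt, configAt, ← hs₀, hshift]
    exact h5 i hi
  · intro i hi
    obtain ⟨h11, h12, h13, h14⟩ := h6 i hi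
    simp only [memAt, configAt, ← hs₀, hshift]
    exact ⟨by omega, by omega, by omega, h14⟩
  · simp only
    omega
  · simp only
    omega
  · simp only [HaltedAt, configAt, ← hs₀, hend]
  · simp only [memAt, configAt, ← hs₀, hend]
    exact h10

end RAM

theorem mainTheorem5 :
    -- whatever choices are made, the while loop can always go on until it is left,
    -- and it runs at most `n` times
    (∀ (n : ℕ) (E : Set (Fin n × Fin n)), (digraphOf E).StronglyBiconnected →
      ∀ (v : Fin n) (T T' : Set (Fin n × Fin n)) (k : ℕ) (F : ℕ → Set (Fin n × Fin n)),
        PartialRun E v T T' k F →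
          k ≤ n ∧
          (¬ IsBiconnected (digraphOf (F k)).toSimpleGraphInclusive →
            ∃ F' : Set (Fin n × Fin n), AugmentStep E (F k) F')) ∧
    -- one fixed program carries out the algorithm on every input: linear time for the trees and for
    -- each iteration, and `O(n * m)` in total
    (∃ (P : RAM.Cmd) (C : ℕ), ∀ (n m : ℕ) (e : Fin m → Fin n × Fin n), Function.Injective e →
      (digraphOf (Set.range e)).StronglyBiconnected →
      ∃ (v : Fin n) (T T' : Set (Fin n × Fin n)) (k : ℕ) (F : ℕ → Set (Fin n × Fin n)),
        CompleteRun (Set.range e) v T T' k F ∧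
        RAM.Executes P e v T T' k F (C * (n + m)) (C * max 1 (n * m))) := by
  refine ⟨fun n E hE v T T' k F h => ⟨?_, h.exists_augmentStep hE⟩, RAM.augmentationProgram, 10000, ?_⟩
  · simpa using h.le_card
  · exact fun n m e he hE => RAM.augmentationProgram_executes he hE
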